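/- **Exact recovery in mixed linear regression.** For every $\mu>1$, every $\kappa\ge 0$ and every $R$ there are constants $c_1,c_2,c_3>0$, depending only on $\mu,\kappa,R$, such that the following holds for all $n,p$. Let $\beta_1^*,\beta_2^*\in\mathbb{R}^p$ and let $\{1,\dots,n\}=\mathcal I_1\sqcup\mathcal I_2$ be a fixed partition with $n_b=|\mathcal I_b|$, $n_1\le R\,n_2$ and $n_2\le R\,n_1$. Let $x_1,\dots,x_n\in\mathbb{R}^p$ be random vectors whose entries $x_i(l)$ ($1\le i\le n$, $1\le l\le p$) are i.i.d. with mean zero, $\mathbb E[x_i(l)^2]=1$, $\mathbb E[x_i(l)^4]=\mu$ and sub-Gaussian norm $\sup_{q\ge1}q^{-1/2}(\mathbb E|x_i(l)|^q)^{1/q}\le\kappa$. Let $y_i=\langle x_i,\beta_b^*\rangle$ for $i\in\mathcal I_b$, $b=1,2$ (no noise). Put $$\alpha=\frac{\|\beta_1^*-\beta_2^*\|_2^2}{\|\beta_1^*\|_2^2+\|\beta_2^*\|_2^2}$$ and assume $\alpha>0$ and $\min\{n_1,n_2\}\ge c_3\,p/\alpha$. Consider the convex program (with $\eta=0$) $$\min_{K\in\mathbb{R}^{p\times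 p},\,g\in\mathbb{R}^p}\|K\|_*\quad\text{subject to}\quad\sum_{i=1}^n\left|-\langle x_ix_i^\top,K\rangle+2y_i\langle x_i,g\rangle-y_i^2\right|\le 0,$$ where $\|\cdot\|_*$ is the nuclear norm. Given an optimal solution $(\hat K,\hat g)$, Algorithm 1, applied to the symmetric part $\frac12(\hat K+\hat K^\top)$ (which is $\hat K$ itself when $\hat K$ is symmetric) and $\hat g$, computes the largest eigenvalue $\hat\lambda$ and a corresponding unit eigenvector $\hat v$ of $\hat J=\hat g\hat g^\top-\frac12(\hat K+\hat K^\top)$, and outputs $\hat\beta_1,\hat\beta_2=\hat g\pm\sqrt{\hat\lambda}\,\hat v$. Then, with probability at least $1-c_1e^{-c_2n}$, an optimal solution exists and, for every optimal solution and every choice of the eigenvector, the output satisfies $\{\hat\beta_1,\hat\beta_2\}=\{\beta_1^*,\beta_2^*\}$. -/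

import Mathlib

open MeasureTheory ProbabilityTheory
open scoped ENNReal NNReal

namespace MixedRegression

noncomputable section

/-- The sub-Gaussian norm `‖X‖_{ψ₂} = sup_{q ≥ 1} q^{-1/2} (𝔼|X|^q)^{1/q}`, with values in
`[0, ∞]`. -/
def subGaussianNorm {Ω : Type*} [MeasurableSpace Ω] (P : Measure Ω) (X : Ω → ℝ) : ℝ≥0∞ :=
  ⨆ (q : ℝ≥0) (_ : 1 ≤ q), eLpNorm X (q : ℝ≥0∞) P / ENNReal.ofReal (Real.sqrt q)

/-- The covariates `x₁, …, xₙ ∈ ℝᵖ` have i.i.d. entries (over all `i` and `l`) with mean zero, unit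
variance, fourth moment `μ` and sub-Gaussian norm at most `κ`. -/
structure IsDesign {Ω : Type*} [MeasurableSpace Ω] (P : Measure Ω) {n p : ℕ}
    (x : Fin n → Ω → EuclideanSpace ℝ (Fin p)) (μ : ℝ) (κ : ℝ≥0) : Prop where
  measurable : ∀ i, Measurable (x i)
  indep : iIndepFun (fun (a : Fin n × Fin p) (ω : Ω) => x a.1 ω a.2) P
  identDistrib : ∀ a b : Fin n × Fin p,
    IdentDistrib (fun ω => x a.1 ω a.2) (fun ω => x b.1 ω b.2) P P
  mean : ∀ i l, ∫ ω, x i ω l ∂P = 0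
  variance : ∀ i l, ∫ ω, (x i ω l) ^ 2 ∂P = 1
  fourth_moment : ∀ i l, ∫ ω, (x i ω l) ^ 4 ∂P = μ
  subGaussian : ∀ i l, subGaussianNorm P (fun ω => x i ω l) ≤ κ

/-- The observation model: `yᵢ = ⟨xᵢ, β_b⟩ + eᵢ` for `i ∈ I_b`, `b = 1, 2`. -/
def IsObservation {n p : ℕ} (β₁ β₂ : EuclideanSpace ℝ (Fin p)) (I₁ I₂ : Finset (Fin n))
    (e : Fin n → ℝ) (x : Fin n → EuclideanSpace ℝ (Fin p)) (y : Fin n → ℝ) : Prop :=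
  (∀ i ∈ I₁, y i = inner ℝ (x i) β₁ + e i) ∧ (∀ i ∈ I₂, y i = inner ℝ (x i) β₂ + e i)

/-- `α = ‖β₁ - β₂‖² / (‖β₁‖² + ‖β₂‖²)`. -/
def alpha {p : ℕ} (β₁ β₂ : EuclideanSpace ℝ (Fin p)) : ℝ :=
  ‖β₁ - β₂‖ ^ 2 / (‖β₁‖ ^ 2 + ‖β₂‖ ^ 2)

/-- The outer product `u uᵀ`. -/
def outer {p : ℕ} (u : EuclideanSpace ℝ (Fin p)) : Matrix (Fin p) (Fin p) ℝ :=
  Matrix.vecMulVec u.ofLp u.ofLp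

/-- The matrix inner product `⟨A, B⟩ = tr (Aᵀ B)`. -/
def matInner {p : ℕ} (A B : Matrix (Fin p) (Fin p) ℝ) : ℝ :=
  (A.transpose * B).trace

/-- The nuclear norm: the sum of the singular values. -/
def nuclearNorm {p : ℕ} (A : Matrix (Fin p) (Fin p) ℝ) : ℝ :=
  ∑ i : Fin p, (Matrix.toEuclideanLin A).singularValues i

/-- The constraint `∑ᵢ |-⟨xᵢ xᵢᵀ, K⟩ + 2 yᵢ ⟨xᵢ, g⟩ - yᵢ²| ≤ η` of the convex program. -/
def IsFeasible {n p : ℕ} (x : Fin n → EuclideanSpace ℝ (Fin p)) (y : Fin n → ℝ) (η : ℝ)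
    (K : Matrix (Fin p) (Fin p) ℝ) (g : EuclideanSpace ℝ (Fin p)) : Prop :=
  ∑ i, |-matInner (outer (x i)) K + 2 * y i * inner ℝ (x i) g - y i ^ 2| ≤ η

/-- `(K, g)` is an optimal solution of the convex program: minimize `‖K‖_*` over all
`(K, g) ∈ ℝ^{p × p} × ℝᵖ` subject to the constraint. -/
def IsOptimal {n p : ℕ} (x : Fin n → EuclideanSpace ℝ (Fin p)) (y : Fin n → ℝ) (η : ℝ)
    (K : Matrix (Fin p) (Fin p) ℝ) (g : EuclideanSpace ℝ (Fin p)) : Prop :=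
  IsFeasible x y η K g ∧ ∀ K' g', IsFeasible x y η K' g' → nuclearNorm K ≤ nuclearNorm K'

/-- `(lam, v)` is a first eigenvalue-eigenvector pair of `J`: `lam` is the largest eigenvalue and
`v` is a unit eigenvector for it. -/
def IsFirstEigenpair {p : ℕ} (J : Matrix (Fin p) (Fin p) ℝ) (lam : ℝ)
    (v : EuclideanSpace ℝ (Fin p)) : Prop :=
  ‖v‖ = 1 ∧ Matrix.toEuclideanLin J v = lam • v ∧
    ∀ ν : ℝ, Module.End.HasEigenvalue (Matrix.toEuclideanLin J) ν → ν ≤ lam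

/-- `(b₁, b₂)` is a possible output of the estimation algorithm on the input `(K, g)`:
`b₁, b₂ = g ± √lam v` for a first eigenpair `(lam, v)` of `J = g gᵀ - K`. -/
def IsAlgorithmOutput {p : ℕ} (K : Matrix (Fin p) (Fin p) ℝ) (g b₁ b₂ : EuclideanSpace ℝ (Fin p)) :
    Prop :=
  ∃ (lam : ℝ) (v : EuclideanSpace ℝ (Fin p)), IsFirstEigenpair (outer g - K) lam v ∧
    b₁ = g + Real.sqrt lam • v ∧ b₂ = g - Real.sqrt lam • v

/-- The symmetric part `(K + Kᵀ) / 2` of a matrix; a symmetric matrix is its own symmetric part. -/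
def symPart {p : ℕ} (K : Matrix (Fin p) (Fin p) ℝ) : Matrix (Fin p) (Fin p) ℝ :=
  (1 / 2 : ℝ) • (K + K.transpose)

/-- `(b₁, b₂)` is a possible outcome of the whole procedure on the data `(x, y)`: solve the convex
program, then run the estimation algorithm on the solution. The constraint sees `K` only through
its symmetric part, and the eigenpair in the algorithm is that of a symmetric matrix, so the
symmetric part of the optimal `K` is what the algorithm receives. -/
def IsEstimate {n p : ℕ} (x : Fin n → EuclideanSpace ℝ (Fin p)) (y : Fin n → ℝ) (η : ℝ)
    (b₁ b₂ : EuclideanSpace ℝ (Fin p)) : Prop :=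
  ∃ K g, IsOptimal x y η K g ∧ IsAlgorithmOutput (symPart K) g b₁ b₂

end

end MixedRegression

set_option linter.unusedSectionVars false

namespace MixedRegression

/-! ### Hilbert–Schmidt and nuclear norms of endomorphisms, and their duality. -/

section LinearAlgebra

open LinearMap Module

variable {E : Type*} [NormedAddCommGroup E] [InnerProductSpace ℝ E] [FiniteDimensional ℝ E]

/-! Let `T` be the symmetric part of a feasible matrix no worse than the target `symRk β₁ β₂`. Put
`H = T - symRk β₁ β₂` and let `h` be `g` minus the midpoint of `β₁, β₂`. Writing `D_b = H - (β_b hᵀ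
+ h β_bᵀ)`, the constraint on sample `b` says exactly that `⟨x, D_b x⟩ = 0` for every covariate `x`
of that sample. So it suffices that, for one `b`, the quadratic measurements annihilate no nonzero
matrix of the type of `D_b`, and that `D_b = 0` forces `H = 0` and `h = 0`.

The deterministic half bounds the ratio of nuclear to Hilbert–Schmidt norm of `D_b`. Since the
target has rank at most two and `H` does not increase its nuclear norm, `nuc H` is at most a
constant times `hsNorm H` (`nuc_le_of_nuc_add_le`). The difference of `D_1` and `D_2` is `δ hᵀ + h
δᵀ` with `δ = β₁ - β₂`, so the larger of the two controls `‖δ‖ ‖h‖`, hence also `β_b hᵀ` and `H`, at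
a cost of `1/√α`. This gives `nuc D_b ≤ (31/√α) hsNorm D_b` for that `b`
(`exists_component_nuc_le`).

The probabilistic half (`exists_forall_exists_inner_ne_zero`) is a small-ball argument. With `hsNorm
D = 1` and `D` symmetric, `⟨x, D x⟩` has variance at least `min (μ - 1) 2`, which is where `μ > 1`
enters, and a fourth moment comparable to the square of its second moment. So the mean of `min |⟨x,
D x⟩| τ` is bounded below uniformly (`exists_le_integral_min_abs`). The truncated empirical process
concentrates by McDiarmid's inequality. Its mean deviation is bounded, after symmetrization and
contraction, by the nuclear norm times the operator norm of `∑ ε_k x_k x_kᵀ`, which is of order `√(m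
p)` by a net argument (`integral_ciSup_signed_quadratic_le`). With `nuc D ≤ L` this is negligible
once `m` is a large multiple of `L² p`, that is of `p/α`.

Applied to both samples, this makes the symmetric part and `g` unique. Then `g gᵀ - K` equals `δ δᵀ
/ 4`, whose top eigenvector gives back `±δ/2`, and the output is the pair `β₁, β₂` in one of the two
orders. -/

/-- The Hilbert–Schmidt inner product `tr (A† B)` of two endomorphisms. -/
noncomputable def hsInner (A B : E →ₗ[ℝ] E) : ℝ :=
  LinearMap.trace ℝ E (A.adjoint ∘ₗ B)

/-- An endomorphism of operator norm at most one. -/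
def IsContr (B : E →ₗ[ℝ] E) : Prop := ∀ v, ‖B v‖ ≤ ‖v‖

theorem hsInner_eq_sum {ι : Type*} [Fintype ι] (b : OrthonormalBasis ι ℝ E) (A B : E →ₗ[ℝ] E) :
    hsInner A B = ∑ i, inner ℝ (A (b i)) (B (b i)) := by
  rw [hsInner, trace_eq_sum_inner _ b]
  simp [LinearMap.adjoint_inner_right]

theorem hsInner_add_right (A B C : E →ₗ[ℝ] E) :
    hsInner A (B + C) = hsInner A B + hsInner A C := by
  simp [hsInner, LinearMap.comp_add]

theorem hsInner_sub_right (A B C : E →ₗ[ℝ] E) :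
    hsInner A (B - C) = hsInner A B - hsInner A C := by
  simp [hsInner, LinearMap.comp_sub]

theorem hsInner_smul_right (c : ℝ) (A B : E →ₗ[ℝ] E) :
    hsInner A (c • B) = c * hsInner A B := by
  simp [hsInner, LinearMap.comp_smul]

theorem hsInner_neg_right (A B : E →ₗ[ℝ] E) : hsInner A (-B) = -hsInner A B := by
  simp [hsInner, LinearMap.comp_neg]

theorem hsInner_comm (A B : E →ₗ[ℝ] E) : hsInner A B = hsInner B A := by
  rw [hsInner_eq_sum (stdOrthonormalBasis ℝ E), hsInner_eq_sum (stdOrthonormalBasis ℝ E)]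
  simp only [real_inner_comm]

theorem hsInner_add_left (A B C : E →ₗ[ℝ] E) :
    hsInner (A + B) C = hsInner A C + hsInner B C := by
  simp only [hsInner_comm _ C, hsInner_add_right]

theorem hsInner_neg_left (A B : E →ₗ[ℝ] E) : hsInner (-A) B = -hsInner A B := by
  simp only [hsInner_comm _ B, hsInner_neg_right]

theorem hsInner_smul_left (c : ℝ) (A B : E →ₗ[ℝ] E) :
    hsInner (c • A) B = c * hsInner A B := by
  simp only [hsInner_comm _ B, hsInner_smul_right]

theorem hsInner_comp_left (A B C : E →ₗ[ℝ] E) :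
    hsInner (A ∘ₗ B) C = hsInner B (A.adjoint ∘ₗ C) := by
  simp [hsInner, LinearMap.adjoint_comp, LinearMap.comp_assoc]

theorem hsInner_comp_right (A B C : E →ₗ[ℝ] E) :
    hsInner (A ∘ₗ B) C = hsInner A (C ∘ₗ B.adjoint) := by
  simp only [hsInner, LinearMap.adjoint_comp, LinearMap.comp_assoc]
  exact LinearMap.trace_mul_comm ℝ (B.adjoint) (A.adjoint ∘ₗ C)

theorem hsInner_adjoint (A B : E →ₗ[ℝ] E) : hsInner A.adjoint B.adjoint = hsInner A B := by
  rw [hsInner_comm A B]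
  simp only [hsInner, LinearMap.adjoint_adjoint]
  exact LinearMap.trace_mul_comm ℝ A B.adjoint

theorem hsInner_self_nonneg (A : E →ₗ[ℝ] E) : 0 ≤ hsInner A A := by
  rw [hsInner_eq_sum (stdOrthonormalBasis ℝ E)]
  exact Finset.sum_nonneg fun i _ => real_inner_self_nonneg

theorem eq_zero_of_hsInner_self_eq_zero {A : E →ₗ[ℝ] E} (h : hsInner A A = 0) : A = 0 := by
  rw [hsInner_eq_sum (stdOrthonormalBasis ℝ E),
    Finset.sum_eq_zero_iff_of_nonneg fun i _ => real_inner_self_nonneg] at h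
  refine (stdOrthonormalBasis ℝ E).toBasis.ext fun i => ?_
  simpa using h i (Finset.mem_univ i)

/-- The Hilbert–Schmidt norm. -/
noncomputable def hsNorm (A : E →ₗ[ℝ] E) : ℝ := √(hsInner A A)

theorem hsNorm_nonneg (A : E →ₗ[ℝ] E) : 0 ≤ hsNorm A := Real.sqrt_nonneg _

theorem sq_hsNorm (A : E →ₗ[ℝ] E) : hsNorm A ^ 2 = hsInner A A :=
  Real.sq_sqrt (hsInner_self_nonneg A)

theorem hsInner_le (A B : E →ₗ[ℝ] E) : hsInner A B ≤ hsNorm A * hsNorm B := by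
  have key : ∀ t : ℝ, 0 ≤ hsNorm B ^ 2 * (t * t) + (2 * hsInner A B) * t + hsNorm A ^ 2 := by
    intro t
    have := hsInner_self_nonneg (A + t • B)
    simp only [hsInner_add_left, hsInner_add_right, hsInner_smul_left, hsInner_smul_right,
      hsInner_comm B A] at this
    rw [sq_hsNorm, sq_hsNorm]
    linarith
  have h := discrim_le_zero key
  simp only [discrim] at h
  refine le_of_sq_le_sq ?_ (mul_nonneg (hsNorm_nonneg A) (hsNorm_nonneg B))
  nlinarith

theorem hsNorm_add_le (A B : E →ₗ[ℝ] E) : hsNorm (A + B) ≤ hsNorm A + hsNorm B := by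
  refine le_of_sq_le_sq ?_ (add_nonneg (hsNorm_nonneg A) (hsNorm_nonneg B))
  rw [sq_hsNorm]
  simp only [hsInner_add_left, hsInner_add_right, hsInner_comm B A]
  have := hsInner_le A B
  rw [← sq_hsNorm, ← sq_hsNorm]
  nlinarith

theorem hsNorm_smul (c : ℝ) (A : E →ₗ[ℝ] E) : hsNorm (c • A) = |c| * hsNorm A := by
  rw [hsNorm, hsNorm, hsInner_smul_left, hsInner_smul_right, ← mul_assoc,
    Real.sqrt_mul (mul_self_nonneg c), Real.sqrt_mul_self_eq_abs]

theorem hsNorm_neg (A : E →ₗ[ℝ] E) : hsNorm (-A) = hsNorm A := by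
  rw [hsNorm, hsNorm, hsInner_neg_left, hsInner_neg_right, neg_neg]

theorem IsContr.adjoint {B : E →ₗ[ℝ] E} (hB : IsContr B) : IsContr B.adjoint := by
  intro v
  have h : ‖B.adjoint v‖ * ‖B.adjoint v‖ ≤ ‖v‖ * ‖B.adjoint v‖ := by
    rw [← real_inner_self_eq_norm_mul_norm, LinearMap.adjoint_inner_right, mul_comm]
    exact (real_inner_le_norm _ _).trans (by gcongr; exact hB _)
  rcases (norm_nonneg (B.adjoint v)).eq_or_lt with h0 | h0
  · rw [← h0]; exact norm_nonneg v
  · exact le_of_mul_le_mul_right h h0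

theorem IsContr.comp {A B : E →ₗ[ℝ] E} (hA : IsContr A) (hB : IsContr B) : IsContr (A ∘ₗ B) :=
  fun v => (hA _).trans (hB v)

theorem IsContr.neg {B : E →ₗ[ℝ] E} (hB : IsContr B) : IsContr (-B) :=
  fun v => by simpa using hB v

/-- The sum of the singular values of an endomorphism. -/
noncomputable def nuc (T : E →ₗ[ℝ] E) : ℝ := ∑ i : Fin (finrank ℝ E), T.singularValues i

theorem norm_apply_eigenvectorBasis (T : E →ₗ[ℝ] E) (i : Fin (finrank ℝ E)) :
    ‖T (T.isSymmetric_adjoint_comp_self.eigenvectorBasis rfl i)‖ = T.singularValues i := by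
  rw [T.singularValues_fin rfl, eq_comm,
    Real.sqrt_eq_iff_mul_self_eq (T.isPositive_adjoint_comp_self.nonneg_eigenvalues rfl i)
      (norm_nonneg _), ← real_inner_self_eq_norm_mul_norm, ← LinearMap.adjoint_inner_right,
    ← LinearMap.comp_apply, T.isSymmetric_adjoint_comp_self.apply_eigenvectorBasis]
  simp [inner_smul_right]

theorem inner_apply_eigenvectorBasis (T : E →ₗ[ℝ] E) {i j : Fin (finrank ℝ E)} (hij : i ≠ j) :
    inner ℝ (T (T.isSymmetric_adjoint_comp_self.eigenvectorBasis rfl i))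
      (T (T.isSymmetric_adjoint_comp_self.eigenvectorBasis rfl j)) = 0 := by
  rw [← LinearMap.adjoint_inner_right,
    ← LinearMap.comp_apply, T.isSymmetric_adjoint_comp_self.apply_eigenvectorBasis,
    inner_smul_right, OrthonormalBasis.inner_eq_zero _ hij, mul_zero]

/-- Compute the trace in a basis of right singular vectors of `T`: each term is at most the
corresponding singular value by Cauchy–Schwarz. -/
theorem hsInner_le_nuc {B : E →ₗ[ℝ] E} (hB : IsContr B) (T : E →ₗ[ℝ] E) :
    hsInner B T ≤ nuc T := by
  set b := T.isSymmetric_adjoint_comp_self.eigenvectorBasis rfl with hb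
  rw [hsInner_eq_sum b, nuc]
  refine Finset.sum_le_sum fun i _ => ?_
  rw [← norm_apply_eigenvectorBasis]
  refine (real_inner_le_norm _ _).trans ?_
  have : ‖B (b i)‖ ≤ 1 := (hB _).trans (by simp)
  exact mul_le_of_le_one_left (norm_nonneg _) this

/-- The polar part of `T` attains the duality: each right singular vector goes to its normalized
image. Where the singular value is zero, the inverse is zero too and the vector goes to zero, so the
images remain orthogonal with norm at most one. -/
theorem exists_isContr_hsInner_eq_nuc (T : E →ₗ[ℝ] E) :
    ∃ B : E →ₗ[ℝ] E, IsContr B ∧ hsInner B T = nuc T := by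
  set b := T.isSymmetric_adjoint_comp_self.eigenvectorBasis rfl with hb
  set f : Fin (finrank ℝ E) → E := fun i => (T.singularValues i)⁻¹ • T (b i) with hf
  have hff : ∀ i j, i ≠ j → inner ℝ (f i) (f j) = 0 := fun i j hij => by
    simp [hf, inner_smul_left, inner_smul_right, hb, inner_apply_eigenvectorBasis T hij]
  have hfn : ∀ i, ‖f i‖ ≤ 1 := fun i => by
    rw [hf, norm_smul, norm_apply_eigenvectorBasis, norm_inv,
      Real.norm_of_nonneg (T.singularValues_nonneg i)]
    exact inv_mul_le_one
  set B : E →ₗ[ℝ] E := b.toBasis.constr ℝ f with hB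
  have hBb : ∀ i, B (b i) = f i := fun i => by
    rw [hB, ← b.coe_toBasis, Basis.constr_basis]
  refine ⟨B, fun v => ?_, ?_⟩
  · have hv : B v = ∑ i, inner ℝ (b i) v • f i := by
      conv_lhs => rw [← b.sum_repr' v]
      simp [hBb]
    refine le_of_sq_le_sq ?_ (norm_nonneg v)
    rw [← b.sum_sq_norm_inner_right v, ← real_inner_self_eq_norm_sq, hv, sum_inner]
    refine Finset.sum_le_sum fun i _ => ?_
    rw [inner_sum, Finset.sum_eq_single i]
    · rw [inner_smul_left, inner_smul_right, real_inner_self_eq_norm_sq, Real.norm_eq_abs, sq_abs]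
      have : ‖f i‖ ^ 2 ≤ 1 := pow_le_one₀ (norm_nonneg _) (hfn i)
      simp only [conj_trivial]
      nlinarith [sq_nonneg (inner ℝ (b i) v)]
    · intro j _ hj
      simp [inner_smul_left, inner_smul_right, hff i j hj.symm]
    · simp
  · rw [hsInner_eq_sum b, nuc]
    refine Finset.sum_congr rfl fun i _ => ?_
    rw [hBb, hf, inner_smul_left, real_inner_self_eq_norm_mul_norm, norm_apply_eigenvectorBasis]
    simp only [conj_trivial]
    rcases eq_or_ne (T.singularValues i) 0 with h | h
    · simp [h]
    · field_simp

/-- A contraction that is extremal for the symmetric part is tested against `T`, and its adjoint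
likewise. This reduces the program to symmetric operators, since the quadratic measurements do not
see the antisymmetric part. -/
theorem nuc_symm_le (T : E →ₗ[ℝ] E) : nuc ((1 / 2 : ℝ) • (T + T.adjoint)) ≤ nuc T := by
  obtain ⟨B, hB, h⟩ := exists_isContr_hsInner_eq_nuc ((1 / 2 : ℝ) • (T + T.adjoint))
  have h1 := hsInner_le_nuc hB T
  have h2 := hsInner_le_nuc hB.adjoint T
  rw [← h, hsInner_smul_right, hsInner_add_right]
  rw [← hsInner_adjoint, LinearMap.adjoint_adjoint] at h2
  linarith

theorem hsNorm_adjoint (A : E →ₗ[ℝ] E) : hsNorm A.adjoint = hsNorm A := by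
  rw [hsNorm, hsNorm, hsInner_adjoint]

/-- The rank-one endomorphism `z ↦ ⟨y, z⟩ x`. -/
noncomputable def rk (x y : E) : E →ₗ[ℝ] E := (InnerProductSpace.rankOne ℝ x y).toLinearMap

@[simp]
theorem rk_apply (x y z : E) : rk x y z = (inner ℝ y z : ℝ) • x := rfl

theorem adjoint_rk (x y : E) : (rk x y).adjoint = rk y x := by
  refine ((LinearMap.eq_adjoint_iff _ _).2 fun u v => ?_).symm
  simp only [rk_apply, inner_smul_left, inner_smul_right, conj_trivial]
  rw [real_inner_comm x u, mul_comm]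

theorem hsInner_rk (B : E →ₗ[ℝ] E) (x y : E) : hsInner B (rk x y) = inner ℝ (B y) x := by
  have : B.adjoint ∘ₗ rk x y = rk (B.adjoint x) y := by
    ext z; simp
  rw [hsInner, this, rk, InnerProductSpace.trace_rankOne, LinearMap.adjoint_inner_right]

theorem hsInner_rk_rk (a b x y : E) :
    hsInner (rk a b) (rk x y) = inner ℝ a x * inner ℝ b y := by
  rw [hsInner_rk, rk_apply, inner_smul_left, conj_trivial, mul_comm]

theorem hsNorm_rk (x y : E) : hsNorm (rk x y) = ‖x‖ * ‖y‖ := by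
  rw [hsNorm, hsInner_rk_rk, real_inner_self_eq_norm_mul_norm, real_inner_self_eq_norm_mul_norm,
    Real.sqrt_eq_iff_mul_self_eq (by positivity) (by positivity)]
  ring

theorem hsInner_rk_le {B : E →ₗ[ℝ] E} (hB : IsContr B) (x y : E) :
    hsInner B (rk x y) ≤ ‖x‖ * ‖y‖ := by
  rw [hsInner_rk, mul_comm]
  exact (real_inner_le_norm _ _).trans (by gcongr; exact hB y)

/-! ### Perturbations that do not increase the nuclear norm of a low-rank operator. -/

section Cone

variable (V : Submodule ℝ E)

/-- The orthogonal projection onto a subspace as an endomorphism. -/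
noncomputable def projOn : E →ₗ[ℝ] E := V.starProjection.toLinearMap

theorem projOn_apply (v : E) : projOn V v = V.starProjection v := rfl

theorem adjoint_projOn : (projOn V).adjoint = projOn V :=
  ((LinearMap.eq_adjoint_iff _ _).2 fun u v => V.inner_starProjection_left_eq_right u v).symm

theorem adjoint_sub_projOn : (LinearMap.id - projOn V).adjoint = LinearMap.id - projOn V := by
  refine ((LinearMap.eq_adjoint_iff _ _).2 fun u v => ?_).symm
  simp only [LinearMap.sub_apply, LinearMap.id_apply, inner_sub_left, inner_sub_right, projOn_apply,
    V.inner_starProjection_left_eq_right]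

theorem projOn_projOn (v : E) : projOn V (projOn V v) = projOn V v :=
  V.starProjection_eq_self_iff.2 (V.starProjection_apply_mem v)

theorem projOn_comp_self : projOn V ∘ₗ projOn V = projOn V := by
  ext v
  exact projOn_projOn V v

theorem sub_projOn_apply_projOn (v : E) :
    (LinearMap.id - projOn V : E →ₗ[ℝ] E) (projOn V v) = 0 := by
  simp [projOn_projOn]

theorem projOn_apply_sub_projOn (v : E) :
    projOn V ((LinearMap.id - projOn V : E →ₗ[ℝ] E) v) = 0 := by
  simp [projOn_projOn]

theorem isContr_projOn : IsContr (projOn V) := fun v => V.norm_starProjection_apply_le v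

theorem norm_sq_projOn_add (v : E) :
    ‖projOn V v‖ ^ 2 + ‖(LinearMap.id - projOn V : E →ₗ[ℝ] E) v‖ ^ 2 = ‖v‖ ^ 2 := by
  rw [V.norm_sq_eq_add_norm_sq_starProjection v, V.starProjection_orthogonal_val]
  rfl

theorem isContr_sub_projOn : IsContr (LinearMap.id - projOn V) := fun v =>
  le_of_sq_le_sq (by nlinarith [norm_sq_projOn_add V v, sq_nonneg ‖projOn V v‖]) (norm_nonneg v)

theorem hsInner_projOn_self : hsInner (projOn V) (projOn V) = finrank ℝ V := by
  rw [hsInner, adjoint_projOn, projOn_comp_self]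
  refine LinearMap.IsProj.trace (p := V) ⟨fun v => ?_, fun v hv => ?_⟩
  · exact V.starProjection_apply_mem v
  · exact V.starProjection_eq_self_iff.2 hv

/-- After taking adjoints, the contraction acts on the image of the projection and can only shrink
its columns; the squared Hilbert–Schmidt norm of the projection is the dimension of `V`. -/
theorem hsNorm_projOn_comp_le {B : E →ₗ[ℝ] E} (hB : IsContr B) :
    hsNorm (projOn V ∘ₗ B) ≤ √(finrank ℝ V) := by
  refine Real.sqrt_le_sqrt ?_
  rw [← hsInner_projOn_self, ← hsInner_adjoint, LinearMap.adjoint_comp, adjoint_projOn,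
    hsInner_eq_sum (stdOrthonormalBasis ℝ E), hsInner_eq_sum (stdOrthonormalBasis ℝ E)]
  refine Finset.sum_le_sum fun i _ => ?_
  rw [real_inner_self_eq_norm_sq, real_inner_self_eq_norm_sq]
  gcongr
  exact hB.adjoint _

/-- With `P` the projection on `V` and `Q = 1 - P`, pairing `K + H` with a dual certificate gives
`nuc (Q H Q) ≤ √r · hsNorm H`, where `r = dim V`. The remaining pieces `P H` and `Q H P` each have a
factor `P`, hence cost `√r · hsNorm H` each, which explains the 3. -/
theorem nuc_le_of_nuc_add_le {K H : E →ₗ[ℝ] E} (hK : projOn V ∘ₗ K ∘ₗ projOn V = K)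
    (h : nuc (K + H) ≤ nuc K) : nuc H ≤ 3 * √(finrank ℝ V) * hsNorm H := by
  set P := projOn V with hP
  set Q : E →ₗ[ℝ] E := LinearMap.id - P with hQ
  have hPc : IsContr P := isContr_projOn V
  have hQc : IsContr Q := isContr_sub_projOn V
  have hPa : P.adjoint = P := adjoint_projOn V
  have hQa : Q.adjoint = Q := adjoint_sub_projOn V
  have hsand : ∀ A C S T : E →ₗ[ℝ] E,
      hsInner (S ∘ₗ A ∘ₗ T) C = hsInner A (S.adjoint ∘ₗ C ∘ₗ T.adjoint) := fun A C S T => by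
    rw [hsInner_comp_left, hsInner_comp_right, LinearMap.comp_assoc]
  obtain ⟨A, hA, hAK⟩ := exists_isContr_hsInner_eq_nuc K
  obtain ⟨W, hW, hWH⟩ := exists_isContr_hsInner_eq_nuc (Q ∘ₗ H ∘ₗ Q)
  obtain ⟨B, hB, hBH⟩ := exists_isContr_hsInner_eq_nuc H
  have hQK : Q ∘ₗ K ∘ₗ Q = 0 := by
    rw [← hK]
    ext v
    simp only [LinearMap.comp_apply, LinearMap.zero_apply]
    exact sub_projOn_apply_projOn V _
  -- The dual certificate: `A` is extremal for `K` and `W` for `Q H Q`. The two blocks live on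
  -- orthogonal subspaces, so Pythagoras makes their sum a contraction.
  have hc : IsContr (P ∘ₗ A ∘ₗ P + Q ∘ₗ W ∘ₗ Q) := by
    intro v
    refine le_of_sq_le_sq ?_ (norm_nonneg v)
    rw [← norm_sq_projOn_add V v,
      ← norm_sq_projOn_add V ((P ∘ₗ A ∘ₗ P + Q ∘ₗ W ∘ₗ Q) v)]
    have e1 : projOn V ((P ∘ₗ A ∘ₗ P + Q ∘ₗ W ∘ₗ Q) v) = P (A (P v)) := by
      simp only [LinearMap.add_apply, LinearMap.comp_apply, map_add]
      rw [hQ, hP, projOn_apply_sub_projOn, add_zero, ← LinearMap.comp_apply, projOn_comp_self]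
    have e2 : (LinearMap.id - projOn V : E →ₗ[ℝ] E) ((P ∘ₗ A ∘ₗ P + Q ∘ₗ W ∘ₗ Q) v)
        = Q (Q (W (Q v))) := by
      rw [LinearMap.add_apply, map_add]
      simp only [LinearMap.comp_apply]
      rw [hP, sub_projOn_apply_projOn, zero_add]
    rw [e1, e2]
    have f1 := (hPc _).trans (hA (P v))
    have f2 := (hQc _).trans ((hQc _).trans (hW (Q v)))
    exact add_le_add (pow_le_pow_left₀ (norm_nonneg _) f1 2) (pow_le_pow_left₀ (norm_nonneg _) f2 2)
  have h1 := (hsInner_le_nuc hc (K + H)).trans h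
  rw [hsInner_add_left, hsInner_add_right, hsInner_add_right, hsand A K, hsand W K, hsand W H,
    hPa, hQa, hK, hQK, hAK, hWH] at h1
  have h0 : hsInner W 0 = 0 := by simp [hsInner]
  have hs : ∀ T : E →ₗ[ℝ] E, IsContr T → hsInner (P ∘ₗ T) H ≤ √(finrank ℝ V) * hsNorm H :=
    fun T hT => (hsInner_le _ _).trans
      (mul_le_mul_of_nonneg_right (hsNorm_projOn_comp_le V hT) (hsNorm_nonneg H))
  have h2 := hs (-(A ∘ₗ P)) (hA.comp hPc).neg
  rw [LinearMap.comp_neg, hsInner_neg_left] at h2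
  have h3 := hs B hB
  have h4 : hsInner (Q ∘ₗ B ∘ₗ P) H ≤ √(finrank ℝ V) * hsNorm H := by
    refine (hsInner_le _ _).trans (mul_le_mul_of_nonneg_right ?_ (hsNorm_nonneg H))
    rw [← hsNorm_adjoint, LinearMap.adjoint_comp, LinearMap.adjoint_comp, hPa, hQa,
      LinearMap.comp_assoc]
    exact hsNorm_projOn_comp_le V (hB.adjoint.comp hQc)
  have h5 := hsInner_le_nuc hB (Q ∘ₗ H ∘ₗ Q)
  have hdec : H = Q ∘ₗ H ∘ₗ Q + P ∘ₗ H + Q ∘ₗ H ∘ₗ P := by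
    ext v
    simp only [hQ, LinearMap.add_apply, LinearMap.comp_apply, LinearMap.sub_apply,
      LinearMap.id_apply, map_sub]
    abel
  have h6 : nuc H = hsInner B (Q ∘ₗ H ∘ₗ Q) + hsInner (P ∘ₗ B) H + hsInner (Q ∘ₗ B ∘ₗ P) H := by
    rw [hsInner_comp_left P, hsand, hPa, hQa, ← hsInner_add_right, ← hsInner_add_right, ← hdec,
      hBH]
  linarith

end Cone

/-- Neither matrix `H - (β hᵀ + h βᵀ)` alone controls `h`, but their difference is `δ hᵀ + h δᵀ`, of
Hilbert–Schmidt norm at least `‖δ‖ ‖h‖`. The one with larger norm therefore controls `h`, then `β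
hᵀ`, then `H`. -/
theorem exists_component_nuc_le {β₁ β₂ h : E} {H : E →ₗ[ℝ] E} (hne : β₁ - β₂ ≠ 0)
    (hnuc : nuc ((1 / 2 : ℝ) • (rk β₁ β₂ + rk β₂ β₁) + H) ≤
      nuc ((1 / 2 : ℝ) • (rk β₁ β₂ + rk β₂ β₁))) :
    ∃ β, (β = β₁ ∨ β = β₂) ∧
      nuc (H - (rk β h + rk h β)) ≤
        31 / √(‖β₁ - β₂‖ ^ 2 / (‖β₁‖ ^ 2 + ‖β₂‖ ^ 2)) * hsNorm (H - (rk β h + rk h β)) ∧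
      (H - (rk β h + rk h β) = 0 → H = 0 ∧ h = 0) := by
  set δ := β₁ - β₂ with hδ
  set S := ‖β₁‖ ^ 2 + ‖β₂‖ ^ 2 with hS
  set s := √(‖δ‖ ^ 2 / S) with hs
  have hδ0 : 0 < ‖δ‖ := norm_pos_iff.2 hne
  have hδS : ‖δ‖ ^ 2 ≤ 2 * S := by
    have := parallelogram_law_with_norm ℝ β₁ β₂
    nlinarith [mul_self_nonneg ‖β₁ + β₂‖]
  have hS0 : 0 < S := by nlinarith [pow_pos hδ0 2]
  have hs0 : 0 < s := Real.sqrt_pos.2 (by positivity)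
  have hss : s ^ 2 = ‖δ‖ ^ 2 / S := Real.sq_sqrt (by positivity)
  have hs2 : s ≤ 2 := by
    refine le_of_sq_le_sq ?_ (by norm_num)
    rw [hss, div_le_iff₀ hS0]
    linarith
  set B := √S with hB
  have hB0 : 0 < B := Real.sqrt_pos.2 hS0
  have hBB : B ^ 2 = S := Real.sq_sqrt hS0.le
  have hsB : s * B = ‖δ‖ := by
    refine (pow_left_inj₀ (by positivity) (by positivity) two_ne_zero).1 ?_
    rw [mul_pow, hss, hBB]
    field_simp
  have hβB : ∀ β, (β = β₁ ∨ β = β₂) → ‖β‖ ≤ B := by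
    rintro β (rfl | rfl) <;> refine le_of_sq_le_sq ?_ hB0.le <;> rw [hBB, hS]
    · nlinarith [sq_nonneg ‖β₂‖]
    · nlinarith [sq_nonneg ‖β₁‖]
  -- The rank is at most 2 and `√2 ≤ 3/2`, so the cone constant `3√2` is rounded up to `9/2`.
  have hrank : √(finrank ℝ (Submodule.span ℝ (Set.range ![β₁, β₂])) : ℝ) ≤ 3 / 2 := by
    have : finrank ℝ (Submodule.span ℝ (Set.range ![β₁, β₂])) ≤ 2 := by
      exact (finrank_range_le_card (R := ℝ) ![β₁, β₂]).trans_eq (Fintype.card_fin 2)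
    rw [Real.sqrt_le_left (by norm_num)]
    have : (finrank ℝ (Submodule.span ℝ (Set.range ![β₁, β₂])) : ℝ) ≤ 2 := by exact_mod_cast this
    linarith
  have hproj : ∀ β, (β = β₁ ∨ β = β₂) →
      projOn (Submodule.span ℝ (Set.range ![β₁, β₂])) β = β := by
    intro β hβ
    refine (Submodule.starProjection_eq_self_iff).2 (Submodule.subset_span ?_)
    rcases hβ with rfl | rfl
    · exact ⟨0, rfl⟩
    · exact ⟨1, rfl⟩
  have hnucH : nuc H ≤ 9 / 2 * hsNorm H := by
    refine (nuc_le_of_nuc_add_le (Submodule.span ℝ (Set.range ![β₁, β₂])) ?_ hnuc).trans ?_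
    · have hin : ∀ β, (β = β₁ ∨ β = β₂) → ∀ v,
          inner ℝ β (projOn (Submodule.span ℝ (Set.range ![β₁, β₂])) v) = inner ℝ β v := by
        intro β hβ v
        rw [← LinearMap.adjoint_inner_left, adjoint_projOn, hproj β hβ]
      ext v
      simp only [LinearMap.comp_apply, LinearMap.smul_apply, LinearMap.add_apply, rk_apply,
        map_smul, map_add, hproj _ (Or.inl rfl), hproj _ (Or.inr rfl), hin _ (Or.inl rfl),
        hin _ (Or.inr rfl)]
    · exact mul_le_mul_of_nonneg_right (by linarith) (hsNorm_nonneg H)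
  set D : E → (E →ₗ[ℝ] E) := fun β => H - (rk β h + rk h β) with hD
  have hdiff : D β₂ - D β₁ = rk δ h + rk h δ := by
    ext v
    simp only [hD, hδ, LinearMap.sub_apply, LinearMap.add_apply, rk_apply, inner_sub_left]
    module
  have hFδ : ‖δ‖ * ‖h‖ ≤ hsNorm (D β₁) + hsNorm (D β₂) := by
    calc ‖δ‖ * ‖h‖ ≤ hsNorm (rk δ h + rk h δ) := by
          refine Real.le_sqrt_of_sq_le ?_
          simp only [hsInner_add_left, hsInner_add_right, hsInner_rk_rk,
            real_inner_self_eq_norm_sq, real_inner_comm h δ]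
          nlinarith [sq_nonneg (inner ℝ δ h), mul_nonneg (sq_nonneg ‖δ‖) (sq_nonneg ‖h‖)]
      _ = hsNorm (D β₂ + -D β₁) := by rw [← hdiff, sub_eq_add_neg]
      _ ≤ hsNorm (D β₂) + hsNorm (-D β₁) := hsNorm_add_le _ _
      _ = hsNorm (D β₁) + hsNorm (D β₂) := by rw [hsNorm_neg, add_comm]
  obtain ⟨β, hβ, hM⟩ : ∃ β, (β = β₁ ∨ β = β₂) ∧
      hsNorm (D β₁) + hsNorm (D β₂) ≤ 2 * hsNorm (D β) := by
    rcases le_total (hsNorm (D β₁)) (hsNorm (D β₂)) with h | h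
    · exact ⟨β₂, Or.inr rfl, by linarith⟩
    · exact ⟨β₁, Or.inl rfl, by linarith⟩
  set M := hsNorm (D β) with hMdef
  have hM0 : 0 ≤ M := hsNorm_nonneg _
  have hBh : B * ‖h‖ ≤ 2 * (M / s) := by
    rw [← mul_div_assoc, le_div_iff₀ hs0]
    calc B * ‖h‖ * s = s * B * ‖h‖ := by ring
      _ ≤ 2 * M := by rw [hsB]; linarith
  have hMs : M ≤ 2 * (M / s) := by
    rw [← mul_div_assoc, le_div_iff₀ hs0]
    nlinarith
  have hβh : ‖β‖ * ‖h‖ ≤ 2 * (M / s) :=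
    (mul_le_mul_of_nonneg_right (hβB β hβ) (norm_nonneg h)).trans hBh
  have hHF : hsNorm H ≤ 6 * (M / s) := by
    calc hsNorm H = hsNorm (D β + (rk β h + rk h β)) := by simp [hD]
      _ ≤ M + (hsNorm (rk β h) + hsNorm (rk h β)) :=
        (hsNorm_add_le _ _).trans (by gcongr; exact hsNorm_add_le _ _)
      _ ≤ 6 * (M / s) := by rw [hsNorm_rk, hsNorm_rk, mul_comm ‖h‖]; linarith
  refine ⟨β, hβ, ?_, fun h0 => ?_⟩
  -- In units of `M / s`: `nuc H` contributes at most `9/2 · 6 = 27` and each rank-one term at most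
  -- 2, so 31 in total.
  · obtain ⟨W, hW, hWD⟩ := exists_isContr_hsInner_eq_nuc (D β)
    have h1 := hsInner_le_nuc hW H
    have h2 := hsInner_rk_le hW.neg β h
    have h3 := hsInner_rk_le hW.neg h β
    rw [hsInner_neg_left] at h2 h3
    have h4 : nuc (D β) = hsInner W H - (hsInner W (rk β h) + hsInner W (rk h β)) := by
      rw [← hWD, hD, hsInner_sub_right, hsInner_add_right]
    change nuc (D β) ≤ 31 / s * M
    rw [div_mul_eq_mul_div, mul_div_assoc, h4]
    rw [mul_comm ‖h‖] at h3
    linarith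
  · have hM1 : M = 0 := by
      rw [hMdef, hD, hsNorm]
      simp only [h0]
      simp [hsInner]
    rw [hM1, zero_div, mul_zero] at hHF hBh
    refine ⟨eq_zero_of_hsInner_self_eq_zero ?_, ?_⟩
    · rw [← sq_hsNorm, le_antisymm hHF (hsNorm_nonneg H)]
      norm_num
    · have : ‖h‖ ≤ 0 := by
        by_contra hc
        exact absurd hBh (not_le.2 (mul_pos hB0 (not_le.1 hc)))
      exact norm_le_zero_iff.1 this

end LinearAlgebra

/-! ### McDiarmid's inequality for independent, not necessarily identically distributed,
coordinates. -/

section Concentration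

variable {𝒳 : Type*} [MeasurableSpace 𝒳]

theorem measurable_finCons {m : ℕ} :
    Measurable fun z : 𝒳 × (Fin m → 𝒳) => (Fin.cons z.1 z.2 : Fin (m + 1) → 𝒳) := by
  refine measurable_pi_iff.2 fun i => ?_
  refine Fin.cases ?_ (fun j => ?_) i
  · simpa using measurable_fst
  · simpa [Function.comp_def] using (measurable_pi_apply j).comp measurable_snd

theorem measurePreserving_finCons {m : ℕ} (ν : Fin (m + 1) → Measure 𝒳)
    [∀ i, IsProbabilityMeasure (ν i)] :
    MeasurePreserving (fun z : 𝒳 × (Fin m → 𝒳) => (Fin.cons z.1 z.2 : Fin (m + 1) → 𝒳))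
      ((ν 0).prod (Measure.pi fun i => ν i.succ)) (Measure.pi ν) := by
  have h := (measurePreserving_piFinSuccAbove ν 0).symm
  convert h using 1
  · funext z
    simp [MeasurableEquiv.piFinSuccAbove, Fin.insertNthEquiv]
  · simp

theorem integral_pi_succ {m : ℕ} (ν : Fin (m + 1) → Measure 𝒳)
    [∀ i, IsProbabilityMeasure (ν i)] {f : (Fin (m + 1) → 𝒳) → ℝ}
    (hf : Integrable f (Measure.pi ν)) :
    ∫ x, f x ∂Measure.pi ν =
      ∫ a, ∫ y, f (Fin.cons a y) ∂(Measure.pi fun i => ν i.succ) ∂(ν 0) := by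
  have h := measurePreserving_finCons ν
  rw [← h.map_eq, integral_map h.measurable.aemeasurable
    (by rw [h.map_eq]; exact hf.aestronglyMeasurable), integral_prod]
  exact h.integrable_comp_of_integrable hf

/-- Hoeffding's lemma: bounded oscillation puts the values in the interval of length `c` starting at
the infimum. -/
theorem integral_exp_le_of_osc {ν : Measure 𝒳} [IsProbabilityMeasure ν] {F : 𝒳 → ℝ}
    (hF : Measurable F) {c : ℝ} (hc : ∀ a b, F a - F b ≤ c) (r : ℝ) :
    ∫ a, Real.exp (r * F a) ∂ν ≤ Real.exp (r * ∫ a, F a ∂ν + c ^ 2 * r ^ 2 / 8) := by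
  have : Nonempty 𝒳 := nonempty_of_isProbabilityMeasure ν
  obtain ⟨a₀⟩ := this
  have hbdd : BddBelow (Set.range F) := ⟨F a₀ - c, by
    rintro _ ⟨b, rfl⟩
    linarith [hc a₀ b]⟩
  have : Nonempty 𝒳 := ⟨a₀⟩
  have hmem : ∀ a, F a ∈ Set.Icc (⨅ b, F b) ((⨅ b, F b) + c) := fun a =>
    ⟨ciInf_le hbdd a, by
      have : F a - c ≤ ⨅ b, F b := le_ciInf fun b => by linarith [hc a b]
      linarith⟩
  have hsg := (hasSubgaussianMGF_of_mem_Icc hF.aemeasurable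
    (Filter.Eventually.of_forall hmem : ∀ᵐ a ∂ν, _)).mgf_le r
  have hpar : ((((‖(⨅ b, F b) + c - ⨅ b, F b‖₊ / 2) ^ 2 : ℝ≥0)) : ℝ) = c ^ 2 / 4 := by
    push_cast
    rw [add_sub_cancel_left, Real.norm_eq_abs, div_pow, sq_abs]
    norm_num
  rw [hpar] at hsg
  have he : ∀ a, Real.exp (r * F a) =
      Real.exp (r * ∫ a, F a ∂ν) * Real.exp (r * (F a - ∫ a, F a ∂ν)) := fun a => by
    rw [← Real.exp_add]; ring_nf
  simp only [he]
  rw [integral_const_mul, Real.exp_add]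
  refine mul_le_mul_of_nonneg_left ?_ (Real.exp_pos _).le
  refine hsg.trans_eq ?_
  ring_nf

theorem integrable_of_measurable_of_abs_le {α : Type*} [MeasurableSpace α] {ν : Measure α}
    [IsFiniteMeasure ν] {f : α → ℝ} (hf : Measurable f) {K : ℝ} (hK : ∀ x, |f x| ≤ K) :
    Integrable f ν :=
  Integrable.of_bound hf.aestronglyMeasurable K (Filter.Eventually.of_forall hK)

/-- **McDiarmid's inequality**, in exponential moment form. -/
theorem integral_exp_le_of_bounded_differences {c : ℝ} (r : ℝ) :
    ∀ {m : ℕ} (ν : Fin m → Measure 𝒳) [∀ i, IsProbabilityMeasure (ν i)]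
      {f : (Fin m → 𝒳) → ℝ}, Measurable f → ∀ {K : ℝ}, (∀ x, |f x| ≤ K) →
      (∀ i x y, (∀ j, j ≠ i → x j = y j) → f x - f y ≤ c) →
      ∫ x, Real.exp (r * f x) ∂Measure.pi ν ≤
        Real.exp (r * ∫ x, f x ∂Measure.pi ν + m * (c ^ 2 * r ^ 2 / 8)) := by
  intro m
  induction m with
  | zero =>
    intro ν _ f hf K hK hc
    have : ∀ x, f x = f default := fun x => by rw [Subsingleton.elim x default]
    simp [this]
  | succ m ih =>
    intro ν _ f hf K hK hc
    have hexpK : ∀ u : ℝ, |u| ≤ K → |Real.exp (r * u)| ≤ Real.exp (|r| * K) := fun u hu => by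
      rw [abs_of_pos (Real.exp_pos _)]
      refine Real.exp_le_exp.2 ((le_abs_self _).trans ?_)
      rw [abs_mul]
      gcongr
    have hem : Measurable fun x => Real.exp (r * f x) := (hf.const_mul r).exp
    rw [integral_pi_succ ν (integrable_of_measurable_of_abs_le hem fun x => hexpK _ (hK x)),
      integral_pi_succ ν (integrable_of_measurable_of_abs_le hf hK)]
    -- Conditioning on the first coordinate: the induction hypothesis handles the others, and the
    -- conditional mean `F` inherits oscillation at most `c`.
    set ν' : Fin m → Measure 𝒳 := fun i => ν i.succ
    set F : 𝒳 → ℝ := fun a => ∫ y, f (Fin.cons a y) ∂Measure.pi ν' with hF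
    have hfc : Measurable fun z : 𝒳 × (Fin m → 𝒳) => f (Fin.cons z.1 z.2) :=
      hf.comp measurable_finCons
    have hfa : ∀ a, Measurable fun y : Fin m → 𝒳 => f (Fin.cons a y) := fun a =>
      hfc.comp measurable_prodMk_left
    have hFm : Measurable F := (hfc.stronglyMeasurable.integral_prod_right).measurable
    have hFK : ∀ a, |F a| ≤ K := fun a => by
      have := norm_integral_le_of_norm_le_const (μ := Measure.pi ν')
        (Filter.Eventually.of_forall fun y => (Real.norm_eq_abs _).trans_le (hK (Fin.cons a y)))
      simpa using this
    have hFc : ∀ a b, F a - F b ≤ c := fun a b => by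
      rw [hF, ← integral_sub (integrable_of_measurable_of_abs_le (hfa a) fun _ => hK _)
        (integrable_of_measurable_of_abs_le (hfa b) fun _ => hK _)]
      have : ∫ y, (f (Fin.cons a y) - f (Fin.cons b y)) ∂Measure.pi ν' ≤
          ∫ _y, c ∂Measure.pi ν' := by
        refine integral_mono ?_ (integrable_const c) fun y => hc 0 _ _ ?_
        · exact (integrable_of_measurable_of_abs_le (hfa a) fun _ => hK _).sub
            (integrable_of_measurable_of_abs_le (hfa b) fun _ => hK _)
        · intro j hj
          obtain ⟨k, rfl⟩ := Fin.exists_succ_eq.2 hj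
          simp
      simpa using this
    have hstep : ∀ a, ∫ y, Real.exp (r * f (Fin.cons a y)) ∂Measure.pi ν' ≤
        Real.exp (r * F a) * Real.exp (m * (c ^ 2 * r ^ 2 / 8)) := fun a => by
      rw [← Real.exp_add]
      refine ih ν' (hfa a) (fun _ => hK _) fun i x y hxy => hc i.succ _ _ fun j hj => ?_
      refine Fin.cases (fun _ => by simp) (fun k hk => ?_) j hj
      simpa using hxy k fun h => hk (by rw [h])
    calc ∫ a, ∫ y, Real.exp (r * f (Fin.cons a y)) ∂Measure.pi ν' ∂ν 0
        ≤ ∫ a, Real.exp (r * F a) * Real.exp (m * (c ^ 2 * r ^ 2 / 8)) ∂ν 0 := by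
          refine integral_mono ?_ ?_ hstep
          · refine Integrable.integral_prod_left (f := fun z : 𝒳 × (Fin m → 𝒳) =>
              Real.exp (r * f (Fin.cons z.1 z.2))) ?_
            exact integrable_of_measurable_of_abs_le (hfc.const_mul r).exp
              fun x => hexpK _ (hK _)
          · exact (integrable_of_measurable_of_abs_le (hFm.const_mul r).exp
              fun x => hexpK _ (hFK _)).mul_const _
      _ ≤ Real.exp (r * ∫ a, F a ∂ν 0 + c ^ 2 * r ^ 2 / 8) *
            Real.exp (m * (c ^ 2 * r ^ 2 / 8)) := by
          rw [integral_mul_const]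
          exact mul_le_mul_of_nonneg_right (integral_exp_le_of_osc hFm hFc r) (Real.exp_pos _).le
      _ = _ := by
          rw [← Real.exp_add]
          push_cast
          ring_nf

/-- **McDiarmid's inequality**. -/
theorem measureReal_ge_le_of_bounded_differences {c : ℝ} (hc0 : 0 < c)
    {m : ℕ} (ν : Fin m → Measure 𝒳) [∀ i, IsProbabilityMeasure (ν i)]
    {f : (Fin m → 𝒳) → ℝ} (hf : Measurable f) {K : ℝ} (hK : ∀ x, |f x| ≤ K)
    (hc : ∀ i x y, (∀ j, j ≠ i → x j = y j) → f x - f y ≤ c) {t : ℝ} (ht : 0 ≤ t) :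
    (Measure.pi ν).real {x | ∫ x, f x ∂Measure.pi ν + m * t ≤ f x} ≤
      Real.exp (-(2 * t ^ 2 / c ^ 2) * m) := by
  -- The minimizer of the Chernoff exponent `-r t + c² r² / 8`.
  set r := 4 * t / c ^ 2 with hr
  have hr0 : 0 ≤ r := by positivity
  have hexp := integral_exp_le_of_bounded_differences r ν hf hK hc
  have hi : Integrable (fun x => Real.exp (r * f x)) (Measure.pi ν) := by
    refine integrable_of_measurable_of_abs_le (hf.const_mul r).exp (K := Real.exp (r * K))
      fun x => ?_
    rw [abs_of_pos (Real.exp_pos _)]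
    refine Real.exp_le_exp.2 ?_
    gcongr
    exact (le_abs_self _).trans (hK x)
  refine (measure_ge_le_exp_mul_mgf _ hr0 hi).trans ?_
  calc _ ≤ Real.exp (-r * (∫ x, f x ∂Measure.pi ν + m * t)) *
        Real.exp (r * ∫ x, f x ∂Measure.pi ν + m * (c ^ 2 * r ^ 2 / 8)) :=
        mul_le_mul_of_nonneg_left hexp (Real.exp_pos _).le
    _ = _ := by
      rw [← Real.exp_add, hr]
      congr 1
      field_simp
      ring

end Concentration

/-! ### Symmetrization and contraction, one coordinate at a time. -/

section Symmetrization

variable {𝒳 : Type*} [MeasurableSpace 𝒳] {ι : Type*} [Fintype ι] [Nonempty ι]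

theorem le_ciSup_fin (f : ι → ℝ) (i : ι) : f i ≤ ⨆ j, f j :=
  le_ciSup (Set.finite_range f).bddAbove i

theorem abs_ciSup_le_sum (f : ι → ℝ) : |⨆ i, f i| ≤ ∑ i, |f i| := by
  obtain ⟨i, hi⟩ := exists_eq_ciSup_of_finite (f := f)
  rw [← hi]
  exact Finset.single_le_sum (f := fun i => |f i|) (fun j _ => abs_nonneg _) (Finset.mem_univ i)

theorem integrable_ciSup {ν : Measure 𝒳} {f : ι → 𝒳 → ℝ} (hf : ∀ i, Measurable (f i))
    (hi : ∀ i, Integrable (f i) ν) : Integrable (fun x => ⨆ i, f i x) ν := by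
  refine Integrable.mono' (integrable_finsetSum Finset.univ fun i _ => (hi i).abs)
    (Measurable.iSup hf).aestronglyMeasurable (Filter.Eventually.of_forall fun x => ?_)
  exact abs_ciSup_le_sum fun i => f i x

/-- The law of a random sign. -/
noncomputable def rademacher : Measure ℝ :=
  (2⁻¹ : ℝ≥0∞) • (Measure.dirac 1 + Measure.dirac (-1))

instance : IsProbabilityMeasure rademacher := ⟨by
  simp only [rademacher, Measure.smul_apply, Measure.add_apply, measure_univ, smul_eq_mul]
  rw [one_add_one_eq_two]
  exact ENNReal.inv_mul_cancel two_ne_zero ENNReal.ofNat_ne_top⟩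

theorem integrable_rademacher (f : ℝ → ℝ) : Integrable f rademacher :=
  ((integrable_dirac (by simp)).add_measure (integrable_dirac (by simp))).smul_measure (by simp)

theorem integral_rademacher (f : ℝ → ℝ) :
    ∫ e, f e ∂rademacher = 1 / 2 * (f 1 + f (-1)) := by
  rw [rademacher, integral_smul_measure, integral_add_measure (integrable_dirac (by simp))
    (integrable_dirac (by simp)), integral_dirac, integral_dirac]
  simp

/-- If the suprema on the left are attained at `i` and `j`, the Lipschitz bound replaces `φ (t i) -
φ (t j)` by `|t i - t j|`. The sign of `t i - t j` decides which index is used in which supremum on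
the right. -/
theorem ciSup_add_ciSup_sub_le (a t : ι → ℝ) {φ : ℝ → ℝ} (hφ : ∀ s t, |φ s - φ t| ≤ |s - t|) :
    (⨆ i, (a i / 2 + φ (t i))) + (⨆ i, (a i / 2 - φ (t i))) ≤
      1 / 2 * ((⨆ i, (a i + 2 * t i)) + ⨆ i, (a i - 2 * t i)) := by
  obtain ⟨i, hi⟩ := exists_eq_ciSup_of_finite (f := fun i => a i / 2 + φ (t i))
  obtain ⟨j, hj⟩ := exists_eq_ciSup_of_finite (f := fun i => a i / 2 - φ (t i))
  rw [← hi, ← hj]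
  have h := (le_abs_self _).trans (hφ (t i) (t j))
  have h1 := le_ciSup_fin (fun i => a i + 2 * t i) i
  have h2 := le_ciSup_fin (fun i => a i + 2 * t i) j
  have h3 := le_ciSup_fin (fun i => a i - 2 * t i) i
  have h4 := le_ciSup_fin (fun i => a i - 2 * t i) j
  rcases abs_cases (t i - t j) with ⟨h5, _⟩ | ⟨h5, _⟩ <;> rw [h5] at h <;> linarith

theorem integrable_lipschitz_comp {ν : Measure 𝒳} [IsFiniteMeasure ν] {t : 𝒳 → ℝ}
    (hi : Integrable t ν) {φ : ℝ → ℝ} (hφm : Measurable φ)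
    (hφ : ∀ s t, |φ s - φ t| ≤ |s - t|) : Integrable (fun x => φ (t x)) ν := by
  refine Integrable.mono' ((integrable_const |φ 0|).add hi.abs)
    (hφm.comp_aemeasurable hi.aemeasurable).aestronglyMeasurable
    (Filter.Eventually.of_forall fun x => ?_)
  have h1 := hφ (t x) 0
  have h2 := abs_sub_abs_le_abs_sub (φ (t x)) (φ 0)
  rw [sub_zero] at h1
  simp only [Pi.add_apply, Real.norm_eq_abs]
  linarith

/-- The offset `a` is split evenly between `φ` at an independent copy and `-φ` at the sample. The
two suprema are integrated separately, so they may be evaluated at the same point, where the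
pointwise contraction inequality applies. The free offset carries the other coordinates in the
induction. -/
theorem integral_ciSup_le_signed {ν : Measure 𝒳} [IsProbabilityMeasure ν] {t : ι → 𝒳 → ℝ}
    (ht : ∀ i, Measurable (t i)) (hi : ∀ i, Integrable (t i) ν) {φ : ℝ → ℝ} (hφm : Measurable φ)
    (hφ : ∀ s t, |φ s - φ t| ≤ |s - t|) (a : ι → ℝ) :
    ∫ x, ⨆ i, (a i + (∫ x', φ (t i x') ∂ν - φ (t i x))) ∂ν ≤
      ∫ z, ⨆ i, (a i + 2 * z.2 * t i z.1) ∂(ν.prod rademacher) := by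
  have hgm : ∀ i, Measurable fun x => φ (t i x) := fun i => hφm.comp (ht i)
  have hgi : ∀ i, Integrable (fun x => φ (t i x)) ν := fun i =>
    integrable_lipschitz_comp (hi i) hφm hφ
  have hplus : Integrable (fun x => ⨆ i, (a i / 2 + φ (t i x))) ν :=
    integrable_ciSup (fun i => (hgm i).const_add _) fun i => (integrable_const _).add (hgi i)
  have hminus : Integrable (fun x => ⨆ i, (a i / 2 - φ (t i x))) ν :=
    integrable_ciSup (fun i => (hgm i).const_sub _) fun i => (integrable_const _).sub (hgi i)
  have hplus' : Integrable (fun x => ⨆ i, (a i + 2 * t i x)) ν :=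
    integrable_ciSup (fun i => ((ht i).const_mul 2).const_add _)
      fun i => (integrable_const _).add ((hi i).const_mul 2)
  have hminus' : Integrable (fun x => ⨆ i, (a i - 2 * t i x)) ν :=
    integrable_ciSup (fun i => ((ht i).const_mul 2).const_sub _)
      fun i => (integrable_const _).sub ((hi i).const_mul 2)
  have hprod : Integrable (fun z : 𝒳 × ℝ => ⨆ i, (a i + 2 * z.2 * t i z.1))
      (ν.prod rademacher) := by
    refine integrable_ciSup (fun i => ?_) fun i => (integrable_const _).add ?_
    · exact ((measurable_snd.const_mul 2).mul ((ht i).comp measurable_fst)).const_add _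
    · have := (hi i).mul_prod (integrable_rademacher fun e => 2 * e)
      exact this.congr (Filter.Eventually.of_forall fun z => by simp; ring)
  rw [integral_prod _ hprod]
  simp only [integral_rademacher]
  calc ∫ x, ⨆ i, (a i + (∫ x', φ (t i x') ∂ν - φ (t i x))) ∂ν
      ≤ ∫ x, ((∫ x', ⨆ i, (a i / 2 + φ (t i x')) ∂ν) + ⨆ i, (a i / 2 - φ (t i x))) ∂ν := by
        refine integral_mono ?_ ((integrable_const _).add hminus) fun x => ciSup_le fun i => ?_
        · exact integrable_ciSup (fun i => ((hgm i).const_sub _).const_add _)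
            fun i => (integrable_const _).add ((integrable_const _).sub (hgi i))
        · have h1 : a i / 2 + ∫ x', φ (t i x') ∂ν ≤ ∫ x', ⨆ i, (a i / 2 + φ (t i x')) ∂ν := by
            have : a i / 2 + ∫ x', φ (t i x') ∂ν = ∫ x', (a i / 2 + φ (t i x')) ∂ν := by
              rw [integral_add (integrable_const _) (hgi i)]
              simp
            rw [this]
            exact integral_mono ((integrable_const _).add (hgi i)) hplus
              fun x' => le_ciSup_fin (fun i => a i / 2 + φ (t i x')) i
          have h2 := le_ciSup_fin (fun i => a i / 2 - φ (t i x)) i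
          linarith
    _ = ∫ x, ((⨆ i, (a i / 2 + φ (t i x))) + ⨆ i, (a i / 2 - φ (t i x))) ∂ν := by
        rw [integral_add (integrable_const _) hminus, integral_add hplus hminus]
        simp
    _ ≤ ∫ x, 1 / 2 * ((⨆ i, (a i + 2 * t i x)) + ⨆ i, (a i - 2 * t i x)) ∂ν := by
        refine integral_mono (hplus.add hminus) ((hplus'.add hminus').const_mul _) fun x => ?_
        exact ciSup_add_ciSup_sub_le a (fun i => t i x) hφ
    _ = _ := by
        refine integral_congr_ae (Filter.Eventually.of_forall fun x => ?_)
        simp only [mul_one, mul_neg, neg_mul, ← sub_eq_add_neg]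

/-- Symmetrization and contraction for the supremum of an empirical process. -/
theorem integral_ciSup_sum_le_signed {t : ι → 𝒳 → ℝ}
    (ht : ∀ i, Measurable (t i)) {φ : ℝ → ℝ} (hφm : Measurable φ)
    (hφ : ∀ s t, |φ s - φ t| ≤ |s - t|) :
    ∀ {m : ℕ} (ν : Fin m → Measure 𝒳) [∀ k, IsProbabilityMeasure (ν k)]
      (_hi : ∀ k i, Integrable (t i) (ν k)) (a : ι → ℝ),
    ∫ x, ⨆ i, (a i + ∑ k, (∫ x', φ (t i x') ∂ν k - φ (t i (x k)))) ∂Measure.pi ν ≤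
      ∫ z, ⨆ i, (a i + ∑ k, 2 * (z k).2 * t i (z k).1)
        ∂Measure.pi (fun k => (ν k).prod rademacher) := by
  intro m
  induction m with
  | zero =>
    intro ν _ hi a
    simp
  | succ m ih =>
    intro ν _ hi a
    have hgm : ∀ i, Measurable fun x => φ (t i x) := fun i => hφm.comp (ht i)
    have hgi : ∀ k i, Integrable (fun x => φ (t i x)) (ν k) := fun k i =>
      integrable_lipschitz_comp (hi k i) hφm hφ
    have hsm : ∀ i, Measurable fun z : 𝒳 × ℝ => 2 * z.2 * t i z.1 := fun i =>
      (measurable_snd.const_mul 2).mul ((ht i).comp measurable_fst)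
    have hsi : ∀ k i, Integrable (fun z : 𝒳 × ℝ => 2 * z.2 * t i z.1)
        ((ν k).prod rademacher) := fun k i => by
      have := (hi k i).mul_prod (integrable_rademacher fun e => 2 * e)
      exact this.congr (Filter.Eventually.of_forall fun z => by simp; ring)
    set σ : Fin (m + 1) → Measure (𝒳 × ℝ) := fun k => (ν k).prod rademacher with hσ
    have hI1 : Integrable (fun x : Fin (m + 1) → 𝒳 =>
        ⨆ i, (a i + ∑ k, (∫ x', φ (t i x') ∂ν k - φ (t i (x k))))) (Measure.pi ν) := by
      refine integrable_ciSup (fun i => ?_) fun i => (integrable_const _).add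
        (integrable_finsetSum _ fun k _ => (integrable_const _).sub ?_)
      · exact (Finset.measurable_sum _ fun k _ =>
          ((hgm i).comp (measurable_pi_apply k)).const_sub _).const_add _
      · exact (measurePreserving_eval ν k).integrable_comp_of_integrable (hgi k i)
    have hI2 : Integrable (fun z : Fin (m + 1) → 𝒳 × ℝ =>
        ⨆ i, (a i + ∑ k, 2 * (z k).2 * t i (z k).1)) (Measure.pi σ) := by
      refine integrable_ciSup (fun i => ?_) fun i => (integrable_const _).add
        (integrable_finsetSum _ fun k _ => ?_)
      · exact (Finset.measurable_sum _ fun k _ =>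
          (hsm i).comp (measurable_pi_apply k)).const_add _
      · exact (measurePreserving_eval σ k).integrable_comp_of_integrable (hsi k i)
    rw [integral_pi_succ ν hI1, integral_pi_succ σ hI2]
    simp only [Fin.sum_univ_succ, Fin.cons_zero, Fin.cons_succ]
    have hrm : ∀ i, Measurable fun z : Fin m → 𝒳 × ℝ =>
        ∑ k, 2 * (z k).2 * t i (z k).1 := fun i =>
      Finset.measurable_sum _ fun k _ => (hsm i).comp (measurable_pi_apply k)
    have hri : ∀ i, Integrable (fun z : Fin m → 𝒳 × ℝ => ∑ k, 2 * (z k).2 * t i (z k).1)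
        (Measure.pi fun k : Fin m => σ k.succ) := fun i =>
      integrable_finsetSum _ fun k _ =>
        (measurePreserving_eval (fun k : Fin m => σ k.succ) k).integrable_comp_of_integrable
          (hsi k.succ i)
    have hrm' : ∀ i, Measurable fun x : Fin m → 𝒳 =>
        ∑ k : Fin m, (∫ x', φ (t i x') ∂ν k.succ - φ (t i (x k))) := fun i =>
      Finset.measurable_sum _ fun k _ => ((hgm i).comp (measurable_pi_apply k)).const_sub _
    have hri' : ∀ i, Integrable (fun x : Fin m → 𝒳 =>
        ∑ k : Fin m, (∫ x', φ (t i x') ∂ν k.succ - φ (t i (x k))))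
        (Measure.pi fun k : Fin m => ν k.succ) := fun i =>
      integrable_finsetSum _ fun k _ => (integrable_const _).sub
        ((measurePreserving_eval (fun k : Fin m => ν k.succ) k).integrable_comp_of_integrable
          (hgi k.succ i))
    have hmix : Integrable (fun w : 𝒳 × (Fin m → 𝒳 × ℝ) =>
        ⨆ i, (a i + (∫ x', φ (t i x') ∂ν 0 - φ (t i w.1)) + ∑ k, 2 * (w.2 k).2 * t i (w.2 k).1))
        ((ν 0).prod (Measure.pi fun k : Fin m => σ k.succ)) := by
      refine integrable_ciSup (fun i => ?_) fun i =>
        ((integrable_const _).add ((integrable_const _).sub ?_)).add ?_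
      · exact ((((hgm i).comp measurable_fst).const_sub _).const_add _).add
          ((hrm i).comp measurable_snd)
      · exact (hgi 0 i).comp_fst _
      · exact (hri i).comp_snd _
    have hmix' : Integrable (fun w : (𝒳 × ℝ) × (Fin m → 𝒳 × ℝ) =>
        ⨆ i, (a i + (2 * w.1.2 * t i w.1.1 + ∑ k, 2 * (w.2 k).2 * t i (w.2 k).1)))
        ((σ 0).prod (Measure.pi fun k : Fin m => σ k.succ)) := by
      refine integrable_ciSup (fun i => ?_) fun i => (integrable_const _).add (Integrable.add ?_ ?_)
      · exact (((hsm i).comp measurable_fst).add ((hrm i).comp measurable_snd)).const_add _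
      · exact (hsi 0 i).comp_fst _
      · exact (hri i).comp_snd _
    have hmix0 : Integrable (fun w : 𝒳 × (Fin m → 𝒳) =>
        ⨆ i, (a i + ((∫ x', φ (t i x') ∂ν 0 - φ (t i w.1)) +
          ∑ k : Fin m, (∫ x', φ (t i x') ∂ν k.succ - φ (t i (w.2 k))))))
        ((ν 0).prod (Measure.pi fun k : Fin m => ν k.succ)) := by
      refine integrable_ciSup (fun i => ?_) fun i => (integrable_const _).add
        (Integrable.add ((integrable_const _).sub ?_) ?_)
      · exact ((((hgm i).comp measurable_fst).const_sub _).add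
          ((hrm' i).comp measurable_snd)).const_add _
      · exact (hgi 0 i).comp_fst _
      · exact (hri' i).comp_snd _
    -- The induction hypothesis treats the later coordinates with the first one frozen in the
    -- offset. After Fubini, the one-coordinate case treats the first with the others in the offset.
    calc _ ≤ ∫ x, ∫ z, ⨆ i, (a i + (∫ x', φ (t i x') ∂ν 0 - φ (t i x)) +
            ∑ k, 2 * (z k).2 * t i (z k).1) ∂(Measure.pi fun k : Fin m => σ k.succ) ∂ν 0 := by
          refine integral_mono hmix0.integral_prod_left hmix.integral_prod_left fun x => ?_
          have := ih (fun k => ν k.succ) (fun k i => hi k.succ i)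
            (fun i => a i + (∫ x', φ (t i x') ∂ν 0 - φ (t i x)))
          simpa only [add_assoc] using this
      _ = ∫ z, ∫ x, ⨆ i, (a i + (∫ x', φ (t i x') ∂ν 0 - φ (t i x)) +
            ∑ k, 2 * (z k).2 * t i (z k).1) ∂ν 0 ∂(Measure.pi fun k : Fin m => σ k.succ) :=
          integral_integral_swap hmix
      _ ≤ ∫ z, ∫ w, ⨆ i, (a i + (2 * w.2 * t i w.1 + ∑ k, 2 * (z k).2 * t i (z k).1))
            ∂σ 0 ∂(Measure.pi fun k : Fin m => σ k.succ) := by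
          refine integral_mono hmix.integral_prod_right hmix'.integral_prod_right fun z => ?_
          have := integral_ciSup_le_signed (ν := ν 0) ht (hi 0) hφm hφ
            (fun i => a i + ∑ k, 2 * (z k).2 * t i (z k).1)
          refine (Eq.trans_le ?_ this).trans_eq ?_ <;>
            refine integral_congr_ae (Filter.Eventually.of_forall fun x => iSup_congr fun i => ?_) <;>
            ring
      _ = _ := (integral_integral_swap hmix').symm

end Symmetrization

/-! ### From moment growth to exponential moments of linear forms and their products. -/

section SubGaussian

variable {Ω : Type*} [MeasurableSpace Ω] {P : Measure Ω}

theorem eLpNorm_le_of_subGaussianNorm_le {X : Ω → ℝ} {κ : ℝ≥0} (h : subGaussianNorm P X ≤ κ)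
    {q : ℝ≥0} (hq : 1 ≤ q) : eLpNorm X q P ≤ κ * ENNReal.ofReal √q := by
  have h1 : eLpNorm X (q : ℝ≥0∞) P / ENNReal.ofReal √q ≤ κ :=
    (le_iSup₂ (f := fun (q : ℝ≥0) (_ : 1 ≤ q) => eLpNorm X (q : ℝ≥0∞) P / ENNReal.ofReal √q)
      q hq).trans h
  rwa [ENNReal.div_le_iff_le_mul (Or.inl ?_) (Or.inl ENNReal.ofReal_ne_top)] at h1
  rw [Ne, ENNReal.ofReal_eq_zero, not_le, Real.sqrt_pos]
  exact_mod_cast zero_lt_one.trans_le hq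

theorem memLp_of_subGaussianNorm_le [IsFiniteMeasure P] {X : Ω → ℝ} (hX : Measurable X) {κ : ℝ≥0}
    (h : subGaussianNorm P X ≤ κ) (q : ℝ≥0) : MemLp X q P := by
  have h1 : MemLp X ((q + 1 : ℝ≥0) : ℝ≥0∞) P := by
    refine ⟨hX.aestronglyMeasurable, ?_⟩
    refine (eLpNorm_le_of_subGaussianNorm_le h le_add_self).trans_lt ?_
    exact ENNReal.mul_lt_top ENNReal.coe_lt_top ENNReal.ofReal_lt_top
  exact h1.mono_exponent (by exact_mod_cast le_self_add)

theorem integral_pow_le_of_subGaussianNorm_le [IsFiniteMeasure P] {X : Ω → ℝ} (hX : Measurable X)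
    {κ : ℝ≥0} (h : subGaussianNorm P X ≤ κ) {k : ℕ} (hk : 1 ≤ k) :
    ∫ ω, X ω ^ (2 * k) ∂P ≤ (2 * k * κ ^ 2) ^ k := by
  have hq : (1 : ℝ≥0) ≤ ((2 * k : ℕ) : ℝ≥0) := by exact_mod_cast (by omega : 1 ≤ 2 * k)
  have h1 := eLpNorm_le_of_subGaussianNorm_le h hq
  have hk0 : ((2 * k : ℕ) : ℝ) ≠ 0 := by
    exact_mod_cast (by omega : 2 * k ≠ 0)
  rw [MemLp.eLpNorm_eq_integral_rpow_norm (by exact_mod_cast (by omega : 2 * k ≠ 0))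
    ENNReal.coe_ne_top (memLp_of_subGaussianNorm_le hX h _),
    ← ENNReal.ofReal_coe_nnreal (p := κ), ← ENNReal.ofReal_mul κ.coe_nonneg,
    ENNReal.ofReal_le_ofReal_iff (by positivity)] at h1
  simp only [ENNReal.coe_toReal, NNReal.coe_natCast, Real.rpow_natCast, Real.norm_eq_abs] at h1
  have habs : ∀ ω, |X ω| ^ (2 * k) = X ω ^ (2 * k) := fun ω => by
    rw [pow_mul, sq_abs, ← pow_mul]
  simp only [habs] at h1
  have hI : 0 ≤ ∫ ω, X ω ^ (2 * k) ∂P := integral_nonneg fun ω => by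
    simp only [pow_mul]; positivity
  have h2 := pow_le_pow_left₀ (by positivity) h1 (2 * k)
  rw [← Real.rpow_natCast, ← Real.rpow_mul hI, inv_mul_cancel₀ hk0, Real.rpow_one] at h2
  refine h2.trans_eq ?_
  rw [pow_mul, mul_pow, Real.sq_sqrt (by positivity)]
  push_cast
  ring

/-- In the exponential series, `k ^ k / k! ≤ e ^ k` bounds the `k`-th term by `(2 e c κ²) ^ k`. The
coefficient `c` makes this ratio at most `1/2`, so the series sums to at most 2; the `+ 1` in its
denominator covers `κ = 0`. -/
theorem lintegral_exp_mul_sq_le [IsProbabilityMeasure P] {X : Ω → ℝ} (hX : Measurable X)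
    {κ : ℝ≥0} (h : subGaussianNorm P X ≤ κ) :
    ∫⁻ ω, ENNReal.ofReal (Real.exp (1 / (4 * Real.exp 1 * κ ^ 2 + 1) * X ω ^ 2)) ∂P ≤ 2 := by
  set c : ℝ := 1 / (4 * Real.exp 1 * κ ^ 2 + 1) with hc
  have hc0 : 0 < c := by positivity
  have hcκ : 2 * Real.exp 1 * (c * κ ^ 2) ≤ 1 / 2 := by
    rw [hc, one_div_mul_eq_div, mul_div_assoc', div_le_iff₀ (by positivity)]
    linarith
  have hser : ∀ ω, ENNReal.ofReal (Real.exp (c * X ω ^ 2)) =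
      ∑' k : ℕ, ENNReal.ofReal (c ^ k / k.factorial * X ω ^ (2 * k)) := fun ω => by
    rw [← ENNReal.ofReal_tsum_of_nonneg]
    · rw [Real.exp_eq_exp_ℝ, NormedSpace.exp_eq_tsum_div]
      congr 1
      refine tsum_congr fun k => ?_
      rw [mul_pow, pow_mul]
      ring
    · intro k
      rw [pow_mul]
      positivity
    · refine (Real.summable_pow_div_factorial (c * X ω ^ 2)).congr fun k => ?_
      rw [mul_pow, pow_mul]
      ring
  have hterm : ∀ k : ℕ, ∫⁻ ω, ENNReal.ofReal (c ^ k / k.factorial * X ω ^ (2 * k)) ∂P ≤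
      ENNReal.ofReal ((1 / 2) ^ k) := by
    intro k
    have hint : Integrable (fun ω => X ω ^ (2 * k)) P := by
      have := (memLp_of_subGaussianNorm_le hX h ((2 * k : ℕ) : ℝ≥0))
      have := this.integrable_norm_pow' (p := 2 * k)
      refine this.congr (Filter.Eventually.of_forall fun ω => ?_)
      simp only [Real.norm_eq_abs]
      rw [pow_mul, sq_abs, ← pow_mul]
    rw [← ofReal_integral_eq_lintegral_ofReal (hint.const_mul _)
      (Filter.Eventually.of_forall fun ω => by simp only [pow_mul, Pi.zero_apply]; positivity),
      integral_const_mul]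
    refine ENNReal.ofReal_le_ofReal ?_
    rcases Nat.eq_zero_or_pos k with rfl | hk
    · simp
    · calc c ^ k / k.factorial * ∫ ω, X ω ^ (2 * k) ∂P
          ≤ c ^ k / k.factorial * (2 * k * κ ^ 2) ^ k := by
            gcongr
            exact integral_pow_le_of_subGaussianNorm_le hX h hk
        _ = (k : ℝ) ^ k / k.factorial * (2 * (c * κ ^ 2)) ^ k := by
            rw [mul_pow, mul_pow, mul_pow, mul_pow]; ring
        _ ≤ Real.exp k * (2 * (c * κ ^ 2)) ^ k := by
            gcongr
            exact Real.pow_div_factorial_le_exp _ k.cast_nonneg k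
        _ = (2 * Real.exp 1 * (c * κ ^ 2)) ^ k := by
            rw [← Real.exp_one_pow, ← mul_pow]; ring
        _ ≤ (1 / 2) ^ k := by gcongr
  simp only [hser]
  rw [lintegral_tsum fun k => (((hX.pow_const _).const_mul _).ennreal_ofReal).aemeasurable]
  refine (ENNReal.tsum_le_tsum hterm).trans ?_
  rw [← ENNReal.ofReal_tsum_of_nonneg (fun k => by positivity)
    (summable_geometric_of_lt_one (by norm_num) (by norm_num)),
    tsum_geometric_of_lt_one (by norm_num) (by norm_num)]
  norm_num

/-- The linear term disappears on integrating a centred variable, leaving only the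
square-exponential moment. -/
theorem exp_le_add_exp_sq (x : ℝ) : Real.exp x ≤ x + Real.exp (x ^ 2) := by
  have h2 := Real.add_one_le_exp (x ^ 2)
  rcases le_or_gt |x| 1 with h | h
  · have h1 := (abs_le.1 (Real.abs_exp_sub_one_sub_id_le h)).2
    linarith
  · rcases lt_abs.1 h with h | h
    · have : Real.exp x ≤ Real.exp (x ^ 2) := Real.exp_le_exp.2 (by nlinarith)
      linarith
    · have : Real.exp x ≤ 1 := Real.exp_le_one_iff.2 (by linarith)
      nlinarith

theorem integrable_of_lintegral_ofReal_le {f : Ω → ℝ} (hf : Measurable f) (h0 : ∀ ω, 0 ≤ f ω)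
    {C : ℝ≥0} (h : ∫⁻ ω, ENNReal.ofReal (f ω) ∂P ≤ C) : Integrable f P := by
  refine ⟨hf.aestronglyMeasurable, ?_⟩
  rw [hasFiniteIntegral_iff_ofReal (Filter.Eventually.of_forall h0)]
  exact h.trans_lt ENNReal.coe_lt_top

theorem integral_le_of_lintegral_ofReal_le {f : Ω → ℝ} (hf : Measurable f) (h0 : ∀ ω, 0 ≤ f ω)
    {C : ℝ≥0} (h : ∫⁻ ω, ENNReal.ofReal (f ω) ∂P ≤ C) : ∫ ω, f ω ∂P ≤ C := by
  rw [integral_eq_lintegral_of_nonneg_ae (Filter.Eventually.of_forall h0) hf.aestronglyMeasurable]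
  exact ENNReal.toReal_le_coe_of_le_coe h

/-- For `t² ≤ c`, centring removes the linear term and convexity of `exp` interpolates between 1 and
`exp (c X²)`. For `t² > c`, completing the square in `t X` is enough and the mean plays no role. -/
theorem hasSubgaussianMGF_of_integral_exp_mul_sq_le [IsProbabilityMeasure P] {X : Ω → ℝ}
    (hX : Measurable X) (hXi : Integrable X P) (h0 : ∫ ω, X ω ∂P = 0) {c : ℝ≥0} (hc : 0 < c)
    (h : ∫⁻ ω, ENNReal.ofReal (Real.exp (c * X ω ^ 2)) ∂P ≤ 2) :
    HasSubgaussianMGF X (2 / c) P := by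
  have hc' : (0 : ℝ) < c := hc
  have hm : Measurable fun ω => Real.exp (c * X ω ^ 2) := ((hX.pow_const 2).const_mul _).exp
  have hi := integrable_of_lintegral_ofReal_le (C := 2) hm (fun ω => (Real.exp_pos _).le) h
  have hle := integral_le_of_lintegral_ofReal_le (C := 2) hm (fun ω => (Real.exp_pos _).le) h
  have hconv : ∀ θ : ℝ, 0 ≤ θ → θ ≤ 1 → ∀ ω,
      Real.exp (θ * (c * X ω ^ 2)) ≤ (1 - θ) + θ * Real.exp (c * X ω ^ 2) := by
    intro θ h0 h1 ω
    have := convexOn_exp.2 (Set.mem_univ (0 : ℝ)) (Set.mem_univ ((c : ℝ) * X ω ^ 2))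
      (sub_nonneg.2 h1) h0 (by ring)
    simpa using this
  have hbd : ∀ t ω, Real.exp (t * X ω) ≤
      Real.exp (t ^ 2 / (4 * c)) * Real.exp (c * X ω ^ 2) := fun t ω => by
    rw [← Real.exp_add]
    refine Real.exp_le_exp.2 ?_
    have : t ^ 2 / (4 * c) + c * X ω ^ 2 - t * X ω = (t - 2 * c * X ω) ^ 2 / (4 * c) := by
      field_simp; ring
    have h2 : 0 ≤ (t - 2 * c * X ω) ^ 2 / (4 * c) := by positivity
    linarith
  have hint : ∀ t, Integrable (fun ω => Real.exp (t * X ω)) P := fun t =>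
    Integrable.mono' (hi.const_mul _) (hX.const_mul t).exp.aestronglyMeasurable
      (Filter.Eventually.of_forall fun ω => by
        rw [Real.norm_eq_abs, abs_of_pos (Real.exp_pos _)]; exact hbd t ω)
  have hcint : ∀ θ : ℝ, Integrable (fun ω => (1 - θ) + θ * Real.exp (c * X ω ^ 2)) P := fun θ =>
    (integrable_const _).add (hi.const_mul θ)
  have hcval : ∀ θ : ℝ, 0 ≤ θ → ∫ ω, ((1 - θ) + θ * Real.exp (c * X ω ^ 2)) ∂P ≤ 1 + θ :=
    fun θ hθ => by
      rw [integral_add (integrable_const _) (hi.const_mul θ), integral_const_mul]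
      simp only [integral_const, probReal_univ, one_smul]
      have : θ * ∫ ω, Real.exp (c * X ω ^ 2) ∂P ≤ θ * 2 := mul_le_mul_of_nonneg_left hle hθ
      linarith
  refine ⟨hint, fun t => ?_⟩
  have hgoal : ((2 / c : ℝ≥0) : ℝ) * t ^ 2 / 2 = t ^ 2 / c := by
    push_cast; field_simp
  rw [hgoal, mgf]
  rcases le_or_gt (t ^ 2) c with ht | ht
  · have hθ : t ^ 2 / c ≤ 1 := (div_le_one hc').2 ht
    calc ∫ ω, Real.exp (t * X ω) ∂P
        ≤ ∫ ω, (t * X ω + ((1 - t ^ 2 / c) + t ^ 2 / c * Real.exp (c * X ω ^ 2))) ∂P := by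
          refine integral_mono (hint t) ((hXi.const_mul t).add (hcint _)) fun ω => ?_
          refine (exp_le_add_exp_sq _).trans ?_
          have := hconv (t ^ 2 / c) (by positivity) hθ ω
          have he : t ^ 2 / c * (c * X ω ^ 2) = (t * X ω) ^ 2 := by field_simp
          rw [he] at this
          linarith
      _ ≤ 1 + t ^ 2 / c := by
          rw [integral_add (hXi.const_mul t) (hcint _), integral_const_mul, h0, mul_zero, zero_add]
          exact hcval _ (by positivity)
      _ ≤ Real.exp (t ^ 2 / c) := by
          have := Real.add_one_le_exp (t ^ 2 / c); linarith
  · have hθ : 1 < t ^ 2 / c := (one_lt_div hc').2 ht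
    calc ∫ ω, Real.exp (t * X ω) ∂P
        ≤ ∫ ω, Real.exp (t ^ 2 / (2 * c)) *
            ((1 - 1 / 2) + 1 / 2 * Real.exp (c * X ω ^ 2)) ∂P := by
          refine integral_mono (hint t) ((hcint _).const_mul _) fun ω => ?_
          refine le_trans ?_ (mul_le_mul_of_nonneg_left
            (hconv (1 / 2) (by norm_num) (by norm_num) ω) (Real.exp_pos _).le)
          rw [← Real.exp_add]
          refine Real.exp_le_exp.2 ?_
          have : t ^ 2 / (2 * c) + 1 / 2 * (c * X ω ^ 2) - t * X ω
              = (t - c * X ω) ^ 2 / (2 * c) := by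
            field_simp; ring
          have h2 : 0 ≤ (t - c * X ω) ^ 2 / (2 * c) := by positivity
          linarith
      _ ≤ Real.exp (t ^ 2 / (2 * c)) * Real.exp (1 / 2) := by
          rw [integral_const_mul]
          refine mul_le_mul_of_nonneg_left ?_ (Real.exp_pos _).le
          refine (hcval _ (by norm_num)).trans ?_
          have := Real.add_one_le_exp (1 / 2 : ℝ); linarith
      _ ≤ Real.exp (t ^ 2 / c) := by
          rw [← Real.exp_add]
          refine Real.exp_le_exp.2 ?_
          have : t ^ 2 / (2 * c) = t ^ 2 / c / 2 := by field_simp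
          rw [this]; linarith

theorem hasSubgaussianMGF_of_subGaussianNorm_le [IsProbabilityMeasure P] {X : Ω → ℝ}
    (hX : Measurable X) (h0 : ∫ ω, X ω ∂P = 0) {κ : ℝ≥0} (h : subGaussianNorm P X ≤ κ) :
    HasSubgaussianMGF X (2 * (4 * Real.toNNReal (Real.exp 1) * κ ^ 2 + 1)) P := by
  have hc : (0 : ℝ≥0) < 1 / (4 * Real.toNNReal (Real.exp 1) * κ ^ 2 + 1) := by positivity
  have hi : Integrable X P := memLp_one_iff_integrable.1
    (by simpa using memLp_of_subGaussianNorm_le hX h 1)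
  have := hasSubgaussianMGF_of_integral_exp_mul_sq_le hX hi h0 hc ?_
  · simpa [div_eq_mul_inv] using this
  · have h1 := lintegral_exp_mul_sq_le hX h
    push_cast
    rwa [Real.coe_toNNReal _ (Real.exp_pos 1).le]

/-- Write `exp (s W²)` as the mean of `exp (√(2s) g W)` over a standard Gaussian `g` and exchange
the integrals. The threshold `3/8` is chosen because the Gaussian mean of `exp (3 g² / 8)` is
exactly 2. -/
theorem lintegral_exp_sq_le_of_hasSubgaussianMGF [IsProbabilityMeasure P] {W : Ω → ℝ}
    (hW : Measurable W) {c : ℝ≥0} (h : HasSubgaussianMGF W c P) {s : ℝ} (hs0 : 0 ≤ s)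
    (hs : s * c ≤ 3 / 8) :
    ∫⁻ ω, ENNReal.ofReal (Real.exp (s * W ω ^ 2)) ∂P ≤ 2 := by
  have hgauss : ∀ ω, ENNReal.ofReal (Real.exp (s * W ω ^ 2)) =
      ∫⁻ g, ENNReal.ofReal (Real.exp (√(2 * s) * g * W ω)) ∂gaussianReal 0 1 := fun ω => by
    have h1 := congrFun (mgf_fun_id_gaussianReal (μ := 0) (v := 1)) (√(2 * s) * W ω)
    rw [mgf] at h1
    rw [← ofReal_integral_eq_lintegral_ofReal]
    · congr 1
      calc Real.exp (s * W ω ^ 2)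
          = Real.exp (0 * (√(2 * s) * W ω) + ((1 : ℝ≥0) : ℝ) * (√(2 * s) * W ω) ^ 2 / 2) := by
            rw [mul_pow, Real.sq_sqrt (by positivity)]
            congr 1; push_cast; ring
        _ = _ := by
            rw [← h1]
            refine integral_congr_ae (Filter.Eventually.of_forall fun g => ?_)
            simp only; ring_nf
    · have := integrable_exp_mul_gaussianReal (μ := 0) (v := 1) (√(2 * s) * W ω)
      exact this.congr (Filter.Eventually.of_forall fun g => by simp only; ring_nf)
    · exact Filter.Eventually.of_forall fun g => (Real.exp_pos _).le
  have hmeas : Measurable (Function.uncurry fun (ω : Ω) (g : ℝ) =>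
      ENNReal.ofReal (Real.exp (√(2 * s) * g * W ω))) :=
    (((measurable_snd.const_mul _).mul (hW.comp measurable_fst)).exp).ennreal_ofReal
  simp only [hgauss]
  rw [lintegral_lintegral_swap hmeas.aemeasurable]
  calc ∫⁻ g, ∫⁻ ω, ENNReal.ofReal (Real.exp (√(2 * s) * g * W ω)) ∂P ∂gaussianReal 0 1
      ≤ ∫⁻ g, ENNReal.ofReal (Real.exp (3 / 8 * g ^ 2)) ∂gaussianReal 0 1 := by
        refine lintegral_mono fun g => ?_
        rw [← ofReal_integral_eq_lintegral_ofReal (h.integrable_exp_mul _)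
          (Filter.Eventually.of_forall fun _ => (Real.exp_pos _).le)]
        refine ENNReal.ofReal_le_ofReal ((h.mgf_le _).trans (Real.exp_le_exp.2 ?_))
        rw [mul_pow, Real.sq_sqrt (by positivity)]
        nlinarith [sq_nonneg g]
    _ = ∫⁻ g, ENNReal.ofReal ((√(2 * Real.pi))⁻¹ * Real.exp (-(1 / 8) * g ^ 2)) := by
        rw [gaussianReal_of_var_ne_zero _ one_ne_zero,
          lintegral_withDensity_eq_lintegral_mul _ (measurable_gaussianPDF 0 1) (by fun_prop)]
        refine lintegral_congr fun g => ?_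
        rw [Pi.mul_apply, gaussianPDF, ← ENNReal.ofReal_mul (gaussianPDFReal_nonneg _ _ _),
          gaussianPDFReal, mul_assoc, ← Real.exp_add]
        congr 2
        · simp
        · congr 1; push_cast; ring
    _ = 2 := by
        rw [← ofReal_integral_eq_lintegral_ofReal
          ((integrable_exp_neg_mul_sq (by norm_num)).const_mul _)
          (Filter.Eventually.of_forall fun _ => by positivity), integral_const_mul,
          integral_gaussian]
        have : Real.pi / (1 / 8) = 2 ^ 2 * (2 * Real.pi) := by ring
        rw [this, Real.sqrt_mul (x := 2 ^ 2) (by norm_num), Real.sqrt_sq (by norm_num)]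
        have hpi : √(2 * Real.pi) ≠ 0 := (Real.sqrt_pos.2 (by positivity)).ne'
        rw [mul_left_comm, inv_mul_cancel₀ hpi]
        norm_num

/-- Termwise comparison of power series: every nonconstant term carries `θ` to a power at least two.
-/
theorem cosh_mul_sub_one_le {θ : ℝ} (h0 : 0 ≤ θ) (h1 : θ ≤ 1) (y : ℝ) :
    Real.cosh (θ * y) - 1 ≤ θ ^ 2 * (Real.cosh y - 1) := by
  have h := hasSum_le (fun n => ?_) (Real.hasSum_cosh (θ * y))
    (((Real.hasSum_cosh y).mul_left (θ ^ 2)).add (hasSum_ite_eq 0 (1 - θ ^ 2)))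
  · linarith
  · rcases n with _ | n
    · simp
    · simp only [Nat.add_eq_zero_iff, one_ne_zero, and_false, if_false, add_zero]
      rw [mul_pow, mul_div_assoc]
      refine mul_le_mul_of_nonneg_right ?_ (by rw [pow_mul]; positivity)
      rw [pow_mul, pow_succ]
      exact mul_le_of_le_one_left (sq_nonneg θ)
        (pow_le_one₀ (sq_nonneg θ) (pow_le_one₀ h0 h1))

/-- The moment generating function of a randomly signed product `V W`: the sign turns `exp` into
`cosh`, which has no linear term, so quadratic decay in `r / s` needs no centring. The product is
split by `|V W| ≤ (V² + W²) / 2` and convexity. -/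
theorem integral_cosh_mul_mul_le [IsProbabilityMeasure P] {V W : Ω → ℝ}
    (hV : Measurable V) (hW : Measurable W) {s : ℝ} (hs : 0 < s)
    (hV2 : ∫⁻ ω, ENNReal.ofReal (Real.exp (s * V ω ^ 2)) ∂P ≤ 2)
    (hW2 : ∫⁻ ω, ENNReal.ofReal (Real.exp (s * W ω ^ 2)) ∂P ≤ 2) {r : ℝ} (hr0 : 0 ≤ r)
    (hr : r ≤ s) :
    Integrable (fun ω => Real.cosh (r * (V ω * W ω))) P ∧
      ∫ ω, Real.cosh (r * (V ω * W ω)) ∂P ≤ Real.exp ((r / s) ^ 2) := by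
  have hsq : ∀ {U : Ω → ℝ}, Measurable U →
      ∫⁻ ω, ENNReal.ofReal (Real.exp (s * U ω ^ 2)) ∂P ≤ 2 →
      Integrable (fun ω => Real.exp (s * U ω ^ 2)) P ∧
        ∫ ω, Real.exp (s * U ω ^ 2) ∂P ≤ 2 := fun hU h =>
    ⟨integrable_of_lintegral_ofReal_le (C := 2) ((hU.pow_const 2).const_mul s).exp
      (fun _ => (Real.exp_pos _).le) h,
     integral_le_of_lintegral_ofReal_le (C := 2) ((hU.pow_const 2).const_mul s).exp
      (fun _ => (Real.exp_pos _).le) h⟩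
  obtain ⟨hVi, hVe⟩ := hsq hV hV2
  obtain ⟨hWi, hWe⟩ := hsq hW hW2
  have hpt : ∀ ω, Real.cosh (r * (V ω * W ω)) ≤ (1 - (r / s) ^ 2) +
      ((r / s) ^ 2 / 2 * Real.exp (s * V ω ^ 2) + (r / s) ^ 2 / 2 * Real.exp (s * W ω ^ 2)) := by
    intro ω
    have hU : ∀ u : ℝ, Real.cosh (r * u ^ 2) ≤ 1 + (r / s) ^ 2 * (Real.exp (s * u ^ 2) - 1) := by
      intro u
      have h1 := cosh_mul_sub_one_le (θ := r / s) (by positivity) ((div_le_one hs).2 hr) (s * u ^ 2)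
      have h2 : r / s * (s * u ^ 2) = r * u ^ 2 := by field_simp
      have h3 : Real.cosh (s * u ^ 2) ≤ Real.exp (s * u ^ 2) := by
        rw [← Real.cosh_add_sinh]
        have : 0 ≤ Real.sinh (s * u ^ 2) := Real.sinh_nonneg_iff.2 (by positivity)
        linarith
      rw [h2] at h1
      nlinarith [sq_nonneg (r / s)]
    have habs : Real.cosh (r * (V ω * W ω)) ≤
        Real.cosh (1 / 2 * (r * V ω ^ 2) + 1 / 2 * (r * W ω ^ 2)) := by
      have hnn : 0 ≤ 1 / 2 * (r * V ω ^ 2) + 1 / 2 * (r * W ω ^ 2) := by positivity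
      rw [Real.cosh_le_cosh, abs_mul, abs_of_nonneg hr0, abs_of_nonneg hnn]
      have : |V ω * W ω| ≤ 1 / 2 * V ω ^ 2 + 1 / 2 * W ω ^ 2 := by
        rw [abs_le]
        constructor <;> nlinarith [sq_nonneg (V ω + W ω), sq_nonneg (V ω - W ω)]
      nlinarith
    have hcv : Real.cosh (1 / 2 * (r * V ω ^ 2) + 1 / 2 * (r * W ω ^ 2)) ≤
        1 / 2 * Real.cosh (r * V ω ^ 2) + 1 / 2 * Real.cosh (r * W ω ^ 2) := by
      have c1 := convexOn_exp.2 (Set.mem_univ (r * V ω ^ 2)) (Set.mem_univ (r * W ω ^ 2))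
        (by norm_num : (0 : ℝ) ≤ 1 / 2) (by norm_num : (0 : ℝ) ≤ 1 / 2) (by norm_num)
      have c2 := convexOn_exp.2 (Set.mem_univ (-(r * V ω ^ 2))) (Set.mem_univ (-(r * W ω ^ 2)))
        (by norm_num : (0 : ℝ) ≤ 1 / 2) (by norm_num : (0 : ℝ) ≤ 1 / 2) (by norm_num)
      simp only [smul_eq_mul] at c1 c2
      have c3 : 1 / 2 * -(r * V ω ^ 2) + 1 / 2 * -(r * W ω ^ 2) =
          -(1 / 2 * (r * V ω ^ 2) + 1 / 2 * (r * W ω ^ 2)) := by ring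
      rw [c3] at c2
      simp only [Real.cosh_eq]
      linarith
    have h1 := hU (V ω)
    have h2 := hU (W ω)
    linarith
  have hdom₀ : Integrable (fun ω => (r / s) ^ 2 / 2 * Real.exp (s * V ω ^ 2) +
      (r / s) ^ 2 / 2 * Real.exp (s * W ω ^ 2)) P := (hVi.const_mul _).add (hWi.const_mul _)
  have hdom := (integrable_const (μ := P) (1 - (r / s) ^ 2)).add hdom₀
  have hint : Integrable (fun ω => Real.cosh (r * (V ω * W ω))) P :=
    Integrable.mono' hdom
      (Real.continuous_cosh.measurable.comp ((hV.mul hW).const_mul r)).aestronglyMeasurable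
      (Filter.Eventually.of_forall fun ω => by
        rw [Real.norm_eq_abs, abs_of_pos (Real.cosh_pos _)]; exact hpt ω)
  refine ⟨hint, (integral_mono hint hdom hpt).trans ?_⟩
  simp only [Pi.add_apply]
  rw [integral_add (integrable_const _) hdom₀, integral_add (hVi.const_mul _) (hWi.const_mul _),
    integral_const_mul, integral_const_mul]
  simp only [integral_const, probReal_univ, one_smul]
  have h1 := Real.add_one_le_exp ((r / s) ^ 2)
  nlinarith [sq_nonneg (r / s)]

end SubGaussian

/-! ### Moments of a quadratic chaos when one independent coordinate is added. -/

section Chaos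

variable {Ω : Type*} [MeasurableSpace Ω] {P : Measure Ω}

/-- All moments of `f` are finite. -/
def HasMoments (P : Measure Ω) (f : Ω → ℝ) : Prop := ∀ q : ℝ≥0, MemLp f q P

namespace HasMoments

variable {f g : Ω → ℝ}

theorem add (hf : HasMoments P f) (hg : HasMoments P g) : HasMoments P fun ω => f ω + g ω :=
  fun q => (hf q).add (hg q)

theorem sub (hf : HasMoments P f) (hg : HasMoments P g) : HasMoments P fun ω => f ω - g ω :=
  fun q => (hf q).sub (hg q)

theorem mul (hf : HasMoments P f) (hg : HasMoments P g) : HasMoments P fun ω => f ω * g ω := by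
  intro q
  have : ENNReal.HolderTriple ((2 * q : ℝ≥0) : ℝ≥0∞) ((2 * q : ℝ≥0) : ℝ≥0∞) q := ⟨by
    rw [ENNReal.coe_mul, ENNReal.mul_inv (Or.inl (by simp)) (Or.inl (by simp)), ← add_mul]
    simp [ENNReal.inv_two_add_inv_two]⟩
  exact (hg (2 * q)).mul' (hf (2 * q))

theorem const [IsFiniteMeasure P] (c : ℝ) : HasMoments P fun _ => c := fun _ => memLp_const c

theorem const_mul (c : ℝ) (hf : HasMoments P f) : HasMoments P fun ω => c * f ω :=
  fun q => (hf q).const_mul c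

theorem pow [IsFiniteMeasure P] (hf : HasMoments P f) (n : ℕ) : HasMoments P fun ω => f ω ^ n := by
  induction n with
  | zero => simpa using const (1 : ℝ)
  | succ n ih => simpa only [pow_succ] using ih.mul hf

theorem finsetSum {ι : Type*} {s : Finset ι} {f : ι → Ω → ℝ} (hf : ∀ i ∈ s, HasMoments P (f i)) :
    HasMoments P fun ω => ∑ i ∈ s, f i ω :=
  fun q => memLp_finsetSum s fun i hi => hf i hi q

theorem integrable (hf : HasMoments P f) : Integrable f P :=
  memLp_one_iff_integrable.1 (by simpa using hf 1)

end HasMoments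

theorem sq_integral_mul_le [IsFiniteMeasure P] {f g : Ω → ℝ} (hf : HasMoments P f)
    (hg : HasMoments P g) :
    (∫ ω, f ω * g ω ∂P) ^ 2 ≤ (∫ ω, f ω ^ 2 ∂P) * ∫ ω, g ω ^ 2 ∂P := by
  have key : ∀ t : ℝ, 0 ≤ (∫ ω, g ω ^ 2 ∂P) * (t * t) + (2 * ∫ ω, f ω * g ω ∂P) * t +
      ∫ ω, f ω ^ 2 ∂P := by
    intro t
    have h0 : 0 ≤ ∫ ω, (f ω + t * g ω) ^ 2 ∂P := integral_nonneg fun ω => sq_nonneg _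
    have he : ∀ ω, (f ω + t * g ω) ^ 2 = f ω ^ 2 + ((2 * t) * (f ω * g ω) + t ^ 2 * g ω ^ 2) :=
      fun ω => by ring
    simp only [he] at h0
    rw [integral_add (hf.pow 2).integrable
      (((hf.mul hg).const_mul _).add ((hg.pow 2).const_mul _)).integrable,
      integral_add ((hf.mul hg).const_mul _).integrable ((hg.pow 2).const_mul _).integrable,
      integral_const_mul, integral_const_mul] at h0
    linarith
  have h := discrim_le_zero key
  simp only [discrim] at h
  nlinarith

variable [IsProbabilityMeasure P]

section Step

variable {M l x : Ω → ℝ} {μ : ℝ}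

theorem integral_comp_mul_comp (hM : Measurable M) (hl : Measurable l) (hx : Measurable x)
    (hind : IndepFun (fun ω => (M ω, l ω)) x P) {F : ℝ × ℝ → ℝ} {G : ℝ → ℝ}
    (hF : Measurable F) (hG : Measurable G) :
    ∫ ω, F (M ω, l ω) * G (x ω) ∂P = (∫ ω, F (M ω, l ω) ∂P) * ∫ ω, G (x ω) ∂P :=
  (hind.comp hF hG).integral_fun_mul_eq_mul_integral
    (hF.comp (hM.prodMk hl)).aestronglyMeasurable (hG.comp hx).aestronglyMeasurable

theorem integral_sq_sub_one (hx' : HasMoments P x) (h2 : ∫ ω, x ω ^ 2 ∂P = 1) :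
    ∫ ω, (x ω ^ 2 - 1) ∂P = 0 := by
  rw [integral_sub (hx'.pow 2).integrable (integrable_const _), h2]
  simp

theorem integral_sq_sub_one_sq (hx' : HasMoments P x) (h2 : ∫ ω, x ω ^ 2 ∂P = 1)
    (h4 : ∫ ω, x ω ^ 4 ∂P = μ) : ∫ ω, (x ω ^ 2 - 1) ^ 2 ∂P = μ - 1 := by
  have he : ∀ ω, (x ω ^ 2 - 1) ^ 2 = x ω ^ 4 - (2 * x ω ^ 2 - 1) := fun ω => by ring
  simp only [he]
  rw [integral_sub (hx'.pow 4).integrable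
    (((hx'.pow 2).const_mul 2).sub (HasMoments.const 1)).integrable,
    integral_sub ((hx'.pow 2).const_mul 2).integrable (integrable_const _), integral_const_mul,
    h2, h4]
  simp
  ring

/-- All cross terms vanish: `x` and `x² - 1` are centred and independent of `(M, l)`, while the term
in `l · x (x² - 1)` is killed by the mean of `l`. -/
theorem integral_step_sq (hM : Measurable M) (hl : Measurable l) (hx : Measurable x)
    (hM' : HasMoments P M) (hl' : HasMoments P l) (hx' : HasMoments P x)
    (hind : IndepFun (fun ω => (M ω, l ω)) x P) (h1 : ∫ ω, x ω ∂P = 0)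
    (h2 : ∫ ω, x ω ^ 2 ∂P = 1) (h4 : ∫ ω, x ω ^ 4 ∂P = μ) (hl1 : ∫ ω, l ω ∂P = 0) (a : ℝ) :
    ∫ ω, (M ω + (2 * x ω * l ω + a * (x ω ^ 2 - 1))) ^ 2 ∂P =
      ∫ ω, M ω ^ 2 ∂P + 4 * ∫ ω, l ω ^ 2 ∂P + a ^ 2 * (μ - 1) := by
  have hx2 := (hx'.pow 2).sub (HasMoments.const 1)
  have he : ∀ ω, (M ω + (2 * x ω * l ω + a * (x ω ^ 2 - 1))) ^ 2 =
      M ω ^ 2 + (4 * ((M ω * l ω) * x ω) + (2 * a * (M ω * (x ω ^ 2 - 1)) +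
        (4 * (l ω ^ 2 * x ω ^ 2) + (4 * a * (l ω * (x ω * (x ω ^ 2 - 1))) +
          a ^ 2 * (x ω ^ 2 - 1) ^ 2)))) := fun ω => by ring
  simp only [he]
  have i1 := (hM'.pow 2)
  have i2 := ((hM'.mul hl').mul hx').const_mul 4
  have i3 := (hM'.mul hx2).const_mul (2 * a)
  have i4 := ((hl'.pow 2).mul (hx'.pow 2)).const_mul 4
  have i5 := (hl'.mul (hx'.mul hx2)).const_mul (4 * a)
  have i6 := (hx2.pow 2).const_mul (a ^ 2)
  rw [integral_add i1.integrable (i2.add (i3.add (i4.add (i5.add i6)))).integrable,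
    integral_add i2.integrable (i3.add (i4.add (i5.add i6))).integrable,
    integral_add i3.integrable (i4.add (i5.add i6)).integrable,
    integral_add i4.integrable (i5.add i6).integrable,
    integral_add i5.integrable i6.integrable]
  simp only [integral_const_mul]
  rw [integral_comp_mul_comp hM hl hx hind (F := fun z => z.1 * z.2) (G := fun t => t)
      (by fun_prop) (by fun_prop),
    integral_comp_mul_comp hM hl hx hind (F := fun z => z.1) (G := fun t => t ^ 2 - 1)
      (by fun_prop) (by fun_prop),
    integral_comp_mul_comp hM hl hx hind (F := fun z => z.2 ^ 2) (G := fun t => t ^ 2)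
      (by fun_prop) (by fun_prop),
    integral_comp_mul_comp hM hl hx hind (F := fun z => z.2) (G := fun t => t * (t ^ 2 - 1))
      (by fun_prop) (by fun_prop), h1, h2, hl1, integral_sq_sub_one hx' h2,
    integral_sq_sub_one_sq hx' h2 h4]
  ring

/-- The arithmetic closing the fourth-moment induction. `R` is the old sum of squared entries, `r`
that of the new off-diagonal row and `a` the new diagonal entry, so the new sum is `R + (2 r + a²)`.
`C` is large enough that each term on the left fits under one term of the expanded square. -/
theorem fourth_moment_step_bound {μ m C B R r a A Q S T U : ℝ} (hμ : 1 ≤ μ) (hm : 0 ≤ m)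
    (hB : 1 ≤ B) (hR : 0 ≤ R) (hr : 0 ≤ r) (hC : 400 * μ * B + 192 * (m + 1) ≤ C)
    (hA : A ≤ (C * R) ^ 2) (hQ : Q ≤ C * R * (B * r)) (hS : S ≤ C * R) (hT : T ≤ (B * r) ^ 2)
    (hU : U ≤ m) :
    A + 64 * Q + 16 * a ^ 2 * (S * (μ - 1)) + 384 * (T * μ) + 192 * a ^ 4 * (U + 1) ≤
      (C * (R + (2 * r + a ^ 2))) ^ 2 := by
  have hBμ : μ ≤ μ * B := le_mul_of_one_le_right (by linarith) hB
  have hBμ' : B ≤ μ * B := le_mul_of_one_le_left (by linarith) hμ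
  have hC1 : 1 ≤ C := by linarith
  have hC400 : 400 * μ * B ≤ C := by linarith
  have hCC : C ≤ C ^ 2 := by rw [sq]; exact le_mul_of_one_le_left (by linarith) hC1
  have hCB : 64 * (C * R * (B * r)) ≤ 4 * C ^ 2 * R * r := by
    have : C * (R * r) * (64 * B) ≤ C * (R * r) * (4 * C) :=
      mul_le_mul_of_nonneg_left (by linarith) (by positivity)
    linarith
  have hCμ : 16 * a ^ 2 * (C * R * (μ - 1)) ≤ 2 * C ^ 2 * R * a ^ 2 := by
    have : a ^ 2 * (C * R) * (16 * (μ - 1)) ≤ a ^ 2 * (C * R) * (2 * C) :=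
      mul_le_mul_of_nonneg_left (by linarith) (by positivity)
    linarith
  have hCl : 384 * ((B * r) ^ 2 * μ) ≤ 4 * C ^ 2 * r ^ 2 := by
    have h5 : (400 * μ * B) ^ 2 ≤ C ^ 2 := pow_le_pow_left₀ (by positivity) hC400 2
    have h6 : B ^ 2 * μ ≤ B ^ 2 * μ ^ 2 := by
      refine mul_le_mul_of_nonneg_left ?_ (sq_nonneg B)
      rw [sq]; exact le_mul_of_one_le_left (by linarith) hμ
    have h8 : 384 * μ * B ^ 2 ≤ 4 * C ^ 2 := by
      have : 0 ≤ B ^ 2 * μ ^ 2 := by positivity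
      linarith
    have h7 : (384 * μ * B ^ 2) * r ^ 2 ≤ (4 * C ^ 2) * r ^ 2 :=
      mul_le_mul_of_nonneg_right h8 (sq_nonneg r)
    linarith
  have hCa : 192 * a ^ 4 * (m + 1) ≤ C ^ 2 * a ^ 4 := by
    have : a ^ 4 * (192 * (m + 1)) ≤ a ^ 4 * C ^ 2 :=
      mul_le_mul_of_nonneg_left (by linarith) (by positivity)
    linarith
  have t4 : 16 * a ^ 2 * (S * (μ - 1)) ≤ 16 * a ^ 2 * (C * R * (μ - 1)) := by
    have : 0 ≤ μ - 1 := by linarith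
    gcongr
  have t5 : 384 * (T * μ) ≤ 384 * ((B * r) ^ 2 * μ) := by
    gcongr
  have t6 : 192 * a ^ 4 * (U + 1) ≤ 192 * a ^ 4 * (m + 1) := by
    gcongr
  have hfin : (C * R) ^ 2 + 4 * C ^ 2 * R * r + 2 * C ^ 2 * R * a ^ 2 + 4 * C ^ 2 * r ^ 2 +
      C ^ 2 * a ^ 4 + C ^ 2 * (4 * r * a ^ 2) = (C * (R + (2 * r + a ^ 2))) ^ 2 := by
    ring
  have : 0 ≤ C ^ 2 * (4 * r * a ^ 2) := by positivity
  linarith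

/-- The increment is centred given `(M, l)`, so the term cubic in `M` integrates to zero; the mixed
second-order terms are handled by Cauchy–Schwarz. -/
theorem integral_step_pow_four_le (hM : Measurable M) (hl : Measurable l) (hx : Measurable x)
    (hM' : HasMoments P M) (hl' : HasMoments P l) (hx' : HasMoments P x)
    (hind : IndepFun (fun ω => (M ω, l ω)) x P) (h1 : ∫ ω, x ω ∂P = 0)
    (h2 : ∫ ω, x ω ^ 2 ∂P = 1) (h4 : ∫ ω, x ω ^ 4 ∂P = μ) (hμ : 1 ≤ μ) {m : ℝ} (hm : 0 ≤ m)
    (h8 : ∫ ω, x ω ^ 8 ∂P ≤ m) {C B R r a : ℝ} (hB : 1 ≤ B) (hR : 0 ≤ R) (hr : 0 ≤ r)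
    (hC : 400 * μ * B + 192 * (m + 1) ≤ C)
    (hM4 : ∫ ω, M ω ^ 4 ∂P ≤ (C * R) ^ 2) (hl4 : ∫ ω, l ω ^ 4 ∂P ≤ (B * r) ^ 2) :
    ∫ ω, (M ω + (2 * x ω * l ω + a * (x ω ^ 2 - 1))) ^ 4 ∂P ≤
      (C * (R + (2 * r + a ^ 2))) ^ 2 := by
  have hx2 := (hx'.pow 2).sub (HasMoments.const 1)
  have i1 := (hM'.pow 4)
  have i2 := (((hM'.pow 3).mul hl').mul hx').const_mul 8
  have i3 := ((hM'.pow 3).mul hx2).const_mul (4 * a)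
  have i4 := (((hM'.pow 2).mul (hl'.pow 2)).mul (hx'.pow 2)).const_mul 64
  have i5 := ((hM'.pow 2).mul (hx2.pow 2)).const_mul (16 * a ^ 2)
  have i6 := ((hl'.pow 4).mul (hx'.pow 4)).const_mul 384
  have i7 := ((hx'.pow 8).add (HasMoments.const 1)).const_mul (192 * a ^ 4)
  have hleft : HasMoments P fun ω => (M ω + (2 * x ω * l ω + a * (x ω ^ 2 - 1))) ^ 4 :=
    (hM'.add (((hx'.const_mul 2).mul hl').add (hx2.const_mul a))).pow 4
  have hright := i1.add (i2.add (i3.add (i4.add (i5.add (i6.add i7)))))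
  have hle := integral_mono hleft.integrable hright.integrable fun ω => by
    set d := 2 * x ω * l ω + a * (x ω ^ 2 - 1) with hd
    -- Only `4 M d³` is estimated; `4 M³ d` is kept exact because its integral vanishes.
    have e1 : (M ω + d) ^ 4 ≤ M ω ^ 4 + 4 * M ω ^ 3 * d + 8 * (M ω ^ 2 * d ^ 2) + 3 * d ^ 4 := by
      nlinarith [sq_nonneg (d * (M ω - d))]
    have e2 : d ^ 2 ≤ 8 * (l ω ^ 2 * x ω ^ 2) + 2 * (a ^ 2 * (x ω ^ 2 - 1) ^ 2) := by
      rw [hd]; nlinarith [sq_nonneg (2 * x ω * l ω - a * (x ω ^ 2 - 1))]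
    have e3 : d ^ 4 ≤ 128 * (l ω ^ 4 * x ω ^ 4) + 8 * (a ^ 4 * (x ω ^ 2 - 1) ^ 4) := by
      have := pow_le_pow_left₀ (sq_nonneg d) e2 2
      nlinarith [sq_nonneg (8 * (l ω ^ 2 * x ω ^ 2) - 2 * (a ^ 2 * (x ω ^ 2 - 1) ^ 2))]
    have e4 : (x ω ^ 2 - 1) ^ 4 ≤ 8 * (x ω ^ 8 + 1) := by
      have f1 : (x ω ^ 2 - 1) ^ 2 ≤ 2 * x ω ^ 4 + 2 := by nlinarith [sq_nonneg (x ω ^ 2 + 1)]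
      have := pow_le_pow_left₀ (sq_nonneg _) f1 2
      nlinarith [sq_nonneg (x ω ^ 4 - 1)]
    have e5 := mul_le_mul_of_nonneg_left e2 (sq_nonneg (M ω))
    have e6 := mul_le_mul_of_nonneg_left e4 (by positivity : 0 ≤ a ^ 4)
    calc (M ω + d) ^ 4 ≤ M ω ^ 4 + 4 * M ω ^ 3 * d + 8 * (M ω ^ 2 * d ^ 2) + 3 * d ^ 4 := e1
      _ ≤ M ω ^ 4 + 4 * M ω ^ 3 * d + 8 * (M ω ^ 2 * (8 * (l ω ^ 2 * x ω ^ 2) +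
            2 * (a ^ 2 * (x ω ^ 2 - 1) ^ 2))) + 3 * (128 * (l ω ^ 4 * x ω ^ 4) +
            8 * (a ^ 4 * (8 * (x ω ^ 8 + 1)))) := by linarith
      _ = _ := by rw [hd]; ring
  refine hle.trans ?_
  rw [integral_add i1.integrable (i2.add (i3.add (i4.add (i5.add (i6.add i7))))).integrable,
    integral_add i2.integrable (i3.add (i4.add (i5.add (i6.add i7)))).integrable,
    integral_add i3.integrable (i4.add (i5.add (i6.add i7))).integrable,
    integral_add i4.integrable (i5.add (i6.add i7)).integrable,
    integral_add i5.integrable (i6.add i7).integrable,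
    integral_add i6.integrable i7.integrable]
  simp only [integral_const_mul]
  rw [integral_add (hx'.pow 8).integrable (integrable_const _),
    integral_comp_mul_comp hM hl hx hind (F := fun z => z.1 ^ 3 * z.2) (G := fun t => t)
      (by fun_prop) (by fun_prop),
    integral_comp_mul_comp hM hl hx hind (F := fun z => z.1 ^ 3) (G := fun t => t ^ 2 - 1)
      (by fun_prop) (by fun_prop),
    integral_comp_mul_comp hM hl hx hind (F := fun z => z.1 ^ 2 * z.2 ^ 2) (G := fun t => t ^ 2)
      (by fun_prop) (by fun_prop),
    integral_comp_mul_comp hM hl hx hind (F := fun z => z.1 ^ 2) (G := fun t => (t ^ 2 - 1) ^ 2)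
      (by fun_prop) (by fun_prop),
    integral_comp_mul_comp hM hl hx hind (F := fun z => z.2 ^ 4) (G := fun t => t ^ 4)
      (by fun_prop) (by fun_prop), h1, h2, h4, integral_sq_sub_one hx' h2,
    integral_sq_sub_one_sq hx' h2 h4]
  simp only [integral_const, probReal_univ, one_smul]
  have hpow : ∀ u : ℝ, (u ^ 2) ^ 2 = u ^ 4 := fun u => by ring
  have hC0 : 0 ≤ C := le_trans (by positivity) hC
  have hML : ∫ ω, M ω ^ 2 * l ω ^ 2 ∂P ≤ C * R * (B * r) := by
    refine le_of_sq_le_sq ?_ (by positivity)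
    refine (sq_integral_mul_le (hM'.pow 2) (hl'.pow 2)).trans ?_
    simp only [hpow]
    rw [mul_pow]
    exact mul_le_mul hM4 hl4 (integral_nonneg fun ω => by positivity) (by positivity)
  have hM2 : ∫ ω, M ω ^ 2 ∂P ≤ C * R := by
    refine le_of_sq_le_sq ?_ (by positivity)
    have := sq_integral_mul_le (hM'.pow 2) (HasMoments.const (P := P) 1)
    simp only [hpow, mul_one] at this
    refine this.trans ?_
    simpa using hM4
  have := fourth_moment_step_bound (A := ∫ ω, M ω ^ 4 ∂P) (a := a) hμ hm hB hR hr hC hM4 hML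
    hM2 hl4 h8
  linarith

end Step

end Chaos

/-! ### Moments and small-ball behaviour of a quadratic form in one covariate. -/

section Row

variable {Ω : Type*} [MeasurableSpace Ω] {P : Measure Ω}

/-- The entries of a single covariate: independent, with the moments of the design. -/
structure IsRow (P : Measure Ω) {p : ℕ} (ξ : Fin p → Ω → ℝ) (μ : ℝ) (κ : ℝ≥0) : Prop where
  measurable : ∀ l, Measurable (ξ l)
  indep : iIndepFun ξ P
  mean : ∀ l, ∫ ω, ξ l ω ∂P = 0
  variance : ∀ l, ∫ ω, ξ l ω ^ 2 ∂P = 1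
  fourth_moment : ∀ l, ∫ ω, ξ l ω ^ 4 ∂P = μ
  subGaussian : ∀ l, subGaussianNorm P (ξ l) ≤ κ

variable [IsProbabilityMeasure P] {p : ℕ} {ξ : Fin p → Ω → ℝ} {μ : ℝ} {κ : ℝ≥0}

namespace IsRow

theorem hasMoments (h : IsRow P ξ μ κ) (l : Fin p) : HasMoments P (ξ l) :=
  memLp_of_subGaussianNorm_le (h.measurable l) (h.subGaussian l)

theorem integral_pow_eight_le (h : IsRow P ξ μ κ) (l : Fin p) :
    ∫ ω, ξ l ω ^ 8 ∂P ≤ (8 * (κ : ℝ) ^ 2) ^ 4 := by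
  have := integral_pow_le_of_subGaussianNorm_le (h.measurable l) (h.subGaussian l)
    (by norm_num : 1 ≤ 4)
  norm_num at this ⊢
  exact this

theorem indepFun_past (h : IsRow P ξ μ κ) {S : Finset (Fin p)} {k : Fin p} (hk : k ∉ S)
    {F G : (S → ℝ) → ℝ} (hF : Measurable F) (hG : Measurable G) :
    IndepFun (fun ω => (F fun i : S => ξ i ω, G fun i : S => ξ i ω)) (ξ k) P := by
  have h1 := h.indep.indepFun_finset S {k} (Finset.disjoint_singleton_right.2 hk) h.measurable
  have h2 : Measurable fun v : ({k} : Finset (Fin p)) → ℝ => v ⟨k, Finset.mem_singleton_self k⟩ :=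
    measurable_pi_apply _
  exact h1.comp (hF.prodMk hG) h2

theorem hasMoments_linear (h : IsRow P ξ μ κ) (S : Finset (Fin p)) (c : Fin p → ℝ) :
    HasMoments P fun ω => ∑ j ∈ S, c j * ξ j ω :=
  HasMoments.finsetSum fun j _ => (h.hasMoments j).const_mul (c j)

theorem measurable_linear (h : IsRow P ξ μ κ) (S : Finset (Fin p)) (c : Fin p → ℝ) :
    Measurable fun ω => ∑ j ∈ S, c j * ξ j ω :=
  Finset.measurable_sum _ fun j _ => (h.measurable j).const_mul (c j)

theorem integral_linear (h : IsRow P ξ μ κ) (S : Finset (Fin p)) (c : Fin p → ℝ) :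
    ∫ ω, ∑ j ∈ S, c j * ξ j ω ∂P = 0 := by
  rw [integral_finsetSum _ fun j _ => ((h.hasMoments j).const_mul (c j)).integrable]
  simp [integral_const_mul, h.mean]

theorem indepFun_linear (h : IsRow P ξ μ κ) {S : Finset (Fin p)} {k : Fin p} (hk : k ∉ S)
    {F : (S → ℝ) → ℝ} (hF : Measurable F) (c : Fin p → ℝ) :
    IndepFun (fun ω => (F fun i : S => ξ i ω, ∑ j ∈ S, c j * ξ j ω)) (ξ k) P := by
  have := h.indepFun_past hk hF (G := fun v => ∑ j : S, c j * v j)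
    (Finset.measurable_sum _ fun j _ => (measurable_pi_apply j).const_mul _)
  convert this using 3 with ω
  exact (Finset.sum_coe_sort S fun j => c j * ξ j ω).symm

theorem integral_linear_moments (h : IsRow P ξ μ κ) (hμ : 1 ≤ μ) (S : Finset (Fin p))
    (c : Fin p → ℝ) :
    ∫ ω, (∑ j ∈ S, c j * ξ j ω) ^ 2 ∂P = ∑ j ∈ S, c j ^ 2 ∧
      ∫ ω, (∑ j ∈ S, c j * ξ j ω) ^ 4 ∂P ≤ 3 * μ * (∑ j ∈ S, c j ^ 2) ^ 2 := by
  induction S using Finset.induction_on with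
  | empty => simp
  | insert k S hk ih =>
    obtain ⟨ih2, ih4⟩ := ih
    have hind : IndepFun (fun ω => (∑ j ∈ S, c j * ξ j ω, ∑ j ∈ S, c j * ξ j ω)) (ξ k) P := by
      have := h.indepFun_linear hk (F := fun v => ∑ j : S, c j * v j)
        (Finset.measurable_sum _ fun j _ => (measurable_pi_apply j).const_mul _) c
      convert this using 3 with ω
      exact (Finset.sum_coe_sort S fun j => c j * ξ j ω).symm
    have hl := h.measurable_linear S c
    have hl' := h.hasMoments_linear S c
    have hl1 := h.integral_linear S c
    have hx := h.measurable k
    have hx' := h.hasMoments k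
    simp only [Finset.sum_insert hk]
    set l : Ω → ℝ := fun ω => ∑ j ∈ S, c j * ξ j ω with hldef
    set x := ξ k with hxdef
    set a := c k
    have e2 : ∀ ω, (a * x ω + ∑ j ∈ S, c j * ξ j ω) ^ 2 =
        a ^ 2 * x ω ^ 2 + (2 * a * (l ω * x ω) + l ω ^ 2) := fun ω => by
      simp only [hldef]; ring
    have e4 : ∀ ω, (a * x ω + ∑ j ∈ S, c j * ξ j ω) ^ 4 =
        a ^ 4 * x ω ^ 4 + (4 * a ^ 3 * (l ω * x ω ^ 3) + (6 * a ^ 2 * (l ω ^ 2 * x ω ^ 2) +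
          (4 * a * (l ω ^ 3 * x ω) + l ω ^ 4))) := fun ω => by
      simp only [hldef]; ring
    simp only [e2, e4]
    have i1 := (hx'.pow 2).const_mul (a ^ 2)
    have i2 := (hl'.mul hx').const_mul (2 * a)
    have i3 := hl'.pow 2
    have j1 := (hx'.pow 4).const_mul (a ^ 4)
    have j2 := (hl'.mul (hx'.pow 3)).const_mul (4 * a ^ 3)
    have j3 := ((hl'.pow 2).mul (hx'.pow 2)).const_mul (6 * a ^ 2)
    have j4 := ((hl'.pow 3).mul hx').const_mul (4 * a)
    have j5 := hl'.pow 4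
    constructor
    · rw [integral_add i1.integrable (i2.add i3).integrable,
        integral_add i2.integrable i3.integrable]
      simp only [integral_const_mul]
      rw [integral_comp_mul_comp hl hl hx hind (F := fun z => z.1) (G := fun t => t)
        (by fun_prop) (by fun_prop), h.mean, h.variance, ih2]
      ring
    · rw [integral_add j1.integrable (j2.add (j3.add (j4.add j5))).integrable,
        integral_add j2.integrable (j3.add (j4.add j5)).integrable,
        integral_add j3.integrable (j4.add j5).integrable,
        integral_add j4.integrable j5.integrable]
      simp only [integral_const_mul]
      rw [integral_comp_mul_comp hl hl hx hind (F := fun z => z.1) (G := fun t => t ^ 3)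
        (by fun_prop) (by fun_prop),
        integral_comp_mul_comp hl hl hx hind (F := fun z => z.1 ^ 2) (G := fun t => t ^ 2)
        (by fun_prop) (by fun_prop),
        integral_comp_mul_comp hl hl hx hind (F := fun z => z.1 ^ 3) (G := fun t => t)
        (by fun_prop) (by fun_prop), h.mean, h.variance, h.fourth_moment, ih2, hl1]
      set r := ∑ j ∈ S, c j ^ 2 with hr
      have hr0 : 0 ≤ r := Finset.sum_nonneg fun j _ => sq_nonneg _
      have h1 : 6 * a ^ 2 * r ≤ μ * (6 * a ^ 2 * r) := le_mul_of_one_le_left (by positivity) hμ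
      have h2 : 0 ≤ μ * a ^ 4 := by positivity
      nlinarith

theorem _root_.Finset.sum_sum_insert_of_symm {ι : Type*} [DecidableEq ι] {S : Finset ι} {k : ι}
    (hk : k ∉ S) {f : ι → ι → ℝ} (hf : ∀ i j, f i j = f j i) :
    ∑ i ∈ insert k S, ∑ j ∈ insert k S, f i j =
      ∑ i ∈ S, ∑ j ∈ S, f i j + (2 * ∑ j ∈ S, f k j + f k k) := by
  simp only [Finset.sum_insert hk, Finset.sum_add_distrib, hf _ k]
  ring

/-- Adding coordinates one by one presents the centred quadratic form as a martingale with
increments `2 ξ_k l + D_kk (ξ_k² - 1)`, where `l` is linear in the earlier coordinates. The sum of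
squared entries grows in exactly the pattern of the one-step estimates. -/
theorem integral_chaos_moments (h : IsRow P ξ μ κ) (hμ : 1 ≤ μ) {D : Fin p → Fin p → ℝ}
    (hD : ∀ i j, D i j = D j i) {C : ℝ}
    (hC : 400 * μ * (3 * μ) + 192 * ((8 * (κ : ℝ) ^ 2) ^ 4 + 1) ≤ C) (S : Finset (Fin p)) :
    ∫ ω, (∑ i ∈ S, ∑ j ∈ S, D i j * (ξ i ω * ξ j ω) - ∑ i ∈ S, D i i) ∂P = 0 ∧
    min (μ - 1) 2 * ∑ i ∈ S, ∑ j ∈ S, D i j ^ 2 ≤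
      ∫ ω, (∑ i ∈ S, ∑ j ∈ S, D i j * (ξ i ω * ξ j ω) - ∑ i ∈ S, D i i) ^ 2 ∂P ∧
    ∫ ω, (∑ i ∈ S, ∑ j ∈ S, D i j * (ξ i ω * ξ j ω) - ∑ i ∈ S, D i i) ^ 4 ∂P ≤
      (C * ∑ i ∈ S, ∑ j ∈ S, D i j ^ 2) ^ 2 := by
  induction S using Finset.induction_on with
  | empty => simp
  | insert k S hk ih =>
    obtain ⟨ih1, ih2, ih4⟩ := ih
    set M : Ω → ℝ := fun ω => ∑ i ∈ S, ∑ j ∈ S, D i j * (ξ i ω * ξ j ω) - ∑ i ∈ S, D i i with hM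
    set l : Ω → ℝ := fun ω => ∑ j ∈ S, D k j * ξ j ω with hl
    have hstep : ∀ ω, ∑ i ∈ insert k S, ∑ j ∈ insert k S, D i j * (ξ i ω * ξ j ω) -
        ∑ i ∈ insert k S, D i i =
        M ω + (2 * ξ k ω * l ω + D k k * (ξ k ω ^ 2 - 1)) := fun ω => by
      rw [Finset.sum_sum_insert_of_symm hk (f := fun i j => D i j * (ξ i ω * ξ j ω))
        (fun i j => by rw [hD i j, mul_comm (ξ i ω)]), Finset.sum_insert hk]
      have : ∑ j ∈ S, D k j * (ξ k ω * ξ j ω) = ξ k ω * l ω := by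
        rw [hl, Finset.mul_sum]
        exact Finset.sum_congr rfl fun j _ => by ring
      rw [this, hM]
      ring
    have hMm : Measurable M := (Finset.measurable_sum _ fun i _ => Finset.measurable_sum _
      fun j _ => ((h.measurable i).mul (h.measurable j)).const_mul _).sub_const _
    have hM' : HasMoments P M := (HasMoments.finsetSum fun i _ => HasMoments.finsetSum
      fun j _ => ((h.hasMoments i).mul (h.hasMoments j)).const_mul _).sub (HasMoments.const _)
    have hlm : Measurable l := h.measurable_linear S (D k)
    have hl' : HasMoments P l := h.hasMoments_linear S (D k)
    have hl1 : ∫ ω, l ω ∂P = 0 := h.integral_linear S (D k)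
    have hx := h.measurable k
    have hx' := h.hasMoments k
    have hind : IndepFun (fun ω => (M ω, l ω)) (ξ k) P := by
      have := h.indepFun_linear hk
        (F := fun v => ∑ i : S, ∑ j : S, D i j * (v i * v j) - ∑ i ∈ S, D i i)
        ((Finset.measurable_sum _ fun i _ => Finset.measurable_sum _ fun j _ =>
          ((measurable_pi_apply i).mul (measurable_pi_apply j)).const_mul _).sub_const _) (D k)
      convert this using 3 with ω
      rw [hM]
      refine congrArg (· - ∑ i ∈ S, D i i) ?_
      rw [← Finset.sum_coe_sort S]
      refine Finset.sum_congr rfl fun i _ => ?_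
      rw [← Finset.sum_coe_sort S]
    obtain ⟨hl2, hl4⟩ := h.integral_linear_moments hμ S (D k)
    have hr0 : 0 ≤ ∑ j ∈ S, D k j ^ 2 := Finset.sum_nonneg fun j _ => sq_nonneg _
    simp only [hstep]
    rw [Finset.sum_sum_insert_of_symm hk (f := fun i j => D i j ^ 2) (fun i j => by rw [hD i j])]
    refine ⟨?_, ?_, ?_⟩
    · have i2 := (hx'.const_mul 2).mul hl'
      have i3 := ((hx'.pow 2).sub (HasMoments.const 1)).const_mul (D k k)
      rw [integral_add hM'.integrable (i2.add i3).integrable,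
        integral_add i2.integrable i3.integrable, ih1, integral_const_mul,
        integral_sq_sub_one hx' (h.variance k)]
      have he : ∀ ω, 2 * ξ k ω * l ω = 2 * (l ω * ξ k ω) := fun ω => by ring
      simp only [he, integral_const_mul]
      rw [integral_comp_mul_comp hMm hlm hx hind (F := fun z => z.2) (G := fun t => t)
        (by fun_prop) (by fun_prop), hl1]
      ring
    · rw [integral_step_sq hMm hlm hx hM' hl' hx' hind (h.mean k) (h.variance k)
        (h.fourth_moment k) hl1, hl2]
      -- Off-diagonal squares enter the variance with weight 2, diagonal ones with weight `μ - 1`;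
      -- hence the minimum.
      have h1 : min (μ - 1) 2 * (2 * ∑ j ∈ S, D k j ^ 2) ≤ 2 * (2 * ∑ j ∈ S, D k j ^ 2) :=
        mul_le_mul_of_nonneg_right (min_le_right _ _) (by positivity)
      have h2 : min (μ - 1) 2 * D k k ^ 2 ≤ (μ - 1) * D k k ^ 2 :=
        mul_le_mul_of_nonneg_right (min_le_left _ _) (by positivity)
      linarith
    · refine integral_step_pow_four_le hMm hlm hx hM' hl' hx' hind (h.mean k) (h.variance k)
        (h.fourth_moment k) hμ (by positivity) (h.integral_pow_eight_le k) (B := 3 * μ)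
        (by linarith) (Finset.sum_nonneg fun i _ => Finset.sum_nonneg fun j _ => sq_nonneg _)
        hr0 hC ih4 (hl4.trans ?_)
      rw [mul_pow]
      refine mul_le_mul_of_nonneg_right ?_ (sq_nonneg _)
      nlinarith

end IsRow

/-- A Paley–Zygmund minorant: with `y = z² / (K s)`, the polynomial `y - y² / 4` lies below both
`|z| / √s` and 1. It involves only `z²` and `z⁴`, so its mean is bounded below from the second and
fourth moments. -/
theorem le_min_abs_sqrt {c s K : ℝ} (hc : 0 < c) (hcs : c ≤ s) (hK : 1 ≤ K) (z : ℝ) :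
    √c * (1 / K / s * z ^ 2 - (1 / K) ^ 2 / (4 * s ^ 2) * z ^ 4) ≤ min |z| √c := by
  have hs0 : 0 < s := hc.trans_le hcs
  have hs : 0 < √s := Real.sqrt_pos.2 hs0
  have hcs' : √c ≤ √s := Real.sqrt_le_sqrt hcs
  obtain ⟨w, hw0, hzw⟩ : ∃ w, 0 ≤ w ∧ |z| = w * √s :=
    ⟨|z| / √s, by positivity, by field_simp⟩
  have hsq : z ^ 2 = w ^ 2 * s := by
    rw [← sq_abs, hzw, mul_pow, Real.sq_sqrt hs0.le]
  have h4 : z ^ 4 = w ^ 4 * s ^ 2 := by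
    have : z ^ 4 = (z ^ 2) ^ 2 := by ring
    rw [this, hsq]; ring
  have hexpr : 1 / K / s * z ^ 2 - (1 / K) ^ 2 / (4 * s ^ 2) * z ^ 4 =
      1 / K * w ^ 2 - (1 / K * w ^ 2) ^ 2 / 4 := by
    rw [hsq, h4]; field_simp
  have hu1 : 1 / K ≤ 1 := (div_le_one (by linarith)).2 hK
  have hyw : 1 / K * w ^ 2 ≤ w ^ 2 := mul_le_of_le_one_left (sq_nonneg w) hu1
  rw [hexpr]
  generalize 1 / K * w ^ 2 = y at hyw ⊢
  have hmin : y - y ^ 2 / 4 ≤ min w 1 := by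
    refine le_min ?_ (by nlinarith [sq_nonneg (y - 2)])
    rcases le_total w 1 with h1 | h1
    · nlinarith [sq_nonneg y]
    · nlinarith [sq_nonneg (y - 2)]
  calc √c * (y - y ^ 2 / 4) ≤ √c * min w 1 :=
        mul_le_mul_of_nonneg_left hmin (Real.sqrt_nonneg c)
    _ = min (√c * w) (√c * 1) := mul_min_of_nonneg _ _ (Real.sqrt_nonneg c)
    _ ≤ min |z| √c := by
        rw [mul_one, hzw]
        refine min_le_min_right _ ?_
        rw [mul_comm]
        gcongr

/-- A small-ball estimate for quadratic forms. -/
theorem exists_le_integral_min_abs (μ : ℝ) (hμ : 1 < μ) (κ : ℝ≥0) :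
    ∃ τ q : ℝ, 0 < τ ∧ 0 < q ∧
      ∀ {Ω : Type*} [MeasurableSpace Ω] (P : Measure Ω) [IsProbabilityMeasure P] {p : ℕ}
        {ξ : Fin p → Ω → ℝ}, IsRow P ξ μ κ → ∀ {D : Fin p → Fin p → ℝ}, (∀ i j, D i j = D j i) →
        ∑ i, ∑ j, D i j ^ 2 = 1 →
        q ≤ ∫ ω, min |∑ i, ∑ j, D i j * (ξ i ω * ξ j ω)| τ ∂P := by
  set c := min (μ - 1) 2 with hc
  set C := 400 * μ * (3 * μ) + 192 * ((8 * (κ : ℝ) ^ 2) ^ 4 + 1) with hC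
  have hc0 : 0 < c := lt_min (by linarith) (by norm_num)
  have hC0 : 0 < C := by positivity
  -- `K` bounds the kurtosis of the uncentred form. The two summands come from the centred fourth
  -- moment and from the trace, and 8 from `(u + v)⁴ ≤ 8 (u⁴ + v⁴)`.
  set K := 8 * (C ^ 2 / c ^ 2 + 1) with hK
  have hK1 : 1 ≤ K := by
    have : 0 ≤ C ^ 2 / c ^ 2 := by positivity
    linarith
  refine ⟨√c, √c * (3 / (4 * K)), Real.sqrt_pos.2 hc0,
    mul_pos (Real.sqrt_pos.2 hc0) (by positivity), ?_⟩
  intro Ω _ P _ p ξ h D hD hD1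
  obtain ⟨m1, m2, m4⟩ := h.integral_chaos_moments hμ.le hD hC.ge Finset.univ
  rw [hD1, mul_one] at m2 m4
  set Z : Ω → ℝ := fun ω => ∑ i, ∑ j, D i j * (ξ i ω * ξ j ω) with hZ
  set t := ∑ i, D i i with ht
  have hZm : Measurable Z := Finset.measurable_sum _ fun i _ => Finset.measurable_sum _
      fun j _ => ((h.measurable i).mul (h.measurable j)).const_mul _
  have hZ' : HasMoments P Z := HasMoments.finsetSum fun i _ => HasMoments.finsetSum
      fun j _ => ((h.hasMoments i).mul (h.hasMoments j)).const_mul _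
  have hM' : HasMoments P fun ω => Z ω - t := hZ'.sub (HasMoments.const t)
  set V := ∫ ω, (Z ω - t) ^ 2 ∂P with hV
  have hZ2 : ∫ ω, Z ω ^ 2 ∂P = V + t ^ 2 := by
    have he : ∀ ω, Z ω ^ 2 = (Z ω - t) ^ 2 + (2 * t * (Z ω - t) + t ^ 2) := fun ω => by ring
    simp only [he]
    rw [integral_add (hM'.pow 2).integrable
      ((hM'.const_mul (2 * t)).add (HasMoments.const (t ^ 2))).integrable,
      integral_add (hM'.const_mul (2 * t)).integrable (integrable_const _), integral_const_mul, m1]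
    simp [hV]
  set s2 := ∫ ω, Z ω ^ 2 ∂P with hs2
  have hs2c : c ≤ s2 := by rw [hZ2]; nlinarith [sq_nonneg t]
  have hs20 : 0 < s2 := hc0.trans_le hs2c
  -- The trace `t` has no dimension-free bound, but `t²` is part of the second moment `s2`, so the
  -- comparison with `s2 ^ 2` is uniform in `p`.
  have hZ4 : ∫ ω, Z ω ^ 4 ∂P ≤ K * s2 ^ 2 := by
    have hle := integral_mono (hZ'.pow 4).integrable
      (((hM'.pow 4).const_mul 8).add (HasMoments.const (8 * t ^ 4))).integrable fun ω => by
        have h1 : Z ω ^ 2 ≤ 2 * (Z ω - t) ^ 2 + 2 * t ^ 2 := by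
          nlinarith [sq_nonneg (Z ω - t - t)]
        have h2 := pow_le_pow_left₀ (sq_nonneg _) h1 2
        change Z ω ^ 4 ≤ 8 * (Z ω - t) ^ 4 + 8 * t ^ 4
        nlinarith [sq_nonneg ((Z ω - t) ^ 2 - t ^ 2)]
    refine hle.trans ?_
    rw [integral_add ((hM'.pow 4).const_mul 8).integrable (integrable_const _),
      integral_const_mul]
    simp only [integral_const, probReal_univ, one_smul]
    have h1 : C ^ 2 ≤ C ^ 2 / c ^ 2 * s2 ^ 2 := by
      rw [div_mul_eq_mul_div, le_div_iff₀ (by positivity)]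
      gcongr
    have h2 : t ^ 4 ≤ s2 ^ 2 := by
      have : t ^ 2 ≤ s2 := by rw [hZ2]; linarith
      have := pow_le_pow_left₀ (sq_nonneg t) this 2
      linarith
    rw [hK]
    linarith
  have hpt := fun ω => le_min_abs_sqrt hc0 hs2c hK1 (Z ω)
  have i2 := (hZ'.pow 2).const_mul (1 / K / s2)
  have i4 := (hZ'.pow 4).const_mul ((1 / K) ^ 2 / (4 * s2 ^ 2))
  have hminint : Integrable (fun ω => min |Z ω| √c) P :=
    hZ'.integrable.abs.inf (integrable_const _)
  refine le_trans ?_ (integral_mono ((i2.sub i4).const_mul √c).integrable hminint hpt)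
  rw [integral_const_mul, integral_sub i2.integrable i4.integrable, integral_const_mul,
    integral_const_mul, ← hs2]
  refine mul_le_mul_of_nonneg_left ?_ (Real.sqrt_nonneg c)
  have h1 : (1 / K) ^ 2 / (4 * s2 ^ 2) * ∫ ω, Z ω ^ 4 ∂P ≤
      (1 / K) ^ 2 / (4 * s2 ^ 2) * (K * s2 ^ 2) := mul_le_mul_of_nonneg_left hZ4 (by positivity)
  have h2 : (1 / K) ^ 2 / (4 * s2 ^ 2) * (K * s2 ^ 2) = 1 / (4 * K) := by field_simp
  have h3 : 1 / K / s2 * s2 = 1 / K := by field_simp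
  have h4 : 3 / (4 * K) = 1 / K - 1 / (4 * K) := by field_simp; norm_num
  rw [h4, h3]
  linarith

end Row

/-! ### Nets of the unit ball and operator norms. -/

section Net

open Module

variable {E : Type*} [NormedAddCommGroup E] [InnerProductSpace ℝ E] [FiniteDimensional ℝ E]

/-- A `1/2`-separated subset of the ball of maximal cardinality is a net. Doubling it gives a
1-separated subset of the ball of radius 2, to which the Besicovitch packing bound applies. -/
theorem exists_half_net : ∃ N : Finset E, (∀ u ∈ N, ‖u‖ ≤ 1) ∧ N.card ≤ 5 ^ finrank ℝ E ∧
    ∀ v : E, ‖v‖ ≤ 1 → ∃ u ∈ N, ‖v - u‖ ≤ 1 / 2 := by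
  classical
  set Q : ℕ → Prop := fun n => ∃ N : Finset E, N.card = n ∧ (∀ u ∈ N, ‖u‖ ≤ 1) ∧
    ∀ u ∈ N, ∀ v ∈ N, u ≠ v → 1 / 2 ≤ ‖u - v‖ with hQ
  have hbound : ∀ n, Q n → n ≤ 5 ^ finrank ℝ E := by
    rintro n ⟨N, rfl, h1, h2⟩
    have hinj : Function.Injective fun u : E => (2 : ℝ) • u := smul_right_injective E two_ne_zero
    rw [← Finset.card_image_of_injective N hinj]
    refine Besicovitch.card_le_of_separated _ ?_ ?_
    · simp only [Finset.mem_image]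
      rintro _ ⟨u, hu, rfl⟩
      rw [norm_smul, Real.norm_ofNat]
      linarith [h1 u hu]
    · simp only [Finset.mem_image]
      rintro _ ⟨u, hu, rfl⟩ _ ⟨v, hv, rfl⟩ huv
      rw [← smul_sub, norm_smul, Real.norm_ofNat]
      linarith [h2 u hu v hv fun h => huv (by rw [h])]
  have hQ0 : Q 0 := ⟨∅, by simp⟩
  obtain ⟨N, hcard, h1, h2⟩ := Nat.findGreatest_spec (P := Q) (Nat.zero_le (5 ^ finrank ℝ E)) hQ0
  refine ⟨N, h1, hbound _ ⟨N, rfl, h1, h2⟩, fun v hv => ?_⟩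
  by_contra! hcon
  have hvN : v ∉ N := fun h => by
    have := hcon v h
    rw [sub_self, norm_zero] at this
    linarith
  have hQ1 : Q (N.card + 1) := by
    refine ⟨insert v N, Finset.card_insert_of_notMem hvN, ?_, ?_⟩
    · intro u hu
      rcases Finset.mem_insert.1 hu with rfl | hu
      exacts [hv, h1 u hu]
    · intro u hu w hw huw
      rcases Finset.mem_insert.1 hu with hu' | hu' <;>
        rcases Finset.mem_insert.1 hw with hw' | hw'
      · exact absurd (hu'.trans hw'.symm) huw
      · rw [hu']; exact (hcon w hw').le
      · rw [hw', norm_sub_rev]; exact (hcon u hu').le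
      · exact h2 u hu' w hw' huw
  have := Nat.le_findGreatest (P := Q) (hbound _ hQ1) hQ1
  omega

/-- Approximating the vector on each side by the net loses a factor 2, hence 4 in total. -/
theorem norm_apply_le_of_net {N : Finset E}
    (hcov : ∀ v : E, ‖v‖ ≤ 1 → ∃ u ∈ N, ‖v - u‖ ≤ 1 / 2) (A : E →ₗ[ℝ] E) {T : ℝ}
    (hT : ∀ u ∈ N, ∀ v ∈ N, inner ℝ u (A v) ≤ T) (v : E) : ‖A v‖ ≤ 4 * T * ‖v‖ := by
  have hN : ∀ c ∈ N, ‖A c‖ ≤ 2 * T := by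
    intro c hc
    set w := A c with hw
    have hu1 : ‖(‖w‖⁻¹ • w)‖ ≤ 1 := by
      rw [norm_smul, norm_inv, norm_norm]; exact inv_mul_le_one
    obtain ⟨u, hu, huv⟩ := hcov _ hu1
    have h1 := hT u hu c hc
    have h2 : inner ℝ (‖w‖⁻¹ • w) w = ‖w‖ := by
      rw [inner_smul_left, real_inner_self_eq_norm_mul_norm, conj_trivial]
      rcases eq_or_ne ‖w‖ 0 with h | h
      · simp [h]
      · field_simp
    have h3 : inner ℝ (‖w‖⁻¹ • w - u) w ≤ 1 / 2 * ‖w‖ :=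
      (real_inner_le_norm _ _).trans (mul_le_mul_of_nonneg_right huv (norm_nonneg w))
    rw [inner_sub_left, h2] at h3
    linarith
  set B := A.toContinuousLinearMap with hB
  have hBA : ∀ v, B v = A v := fun v => rfl
  have hop : ‖B‖ ≤ 2 * T + ‖B‖ / 2 := by
    obtain ⟨u₀, hu₀, -⟩ := hcov 0 (by simp)
    have hT0 : 0 ≤ 2 * T := (norm_nonneg _).trans (hN u₀ hu₀)
    refine ContinuousLinearMap.opNorm_le_of_unit_norm (by positivity) fun v hv => ?_
    obtain ⟨u, hu, huv⟩ := hcov v hv.le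
    calc ‖B v‖ = ‖B u + B (v - u)‖ := by rw [← map_add]; simp
      _ ≤ ‖B u‖ + ‖B‖ * ‖v - u‖ := (norm_add_le _ _).trans (by gcongr; exact B.le_opNorm _)
      _ ≤ 2 * T + ‖B‖ * (1 / 2) := by gcongr; exact hN u hu
      _ = 2 * T + ‖B‖ / 2 := by ring
  calc ‖A v‖ ≤ ‖B‖ * ‖v‖ := B.le_opNorm v
    _ ≤ 4 * T * ‖v‖ := by gcongr; linarith

theorem hsInner_le_of_net {N : Finset E}
    (hcov : ∀ v : E, ‖v‖ ≤ 1 → ∃ u ∈ N, ‖v - u‖ ≤ 1 / 2) (A D : E →ₗ[ℝ] E) {T : ℝ}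
    (hT0 : 0 < T) (hT : ∀ u ∈ N, ∀ v ∈ N, inner ℝ u (A v) ≤ T) :
    hsInner A D ≤ 4 * T * nuc D := by
  have hc : IsContr ((4 * T)⁻¹ • A) := fun v => by
    rw [LinearMap.smul_apply, norm_smul, norm_inv, Real.norm_of_nonneg (by positivity),
      inv_mul_le_iff₀ (by positivity)]
    exact norm_apply_le_of_net hcov A hT v
  have := hsInner_le_nuc hc D
  rwa [hsInner_smul_left, inv_mul_le_iff₀ (by positivity)] at this

theorem hsInner_sum_right {ι : Type*} (s : Finset ι) (A : E →ₗ[ℝ] E) (B : ι → E →ₗ[ℝ] E) :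
    hsInner A (∑ k ∈ s, B k) = ∑ k ∈ s, hsInner A (B k) :=
  map_sum (AddMonoidHom.mk' (hsInner A) fun B C => hsInner_add_right A B C) B s

theorem nuc_nonneg (T : E →ₗ[ℝ] E) : 0 ≤ nuc T :=
  Finset.sum_nonneg fun i _ => T.singularValues_nonneg i

end Net

/-! ### The Rademacher process of quadratic forms over a nuclear-norm ball. -/

section Supremum

open Module

variable {E : Type*} [NormedAddCommGroup E] [InnerProductSpace ℝ E] [FiniteDimensional ℝ E]
  [MeasurableSpace E] [BorelSpace E]

theorem integral_exp_signed_le {ν : Measure E} [IsProbabilityMeasure ν] {s : ℝ} (hs : 0 < s)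
    (hν : ∀ u : E, ‖u‖ ≤ 1 → ∫⁻ x, ENNReal.ofReal (Real.exp (s * inner ℝ u x ^ 2)) ∂ν ≤ 2)
    {r : ℝ} (hr0 : 0 ≤ r) (hr : r ≤ s) {u v : E} (hu : ‖u‖ ≤ 1) (hv : ‖v‖ ≤ 1) :
    Integrable (fun z : E × ℝ => Real.exp (r * (z.2 * (inner ℝ u z.1 * inner ℝ v z.1))))
      (ν.prod rademacher) ∧
    ∫ z, Real.exp (r * (z.2 * (inner ℝ u z.1 * inner ℝ v z.1))) ∂(ν.prod rademacher) ≤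
      Real.exp ((r / s) ^ 2) := by
  have hmu : ∀ u : E, Measurable fun x : E => (inner ℝ u x : ℝ) := fun u =>
    (continuous_const.inner continuous_id).measurable
  obtain ⟨h1, h2⟩ := integral_cosh_mul_mul_le (hmu u) (hmu v) hs (hν u hu) (hν v hv) hr0 hr
  have hval : ∀ x : E, ∫ e, Real.exp (r * (e * (inner ℝ u x * inner ℝ v x))) ∂rademacher =
      Real.cosh (r * (inner ℝ u x * inner ℝ v x)) := fun x => by
    rw [integral_rademacher, Real.cosh_eq]
    ring_nf
  have hmeas : Measurable fun z : E × ℝ =>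
      Real.exp (r * (z.2 * (inner ℝ u z.1 * inner ℝ v z.1))) :=
    ((measurable_snd.mul (((hmu u).comp measurable_fst).mul
      ((hmu v).comp measurable_fst))).const_mul r).exp
  have hint : Integrable (fun z : E × ℝ =>
      Real.exp (r * (z.2 * (inner ℝ u z.1 * inner ℝ v z.1)))) (ν.prod rademacher) := by
    refine (integrable_prod_iff hmeas.aestronglyMeasurable).2
      ⟨Filter.Eventually.of_forall fun x => integrable_rademacher _, ?_⟩
    simp only [Real.norm_eq_abs, abs_of_pos (Real.exp_pos _), hval]
    exact h1
  refine ⟨hint, ?_⟩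
  rw [integral_prod _ hint]
  simp only [hval]
  exact h2

/-- The signed sum is `2 ⟨A, D i⟩` with `A = ∑ ε_k x_k x_kᵀ`, so duality bounds it by the nuclear
norm times the operator norm of `A`. A soft maximum over pairs of net points controls the latter in
mean. -/
theorem integral_ciSup_signed_quadratic_le {m : ℕ} (hE : 0 < finrank ℝ E)
    (hpm : finrank ℝ E ≤ m) (ν : Fin m → Measure E) [∀ k, IsProbabilityMeasure (ν k)]
    {s : ℝ} (hs : 0 < s)
    (hν : ∀ k, ∀ u : E, ‖u‖ ≤ 1 → ∫⁻ x, ENNReal.ofReal (Real.exp (s * inner ℝ u x ^ 2)) ∂ν k ≤ 2)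
    {ι : Type*} [Fintype ι] [Nonempty ι] (D : ι → E →ₗ[ℝ] E) {L : ℝ} (hL : ∀ i, nuc (D i) ≤ L) :
    ∫ z, ⨆ i, ∑ k, 2 * (z k).2 * inner ℝ (z k).1 (D i (z k).1)
      ∂Measure.pi (fun k => (ν k).prod rademacher) ≤ 48 * L / s * √(m * finrank ℝ E) := by
  obtain ⟨N, hN1, hNc, hcov⟩ := exists_half_net (E := E)
  set p := finrank ℝ E with hp
  have hm0 : (0 : ℝ) < m := by exact_mod_cast hE.trans_le hpm
  have hp0 : (0 : ℝ) < p := by exact_mod_cast hE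
  have hp1 : (1 : ℝ) ≤ p := by exact_mod_cast hE
  have hL0 : 0 ≤ L := (nuc_nonneg _).trans (hL (Classical.arbitrary ι))
  -- Chosen so that `m (r / s)² = p`: the moment generating function at a net pair is then at most
  -- `e ^ p`.
  set r := s * √(p / m) with hr
  have hr0 : 0 < r := mul_pos hs (Real.sqrt_pos.2 (by positivity))
  have hrs : r ≤ s := by
    refine mul_le_of_le_one_right hs.le (Real.sqrt_le_one.2 ?_)
    rw [div_le_one hm0]
    exact_mod_cast hpm
  have hrs2 : m * (r / s) ^ 2 = p := by
    rw [hr, mul_div_cancel_left₀ _ hs.ne', Real.sq_sqrt (by positivity)]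
    field_simp
  -- At most `25 ^ p ≤ e ^ (4 p)` net pairs, each contributing at most `e ^ p`, are exactly
  -- cancelled by `e ^ (-b)`.
  set b : ℝ := 5 * p with hb
  set Y : E × E → (Fin m → E × ℝ) → ℝ := fun w z =>
    ∑ k, (z k).2 * (inner ℝ w.1 (z k).1 * inner ℝ w.2 (z k).1) with hY
  set σ : Fin m → Measure (E × ℝ) := fun k => (ν k).prod rademacher with hσ
  have hexp : ∀ w z, Real.exp (r * Y w z) =
      ∏ k, Real.exp (r * ((z k).2 * (inner ℝ w.1 (z k).1 * inner ℝ w.2 (z k).1))) := fun w z => by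
    rw [← Real.exp_sum, hY, Finset.mul_sum]
  have hYint : ∀ w ∈ N ×ˢ N, Integrable (fun z => Real.exp (r * Y w z)) (Measure.pi σ) ∧
      ∫ z, Real.exp (r * Y w z) ∂Measure.pi σ ≤ Real.exp p := by
    intro w hw
    rw [Finset.mem_product] at hw
    have hk := fun k => integral_exp_signed_le hs (hν k) hr0.le hrs (hN1 _ hw.1) (hN1 _ hw.2)
    simp only [hexp]
    refine ⟨Integrable.fintype_prod fun k => (hk k).1, ?_⟩
    rw [integral_fintype_prod_eq_prod (fun _ (z : E × ℝ) =>
      Real.exp (r * (z.2 * (inner ℝ w.1 z.1 * inner ℝ w.2 z.1))))]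
    calc _ ≤ ∏ _k : Fin m, Real.exp ((r / s) ^ 2) :=
          Finset.prod_le_prod (fun k _ => integral_nonneg fun _ => (Real.exp_pos _).le)
            fun k _ => (hk k).2
      _ = Real.exp p := by
          rw [Finset.prod_const, Finset.card_univ, Fintype.card_fin, ← Real.exp_nat_mul, hrs2]
  -- A soft maximum: `y ≤ e ^ (y - b) + b`, with the exponential at one pair replaced by the sum
  -- over all pairs.
  set T : (Fin m → E × ℝ) → ℝ := fun z =>
    1 / r * (Real.exp (-b) * ∑ w ∈ N ×ˢ N, Real.exp (r * Y w z) + b) with hT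
  have hTpos : ∀ z, 0 < T z := fun z => by
    have : 0 ≤ ∑ w ∈ N ×ˢ N, Real.exp (r * Y w z) :=
      Finset.sum_nonneg fun _ _ => (Real.exp_pos _).le
    positivity
  have hsumint : Integrable (fun z => ∑ w ∈ N ×ˢ N, Real.exp (r * Y w z)) (Measure.pi σ) :=
    integrable_finsetSum _ fun w hw => (hYint w hw).1
  have hTint : Integrable T (Measure.pi σ) :=
    ((hsumint.const_mul _).add (integrable_const _)).const_mul _
  have hTval : ∫ z, T z ∂Measure.pi σ ≤ 1 / r * (1 + b) := by
    rw [integral_const_mul, integral_add (hsumint.const_mul _) (integrable_const _),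
      integral_const_mul, integral_finsetSum _ fun w hw => (hYint w hw).1]
    refine mul_le_mul_of_nonneg_left ?_ (by positivity)
    simp only [integral_const, probReal_univ, one_smul]
    gcongr
    calc Real.exp (-b) * ∑ w ∈ N ×ˢ N, ∫ z, Real.exp (r * Y w z) ∂Measure.pi σ
        ≤ Real.exp (-b) * ∑ w ∈ N ×ˢ N, Real.exp p := by
          gcongr with w hw
          exact (hYint w hw).2
      _ = Real.exp (-b) * ((N.card : ℝ) * N.card * Real.exp p) := by
          rw [Finset.sum_const, Finset.card_product]; simp
      _ ≤ Real.exp (-b) * ((5 : ℝ) ^ p * 5 ^ p * Real.exp p) := by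
          have : (N.card : ℝ) ≤ 5 ^ p := by exact_mod_cast hNc
          gcongr
      _ ≤ Real.exp (-b) * (Real.exp (2 * p) * Real.exp (2 * p) * Real.exp p) := by
          have h5 : (5 : ℝ) ≤ Real.exp 2 := by
            have h := Real.exp_one_gt_d9
            have h2 : Real.exp 2 = Real.exp 1 * Real.exp 1 := by
              rw [← Real.exp_add]; norm_num
            rw [h2]; nlinarith
          have : (5 : ℝ) ^ p ≤ Real.exp (2 * p) := by
            rw [mul_comm, Real.exp_nat_mul]
            gcongr
          gcongr
      _ = 1 := by
          rw [← Real.exp_add, ← Real.exp_add, ← Real.exp_add, hb, Real.exp_eq_one_iff]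
          ring
  have hpt : ∀ z, (⨆ i, ∑ k, 2 * (z k).2 * inner ℝ (z k).1 (D i (z k).1)) ≤
      8 * L * T z := by
    intro z
    refine ciSup_le fun i => ?_
    set A : E →ₗ[ℝ] E := ∑ k, (z k).2 • rk (z k).1 (z k).1 with hA
    have hAD : ∑ k, 2 * (z k).2 * inner ℝ (z k).1 (D i (z k).1) = 2 * hsInner A (D i) := by
      have : hsInner A (D i) = ∑ k, (z k).2 * inner ℝ (z k).1 (D i (z k).1) := by
        rw [hsInner_comm, hA, hsInner_sum_right]
        refine Finset.sum_congr rfl fun k _ => ?_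
        rw [hsInner_smul_right, hsInner_rk, real_inner_comm]
      rw [this, Finset.mul_sum]
      exact Finset.sum_congr rfl fun k _ => by ring
    rw [hAD]
    have hle : hsInner A (D i) ≤ 4 * T z * nuc (D i) := by
      refine hsInner_le_of_net hcov A (D i) (hTpos z) fun u hu v hv => ?_
      have hw : (u, v) ∈ N ×ˢ N := Finset.mem_product.2 ⟨hu, hv⟩
      have hYA : inner ℝ u (A v) = Y (u, v) z := by
        simp only [hA, hY, LinearMap.sum_apply, inner_sum]
        refine Finset.sum_congr rfl fun k _ => ?_
        simp only [LinearMap.smul_apply, rk_apply, inner_smul_right]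
        rw [real_inner_comm v]
        ring
      rw [hYA]
      simp only [hT]
      rw [one_div, inv_mul_eq_div, le_div_iff₀ hr0]
      have h1 := Real.add_one_le_exp (r * Y (u, v) z - b)
      have h2 : Real.exp (r * Y (u, v) z) ≤ ∑ w ∈ N ×ˢ N, Real.exp (r * Y w z) :=
        Finset.single_le_sum (f := fun w => Real.exp (r * Y w z))
          (fun _ _ => (Real.exp_pos _).le) hw
      have h3 : Real.exp (r * Y (u, v) z - b) =
          Real.exp (-b) * Real.exp (r * Y (u, v) z) := by
        rw [← Real.exp_add]; ring_nf
      have h4 := mul_le_mul_of_nonneg_left h2 (Real.exp_pos (-b)).le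
      linarith
    have := mul_le_mul_of_nonneg_left (hL i) (hTpos z).le
    linarith
  have hfin : 8 * L * (1 / r * (1 + b)) ≤ 48 * L / s * √(m * p) := by
    have h1 : √(m * p) = √(p / m) * m := by
      have : (m : ℝ) * p = p / m * m ^ 2 := by field_simp
      rw [this, Real.sqrt_mul (by positivity), Real.sqrt_sq hm0.le]
    have h2 : 1 / r * p = 1 / s * √(m * p) := by
      rw [h1, hr]
      have hq : 0 < √(p / m : ℝ) := Real.sqrt_pos.2 (by positivity)
      have hq2 : √(p / m : ℝ) ^ 2 * m = p := by
        rw [Real.sq_sqrt (by positivity)]; field_simp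
      field_simp
      linarith
    have h3 : 1 / r * (1 + b) ≤ 6 * (1 / r * p) := by
      rw [mul_left_comm]
      refine mul_le_mul_of_nonneg_left ?_ (by positivity)
      linarith
    rw [h2] at h3
    calc 8 * L * (1 / r * (1 + b)) ≤ 8 * L * (6 * (1 / s * √(m * p))) := by gcongr
      _ = _ := by ring
  have h8 : ∫ z, 8 * L * T z ∂Measure.pi σ ≤ 48 * L / s * √(m * p) := by
    rw [integral_const_mul]
    exact (mul_le_mul_of_nonneg_left hTval (by positivity)).trans hfin
  -- Integrability need not be proved: otherwise the integral is 0 by convention and the bound is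
  -- nonnegative.
  by_cases hI : Integrable (fun z : Fin m → E × ℝ =>
      ⨆ i, ∑ k, 2 * (z k).2 * inner ℝ (z k).1 (D i (z k).1)) (Measure.pi σ)
  · exact (integral_mono hI (hTint.const_mul _) hpt).trans h8
  · rw [integral_undef hI]
    positivity

end Supremum

/-! ### No admissible operator is annihilated by all the measurements. -/

section Kernel

open Module

variable {E : Type*} [NormedAddCommGroup E] [InnerProductSpace ℝ E] [FiniteDimensional ℝ E]
  [MeasurableSpace E] [BorelSpace E]

theorem measurable_inner_apply (D : E →ₗ[ℝ] E) : Measurable fun x : E => (inner ℝ x (D x) : ℝ) :=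
  (continuous_id.inner D.continuous_of_finiteDimensional).measurable

theorem integrable_inner_apply {ν : Measure E} {s : ℝ} (hs : 0 < s)
    (hν : ∀ u : E, ‖u‖ ≤ 1 → ∫⁻ x, ENNReal.ofReal (Real.exp (s * inner ℝ u x ^ 2)) ∂ν ≤ 2)
    (D : E →ₗ[ℝ] E) : Integrable (fun x : E => (inner ℝ x (D x) : ℝ)) ν := by
  have hu : ∀ u : E, ‖u‖ ≤ 1 → Integrable (fun x : E => (inner ℝ u x : ℝ) ^ 2) ν := by
    intro u hu
    have hm : Measurable fun x : E => (inner ℝ u x : ℝ) :=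
      (continuous_const.inner continuous_id).measurable
    have h1 : Integrable (fun x : E => Real.exp (s * inner ℝ u x ^ 2)) ν :=
      integrable_of_lintegral_ofReal_le ((hm.pow_const 2).const_mul s).exp
        (fun x => (Real.exp_pos _).le) (C := 2) (hν u hu)
    refine (h1.const_mul s⁻¹).mono' (hm.pow_const 2).aestronglyMeasurable
      (Filter.Eventually.of_forall fun x => ?_)
    rw [Real.norm_of_nonneg (sq_nonneg _), inv_mul_eq_div, le_div_iff₀ hs]
    linarith [Real.add_one_le_exp (s * inner ℝ u x ^ 2)]
  have hn : Integrable (fun x : E => ‖x‖ ^ 2) ν := by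
    have := integrable_finsetSum Finset.univ fun i (_ : i ∈ Finset.univ) =>
      hu (stdOrthonormalBasis ℝ E i) (by simp)
    refine this.congr (Filter.Eventually.of_forall fun x => ?_)
    exact (stdOrthonormalBasis ℝ E).sum_sq_inner_right x
  refine (hn.const_mul ‖D.toContinuousLinearMap‖).mono'
    (measurable_inner_apply D).aestronglyMeasurable (Filter.Eventually.of_forall fun x => ?_)
  calc ‖(inner ℝ x (D x) : ℝ)‖ ≤ ‖x‖ * ‖D x‖ := abs_real_inner_le_norm _ _
    _ ≤ ‖x‖ * (‖D.toContinuousLinearMap‖ * ‖x‖) := by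
      gcongr
      exact D.toContinuousLinearMap.le_opNorm x
    _ = _ := by ring

theorem abs_min_abs_sub_le (τ s t : ℝ) : |min |s| τ - min |t| τ| ≤ |s - t| :=
  (abs_min_sub_min_le_max _ _ _ _).trans
    (max_le (abs_abs_sub_abs_le_abs_sub s t) (by simp))

variable {m : ℕ} (ν : Fin m → Measure E) [∀ k, IsProbabilityMeasure (ν k)]

/-- The truncated measurements have total mean at least `m q`. Half of this is given up: `m q / 4`
for the mean of the supremum of deviations, and `m q / 4` for its McDiarmid fluctuation, whose
bounded differences are `τ` thanks to the truncation. -/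
theorem measureReal_exists_sum_min_abs_le {s τ q L : ℝ} (hE : 0 < finrank ℝ E)
    (hpm : finrank ℝ E ≤ m) (hs : 0 < s) (hτ : 0 < τ) (hq : 0 < q)
    (hν : ∀ k, ∀ u : E, ‖u‖ ≤ 1 → ∫⁻ x, ENNReal.ofReal (Real.exp (s * inner ℝ u x ^ 2)) ∂ν k ≤ 2)
    (hm : 48 * L / s * √(m * finrank ℝ E) ≤ m * (q / 4))
    {ι : Type*} [Fintype ι] [Nonempty ι] (D : ι → E →ₗ[ℝ] E) (hL : ∀ i, nuc (D i) ≤ L)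
    (hD : ∀ i k, q ≤ ∫ x, min |inner ℝ x (D i x)| τ ∂ν k) :
    (Measure.pi ν).real {z | ∃ i, ∑ k, min |inner ℝ (z k) (D i (z k))| τ ≤ m * (q / 2)} ≤
      Real.exp (-(2 * (q / 4) ^ 2 / τ ^ 2) * m) := by
  set t : ι → E → ℝ := fun i x => inner ℝ x (D i x) with ht
  set φ : ℝ → ℝ := fun a => min |a| τ with hφ
  have htm : ∀ i, Measurable (t i) := fun i => measurable_inner_apply (D i)
  have hφm : Measurable φ := (continuous_abs.min continuous_const).measurable
  have hφ0 : ∀ a, 0 ≤ φ a := fun a => le_min (abs_nonneg _) hτ.le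
  have hφτ : ∀ a, φ a ≤ τ := fun a => min_le_right _ _
  have hint : ∀ i k, Integrable (fun x => φ (t i x)) (ν k) := fun i k =>
    integrable_of_measurable_of_abs_le (hφm.comp (htm i)) (K := τ) fun x => by
      rw [abs_of_nonneg (hφ0 _)]; exact hφτ _
  have hmean0 : ∀ i k, 0 ≤ ∫ x, φ (t i x) ∂ν k := fun i k => integral_nonneg fun _ => hφ0 _
  have hmeanτ : ∀ i k, ∫ x, φ (t i x) ∂ν k ≤ τ := fun i k => by
    refine (integral_mono (hint i k) (integrable_const τ) fun x => hφτ _).trans_eq ?_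
    simp
  set F : ι → (Fin m → E) → ℝ := fun i z => ∑ k, (∫ x, φ (t i x) ∂ν k - φ (t i (z k))) with hF
  set f : (Fin m → E) → ℝ := fun z => ⨆ i, F i z with hf
  have hFm : ∀ i, Measurable (F i) := fun i =>
    Finset.measurable_sum _ fun k _ =>
      measurable_const.sub (hφm.comp ((htm i).comp (measurable_pi_apply k)))
  have hfm : Measurable f := Measurable.iSup hFm
  have hfK : ∀ z, |f z| ≤ ∑ _i : ι, ∑ _k : Fin m, τ := fun z => by
    refine (abs_ciSup_le_sum _).trans (Finset.sum_le_sum fun i _ => ?_)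
    refine (Finset.abs_sum_le_sum_abs _ _).trans (Finset.sum_le_sum fun k _ => ?_)
    exact abs_sub_le_of_nonneg_of_le (hmean0 i k) (hmeanτ i k) (hφ0 _) (hφτ _)
  have hbd : ∀ j (x y : Fin m → E), (∀ k, k ≠ j → x k = y k) → f x - f y ≤ τ := by
    intro j x y hxy
    rw [sub_le_iff_le_add]
    refine ciSup_le fun i => ?_
    have h1 : F i x - F i y = φ (t i (y j)) - φ (t i (x j)) := by
      rw [hF, ← Finset.sum_sub_distrib, Finset.sum_eq_single j]
      · ring
      · intro k _ hk
        rw [hxy k hk]; ring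
      · simp
    have h2 : F i y ≤ f y := le_ciSup_fin (fun i => F i y) i
    linarith [hφ0 (t i (x j)), hφτ (t i (y j))]
  have hmeanf : ∫ z, f z ∂Measure.pi ν ≤ m * (q / 4) := by
    have h1 := integral_ciSup_sum_le_signed htm hφm (abs_min_abs_sub_le τ) ν
      (fun k i => integrable_inner_apply hs (hν k) (D i)) (fun _ => 0)
    simp only [zero_add] at h1
    exact h1.trans ((integral_ciSup_signed_quadratic_le hE hpm ν hs hν D hL).trans hm)
  refine (measureReal_mono ?_).trans
    (measureReal_ge_le_of_bounded_differences hτ ν hfm hfK hbd (t := q / 4) (by positivity))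
  rintro z ⟨i, hi⟩
  rw [Set.mem_ofPred_eq]
  have h1 : m * q ≤ ∑ k, ∫ x, φ (t i x) ∂ν k := by
    calc (m : ℝ) * q = ∑ _k : Fin m, q := by simp
      _ ≤ _ := Finset.sum_le_sum fun k _ => hD i k
  have h2 : F i z = ∑ k, ∫ x, φ (t i x) ∂ν k - ∑ k, φ (t i (z k)) :=
    Finset.sum_sub_distrib _ _
  have h3 : F i z ≤ f z := le_ciSup_fin (fun i => F i z) i
  linarith

/-- The finite-family bound does not depend on the number of operators, so it passes to the
increasing union over a dense sequence of `S`. An operator with all measurements zero would, by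
continuity, have a neighbour in the sequence with a small truncated sum. -/
theorem exists_measurableSet_forall_exists_inner_ne_zero {s τ q L : ℝ} (hE : 0 < finrank ℝ E)
    (hpm : finrank ℝ E ≤ m) (hs : 0 < s) (hτ : 0 < τ) (hq : 0 < q)
    (hν : ∀ k, ∀ u : E, ‖u‖ ≤ 1 → ∫⁻ x, ENNReal.ofReal (Real.exp (s * inner ℝ u x ^ 2)) ∂ν k ≤ 2)
    (hm : 48 * L / s * √(m * finrank ℝ E) ≤ m * (q / 4))
    (S : Set (E →L[ℝ] E)) (hL : ∀ D ∈ S, nuc (D : E →ₗ[ℝ] E) ≤ L)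
    (hD : ∀ D ∈ S, ∀ k, q ≤ ∫ x, min |inner ℝ x (D x)| τ ∂ν k) :
    ∃ B : Set (Fin m → E), MeasurableSet B ∧
      (Measure.pi ν).real B ≤ Real.exp (-(2 * (q / 4) ^ 2 / τ ^ 2) * m) ∧
      ∀ z ∉ B, ∀ D ∈ S, ∃ k, inner ℝ (z k) (D (z k)) ≠ 0 := by
  rcases S.eq_empty_or_nonempty with rfl | hS
  · exact ⟨∅, .empty, by simpa using (Real.exp_pos _).le, by simp⟩
  have := hS.to_subtype
  have : ProperSpace (E →L[ℝ] E) := FiniteDimensional.proper ℝ _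
  set d : ℕ → S := TopologicalSpace.denseSeq S with hd
  set g : (Fin m → E) → (E →L[ℝ] E) → ℝ := fun z D => ∑ k, min |inner ℝ (z k) (D (z k))| τ with hg
  have hgm : ∀ D, Measurable fun z => g z D := fun D =>
    Finset.measurable_sum _ fun k _ =>
      (continuous_abs.min continuous_const).measurable.comp
        ((measurable_inner_apply (D : E →ₗ[ℝ] E)).comp (measurable_pi_apply k))
  -- `N + 1` rather than `N` keeps the index type nonempty, as the suprema require.
  set B : ℕ → Set (Fin m → E) := fun N => {z | ∃ i : Fin (N + 1), g z (d i) ≤ m * (q / 2)} with hB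
  have hBm : ∀ N, MeasurableSet (B N) := fun N => by
    rw [hB]
    simp only [Set.ofPred_exists]
    exact MeasurableSet.iUnion fun i => measurableSet_le (hgm _) measurable_const
  have hmono : Monotone B := by
    rintro N N' h z ⟨i, hi⟩
    exact ⟨⟨i, by omega⟩, hi⟩
  refine ⟨⋃ N, B N, MeasurableSet.iUnion hBm, ?_, ?_⟩
  · refine ENNReal.toReal_le_of_le_ofReal (Real.exp_pos _).le ?_
    rw [hmono.measure_iUnion]
    refine iSup_le fun N => ?_
    rw [← ofReal_measureReal]
    exact ENNReal.ofReal_le_ofReal (measureReal_exists_sum_min_abs_le ν hE hpm hs hτ hq hν hm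
      (fun i : Fin (N + 1) => ((d i : E →L[ℝ] E) : E →ₗ[ℝ] E)) (fun i => hL _ (d i).2)
      fun i k => hD _ (d i).2 k)
  · intro z hz D hDS
    by_contra! hcon
    have hgc : Continuous fun D : S => g z D := by
      refine continuous_finsetSum _ fun k _ => ?_
      refine (Continuous.inner continuous_const ?_).abs.min continuous_const
      exact (ContinuousLinearMap.apply ℝ E (z k)).continuous.comp continuous_subtype_val
    have h0 : g z D = 0 := by
      refine Finset.sum_eq_zero fun k _ => ?_
      rw [hcon k, abs_zero, min_eq_left hτ.le]
    have hmq : (0 : ℝ) < m * (q / 2) := by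
      have : (0 : ℝ) < m := by exact_mod_cast hE.trans_le hpm
      positivity
    obtain ⟨D', hD', i, rfl⟩ := (TopologicalSpace.denseRange_denseSeq S).inter_open_nonempty
      {D : S | g z D < m * (q / 2)} (isOpen_lt hgc continuous_const)
      ⟨⟨D, hDS⟩, by rw [Set.mem_ofPred_eq, h0]; exact hmq⟩
    exact hz (Set.mem_iUnion.2 ⟨i, ⟨i, by omega⟩, le_of_lt hD'⟩)

end Kernel

/-! ### Application to a sample of independent covariates. -/

section Design

open Module

/-- By independence the sub-Gaussian parameters of the terms `u_l x_l` add up, and their total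
carries the factor `‖u‖² ≤ 1`. -/
theorem IsRow.lintegral_exp_le {Ω : Type*} [MeasurableSpace Ω] {P : Measure Ω}
    [IsProbabilityMeasure P] {p : ℕ} {x : Ω → EuclideanSpace ℝ (Fin p)} {μ : ℝ} {κ : ℝ≥0}
    (hx : Measurable x) (h : IsRow P (fun l ω => x ω l) μ κ) {u : EuclideanSpace ℝ (Fin p)}
    (hu : ‖u‖ ≤ 1) {s : ℝ} (hs0 : 0 ≤ s)
    (hs : s * (2 * (4 * Real.toNNReal (Real.exp 1) * κ ^ 2 + 1) : ℝ≥0) ≤ 3 / 8) :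
    ∫⁻ v, ENNReal.ofReal (Real.exp (s * inner ℝ u v ^ 2)) ∂P.map x ≤ 2 := by
  have hm : Measurable fun v : EuclideanSpace ℝ (Fin p) => (inner ℝ u v : ℝ) :=
    (continuous_const.inner continuous_id).measurable
  rw [lintegral_map (by fun_prop) hx]
  have h1 : ∀ l, HasSubgaussianMGF (fun ω => u l * x ω l)
      (Real.toNNReal (u l ^ 2) * (2 * (4 * Real.toNNReal (Real.exp 1) * κ ^ 2 + 1))) P := fun l => by
    rw [Real.toNNReal_of_nonneg (sq_nonneg _)]
    exact (hasSubgaussianMGF_of_subGaussianNorm_le (h.measurable l) (h.mean l)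
      (h.subGaussian l)).const_mul (u l)
  have hind : iIndepFun (fun l ω => u l * x ω l) P :=
    h.indep.comp (fun l a => u l * a) fun l => measurable_const_mul (u l)
  have h2 := HasSubgaussianMGF.sum_of_iIndepFun hind (s := Finset.univ) fun l _ => h1 l
  have h3 : ∀ ω, ∑ l, u l * x ω l = inner ℝ u (x ω) := fun ω => by
    rw [PiLp.inner_apply]
    exact Finset.sum_congr rfl fun l _ => by simp [mul_comm]
  simp only [h3] at h2
  refine lintegral_exp_sq_le_of_hasSubgaussianMGF (hm.comp hx) h2 hs0 ?_
  rw [← Finset.sum_mul, NNReal.coe_mul]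
  have h4 : ((∑ l, Real.toNNReal (u l ^ 2) : ℝ≥0) : ℝ) ≤ 1 := by
    rw [NNReal.coe_sum]
    simp only [Real.coe_toNNReal _ (sq_nonneg _)]
    rw [← EuclideanSpace.real_norm_sq_eq]
    exact pow_le_one₀ (norm_nonneg u) hu
  refine le_trans (mul_le_mul_of_nonneg_left ?_ hs0) hs
  exact mul_le_of_le_one_left (NNReal.coe_nonneg _) h4

theorem hsNorm_sq_eq_sum_matrix {p : ℕ}
    (D : EuclideanSpace ℝ (Fin p) →ₗ[ℝ] EuclideanSpace ℝ (Fin p)) :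
    hsNorm D ^ 2 = ∑ i, ∑ j, (D (EuclideanSpace.single j 1) i) ^ 2 := by
  rw [sq_hsNorm, hsInner_eq_sum (EuclideanSpace.basisFun (Fin p) ℝ), Finset.sum_comm]
  refine Finset.sum_congr rfl fun j _ => ?_
  rw [real_inner_self_eq_norm_sq, EuclideanSpace.real_norm_sq_eq, EuclideanSpace.basisFun_apply]

theorem inner_apply_eq_sum {p : ℕ} (D : EuclideanSpace ℝ (Fin p) →ₗ[ℝ] EuclideanSpace ℝ (Fin p))
    (x : EuclideanSpace ℝ (Fin p)) :
    inner ℝ x (D x) = ∑ i, ∑ j, D (EuclideanSpace.single j 1) i * (x i * x j) := by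
  have hx : x = ∑ j, x j • EuclideanSpace.single j (1 : ℝ) := by
    conv_lhs => rw [← (EuclideanSpace.basisFun (Fin p) ℝ).sum_repr x]
    simp
  have hD : ∀ i, D x i = ∑ j, x j * D (EuclideanSpace.single j 1) i := fun i => by
    conv_lhs => rw [hx, map_sum]
    simp
  rw [PiLp.inner_apply]
  refine Finset.sum_congr rfl fun i _ => ?_
  simp only [hD, RCLike.inner_apply, conj_trivial, Finset.sum_mul]
  exact Finset.sum_congr rfl fun j _ => by ring

theorem apply_single_comm {p : ℕ}
    {D : EuclideanSpace ℝ (Fin p) →ₗ[ℝ] EuclideanSpace ℝ (Fin p)} (hD : D.adjoint = D)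
    (i j : Fin p) : D (EuclideanSpace.single j 1) i = D (EuclideanSpace.single i 1) j := by
  have h := LinearMap.adjoint_inner_left D (EuclideanSpace.single i (1 : ℝ))
    (EuclideanSpace.single j (1 : ℝ))
  rw [hD] at h
  simpa [EuclideanSpace.inner_single_left, EuclideanSpace.inner_single_right] using h

/-- With overwhelming probability no symmetric operator with small ratio of nuclear norm and
Hilbert–Schmidt norm is annihilated by all the quadratic measurements. -/
theorem exists_forall_exists_inner_ne_zero (μ : ℝ) (hμ : 1 < μ) (κ : ℝ≥0) :
    ∃ c₂ c₃ : ℝ, 0 < c₂ ∧ 0 < c₃ ∧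
      ∀ {Ω : Type*} [MeasurableSpace Ω] (P : Measure Ω) [IsProbabilityMeasure P] {m p : ℕ}
        (x : Fin m → Ω → EuclideanSpace ℝ (Fin p)), (∀ k, Measurable (x k)) → iIndepFun x P →
        (∀ k, IsRow P (fun l ω => x k ω l) μ κ) → ∀ {L : ℝ}, 1 ≤ L → 0 < p →
        c₃ * L ^ 2 * p ≤ m →
        ∃ B : Set Ω, MeasurableSet B ∧ P.real B ≤ Real.exp (-c₂ * m) ∧
          ∀ ω ∉ B, ∀ D : EuclideanSpace ℝ (Fin p) →ₗ[ℝ] EuclideanSpace ℝ (Fin p),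
            D.adjoint = D → hsNorm D = 1 → nuc D ≤ L → ∃ k, inner ℝ (x k ω) (D (x k ω)) ≠ 0 := by
  obtain ⟨τ, q, hτ, hq, hrow⟩ := exists_le_integral_min_abs μ hμ κ
  set σ : ℝ≥0 := 2 * (4 * Real.toNNReal (Real.exp 1) * κ ^ 2 + 1) with hσ
  have hσ0 : 0 < (σ : ℝ) := by
    have : 0 < σ := by positivity
    exact_mod_cast this
  set s : ℝ := 3 / (8 * σ) with hs
  have hs0 : 0 < s := by positivity
  have hsσ : s * σ ≤ 3 / 8 := le_of_eq (by rw [hs]; field_simp)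
  -- The square of `192 / (s q) = 4 · 48 / (s q)` makes the Rademacher bound at most `m q / 4`; the
  -- `+ 1` ensures `p ≤ m`.
  refine ⟨2 * (q / 4) ^ 2 / τ ^ 2, (192 / (s * q)) ^ 2 + 1, by positivity, by positivity, ?_⟩
  intro Ω _ P _ m p x hx hind hxrow L hL hp hm
  have hfin : finrank ℝ (EuclideanSpace ℝ (Fin p)) = p := by simp
  have hprob : ∀ k, IsProbabilityMeasure (P.map (x k)) := fun k =>
    Measure.isProbabilityMeasure_map (hx k).aemeasurable
  have hp0 : (0 : ℝ) < p := by exact_mod_cast hp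
  have hL2 : 1 ≤ L ^ 2 := one_le_pow₀ hL
  have hpm : (p : ℝ) ≤ m := by
    refine le_trans ?_ hm
    have : 0 ≤ (192 / (s * q)) ^ 2 := sq_nonneg _
    have h1 : 1 ≤ ((192 / (s * q)) ^ 2 + 1) * L ^ 2 :=
      one_le_mul_of_one_le_of_one_le (by linarith) hL2
    exact le_mul_of_one_le_left hp0.le h1
  have hm0 : (0 : ℝ) < m := hp0.trans_le hpm
  have hmain : 48 * L / s * √(m * p) ≤ m * (q / 4) := by
    have h1 : (192 / (s * q)) ^ 2 * L ^ 2 * p ≤ m := by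
      refine le_trans ?_ hm
      gcongr
      linarith
    have h2 : (48 * L / s) ^ 2 * (m * p) ≤ (m * (q / 4)) ^ 2 := by
      have h3 : (48 * L / s) ^ 2 * (m * p) =
          m * (q / 4) ^ 2 * ((192 / (s * q)) ^ 2 * L ^ 2 * p) := by
        field_simp
        ring
      rw [h3]
      calc _ ≤ m * (q / 4) ^ 2 * m := by gcongr
        _ = _ := by ring
    have h4 := Real.sqrt_le_sqrt h2
    rwa [Real.sqrt_mul (by positivity), Real.sqrt_sq (by positivity),
      Real.sqrt_sq (by positivity)] at h4
  obtain ⟨B, hB, hBm, hBD⟩ := exists_measurableSet_forall_exists_inner_ne_zero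
    (fun k => P.map (x k)) (s := s) (τ := τ) (q := q) (L := L) (by rw [hfin]; exact hp)
    (by rw [hfin]; exact_mod_cast hpm) hs0 hτ hq
    (fun k u hu => (hxrow k).lintegral_exp_le (hx k) hu hs0.le hsσ) (by rw [hfin]; exact hmain)
    {D | (D : EuclideanSpace ℝ (Fin p) →ₗ[ℝ] EuclideanSpace ℝ (Fin p)).adjoint = D ∧
      hsNorm (D : EuclideanSpace ℝ (Fin p) →ₗ[ℝ] EuclideanSpace ℝ (Fin p)) = 1 ∧
      nuc (D : EuclideanSpace ℝ (Fin p) →ₗ[ℝ] EuclideanSpace ℝ (Fin p)) ≤ L}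
    (fun D hD => hD.2.2) (by
      rintro D ⟨hD1, hD2, -⟩ k
      have hmeas : Measurable fun v : EuclideanSpace ℝ (Fin p) => min |inner ℝ v (D v)| τ :=
        (continuous_abs.min continuous_const).measurable.comp
          (measurable_inner_apply (D : EuclideanSpace ℝ (Fin p) →ₗ[ℝ] EuclideanSpace ℝ (Fin p)))
      rw [integral_map (hx k).aemeasurable hmeas.aestronglyMeasurable]
      have h1 := hrow P (hxrow k) (D := fun i j => D (EuclideanSpace.single j 1) i)
        (fun i j => apply_single_comm hD1 i j) (by
          have := hsNorm_sq_eq_sum_matrix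
            (D : EuclideanSpace ℝ (Fin p) →ₗ[ℝ] EuclideanSpace ℝ (Fin p))
          rw [hD2, one_pow] at this
          exact this.symm)
      refine h1.trans_eq (integral_congr_ae (Filter.Eventually.of_forall fun ω => ?_))
      have := inner_apply_eq_sum
        (D : EuclideanSpace ℝ (Fin p) →ₗ[ℝ] EuclideanSpace ℝ (Fin p)) (x k ω)
      rw [ContinuousLinearMap.coe_coe] at this
      simp only [this])
  have hX : Measurable fun ω k => x k ω := measurable_pi_iff.2 hx
  refine ⟨(fun ω k => x k ω) ⁻¹' B, hX hB, ?_, ?_⟩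
  · rw [← map_measureReal_apply hX hB,
      (iIndepFun_iff_map_fun_eq_pi_map fun k => (hx k).aemeasurable).1 hind]
    exact hBm
  · intro ω hω D h1 h2 h3
    exact hBD _ hω D.toContinuousLinearMap ⟨h1, h2, h3⟩

end Design

/-! ### Independence of the covariates from independence of their entries. -/

section Rows

variable {Ω : Type*} [MeasurableSpace Ω] {P : Measure Ω} [IsProbabilityMeasure P] {n p : ℕ}
  {x : Fin n → Ω → EuclideanSpace ℝ (Fin p)} {μ : ℝ} {κ : ℝ≥0}

theorem IsDesign.measurable_entry (h : IsDesign P x μ κ) (i : Fin n) (l : Fin p) :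
    Measurable fun ω => x i ω l :=
  (EuclideanSpace.proj (𝕜 := ℝ) l).continuous.measurable.comp (h.measurable i)

theorem IsDesign.isRow (h : IsDesign P x μ κ) (i : Fin n) : IsRow P (fun l ω => x i ω l) μ κ where
  measurable := h.measurable_entry i
  indep := h.indep.precomp (g := fun l => (i, l)) fun _ _ hl => (Prod.mk.inj hl).2
  mean := h.mean i
  variance := h.variance i
  fourth_moment := h.fourth_moment i
  subGaussian := h.subGaussian i

/-- The joint law of all entries is a product over pairs; currying turns it into a product over `i`
of the row laws. -/
theorem IsDesign.iIndepFun (h : IsDesign P x μ κ) : iIndepFun x P := by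
  have hm := h.measurable_entry
  have hprob : ∀ i l, IsProbabilityMeasure (P.map fun ω => x i ω l) := fun i l =>
    Measure.isProbabilityMeasure_map (hm i l).aemeasurable
  have hcurry : ProbabilityTheory.iIndepFun (fun i ω => fun l => x i ω l) P := by
    rw [iIndepFun_iff_map_fun_eq_infinitePi_map fun i => measurable_pi_iff.2 (hm i)]
    have h1 := (iIndepFun_iff_map_fun_eq_infinitePi_map fun a : Fin n × Fin p => hm a.1 a.2).1
      h.indep
    have h2 := Measure.infinitePi_map_curry fun i l => P.map fun ω => x i ω l
    rw [← h1, Measure.map_map (MeasurableEquiv.measurable _)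
      (measurable_pi_iff.2 fun a : Fin n × Fin p => hm a.1 a.2)] at h2
    refine Eq.trans ?_ (h2.trans ?_)
    · rfl
    · congr 1
      funext i
      exact ((iIndepFun_iff_map_fun_eq_infinitePi_map (hm i)).1 (h.isRow i).indep).symm
  exact hcurry.comp (fun _ => WithLp.toLp 2) fun _ => (PiLp.continuous_toLp 2 _).measurable

end Rows

/-! ### From vanishing measurements to the target, and from the target to its eigenvectors. -/

section Recovery

open Module

variable {E : Type*} [NormedAddCommGroup E] [InnerProductSpace ℝ E] [FiniteDimensional ℝ E]

theorem nuc_smul_le {c : ℝ} (hc : 0 ≤ c) (T : E →ₗ[ℝ] E) : nuc (c • T) ≤ c * nuc T := by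
  obtain ⟨B, hB, h⟩ := exists_isContr_hsInner_eq_nuc (c • T)
  rw [← h, hsInner_smul_right]
  exact mul_le_mul_of_nonneg_left (hsInner_le_nuc hB T) hc

/-- Homogeneity: a nonzero `D` may be rescaled to Hilbert–Schmidt norm one. -/
theorem eq_zero_of_forall_measurement_eq_zero {ι : Type*} {x : ι → E} {L : ℝ}
    (hx : ∀ D : E →ₗ[ℝ] E, D.adjoint = D → hsNorm D = 1 → nuc D ≤ L →
      ∃ k, inner ℝ (x k) (D (x k)) ≠ 0)
    {D : E →ₗ[ℝ] E} (hD : D.adjoint = D) (hL : nuc D ≤ L * hsNorm D)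
    (h0 : ∀ k, inner ℝ (x k) (D (x k)) = 0) : D = 0 := by
  by_contra hne
  have hpos : 0 < hsNorm D := by
    refine (hsNorm_nonneg D).lt_of_ne' fun h => hne (eq_zero_of_hsInner_self_eq_zero ?_)
    rw [← sq_hsNorm, h, zero_pow two_ne_zero]
  obtain ⟨k, hk⟩ := hx ((hsNorm D)⁻¹ • D) (by simp [hD])
    (by rw [hsNorm_smul, abs_of_pos (inv_pos.2 hpos), inv_mul_cancel₀ hpos.ne'])
    ((nuc_smul_le (inv_pos.2 hpos).le D).trans (by
      rw [inv_mul_le_iff₀ hpos, mul_comm]; exact hL))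
  rw [LinearMap.smul_apply, inner_smul_right, h0 k, mul_zero] at hk
  exact hk rfl

/-- The target operator `(β₁ β₂ᵀ + β₂ β₁ᵀ) / 2`. -/
noncomputable def symRk (β₁ β₂ : E) : E →ₗ[ℝ] E := (1 / 2 : ℝ) • (rk β₁ β₂ + rk β₂ β₁)

theorem adjoint_symRk (β₁ β₂ : E) : (symRk β₁ β₂).adjoint = symRk β₁ β₂ := by
  simp [symRk, adjoint_rk, add_comm]

theorem inner_symRk_apply (β₁ β₂ x : E) :
    inner ℝ x (symRk β₁ β₂ x) = inner ℝ x β₁ * inner ℝ x β₂ := by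
  simp only [symRk, LinearMap.smul_apply, LinearMap.add_apply, rk_apply, inner_smul_right,
    inner_add_right]
  rw [real_inner_comm x β₁, real_inner_comm x β₂]
  ring

/-- The constraint on either sample is the vanishing of the quadratic form of `H - (β hᵀ + h βᵀ)`
for that sample's `β`. Only the sample picked by `exists_component_nuc_le` is used, but which one
that is depends on `T` and `g`, so both are assumed good. -/
theorem eq_of_measurements {ι : Type*} {I₁ I₂ : Set ι} {x : ι → E} {β₁ β₂ g : E} {T : E →ₗ[ℝ] E}
    (hne : β₁ - β₂ ≠ 0)
    (h₁ : ∀ D : E →ₗ[ℝ] E, D.adjoint = D → hsNorm D = 1 →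
      nuc D ≤ 31 / √(‖β₁ - β₂‖ ^ 2 / (‖β₁‖ ^ 2 + ‖β₂‖ ^ 2)) →
      ∃ k : I₁, inner ℝ (x k) (D (x k)) ≠ 0)
    (h₂ : ∀ D : E →ₗ[ℝ] E, D.adjoint = D → hsNorm D = 1 →
      nuc D ≤ 31 / √(‖β₁ - β₂‖ ^ 2 / (‖β₁‖ ^ 2 + ‖β₂‖ ^ 2)) →
      ∃ k : I₂, inner ℝ (x k) (D (x k)) ≠ 0)
    (hT : T.adjoint = T) (hnuc : nuc T ≤ nuc (symRk β₁ β₂))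
    (hT₁ : ∀ i ∈ I₁, -inner ℝ (x i) (T (x i)) + 2 * inner ℝ (x i) β₁ * inner ℝ (x i) g -
      inner ℝ (x i) β₁ ^ 2 = 0)
    (hT₂ : ∀ i ∈ I₂, -inner ℝ (x i) (T (x i)) + 2 * inner ℝ (x i) β₂ * inner ℝ (x i) g -
      inner ℝ (x i) β₂ ^ 2 = 0) :
    T = symRk β₁ β₂ ∧ g = (1 / 2 : ℝ) • (β₁ + β₂) := by
  set H := T - symRk β₁ β₂ with hH
  set h := g - (1 / 2 : ℝ) • (β₁ + β₂) with hh
  have hHadj : H.adjoint = H := by rw [hH, map_sub, hT, adjoint_symRk]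
  have hquad : ∀ β x : E, inner ℝ x ((H - (rk β h + rk h β)) x) =
      inner ℝ x (T x) - inner ℝ x β₁ * inner ℝ x β₂ - 2 * inner ℝ x β * inner ℝ x g +
        inner ℝ x β * (inner ℝ x β₁ + inner ℝ x β₂) := by
    intro β x
    simp only [hH, hh, LinearMap.sub_apply, LinearMap.add_apply, rk_apply, inner_sub_right,
      inner_add_right, inner_smul_right, inner_symRk_apply, inner_sub_left, inner_smul_left,
      inner_add_left, conj_trivial]
    rw [real_inner_comm x β, real_inner_comm x g, real_inner_comm x β₁, real_inner_comm x β₂]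
    ring
  obtain ⟨β, hβ, hle, hzero⟩ := exists_component_nuc_le (h := h) (H := H) hne
    (by
      change nuc (symRk β₁ β₂ + H) ≤ nuc (symRk β₁ β₂)
      rwa [hH, add_sub_cancel])
  have hadj : (H - (rk β h + rk h β)).adjoint = H - (rk β h + rk h β) := by
    rw [map_sub, map_add, adjoint_rk, adjoint_rk, hHadj, add_comm (rk h β)]
  have hD : H - (rk β h + rk h β) = 0 := by
    rcases hβ with rfl | rfl
    · refine eq_zero_of_forall_measurement_eq_zero (x := fun k : I₁ => x k) h₁ hadj hle fun k => ?_
      rw [hquad]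
      linear_combination -(hT₁ k k.2)
    · refine eq_zero_of_forall_measurement_eq_zero (x := fun k : I₂ => x k) h₂ hadj hle fun k => ?_
      rw [hquad]
      linear_combination -(hT₂ k k.2)
  exact ⟨sub_eq_zero.1 (hzero hD).1, sub_eq_zero.1 (hzero hD).2⟩

theorem rk_self_sub_symRk (β₁ β₂ : E) :
    rk ((1 / 2 : ℝ) • (β₁ + β₂)) ((1 / 2 : ℝ) • (β₁ + β₂)) - symRk β₁ β₂ =
      (1 / 4 : ℝ) • rk (β₁ - β₂) (β₁ - β₂) := by
  ext z
  simp only [symRk, LinearMap.sub_apply, LinearMap.smul_apply, LinearMap.add_apply, rk_apply,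
    inner_smul_left, inner_add_left, inner_sub_left, conj_trivial]
  module

theorem hasEigenvalue_rk_self {δ : E} (hδ : δ ≠ 0) :
    End.HasEigenvalue ((1 / 4 : ℝ) • rk δ δ) (‖δ‖ ^ 2 / 4) := by
  refine End.hasEigenvalue_of_hasEigenvector (x := δ) (End.hasEigenvector_iff.2 ⟨?_, hδ⟩)
  rw [End.mem_eigenspace_iff, LinearMap.smul_apply, rk_apply, real_inner_self_eq_norm_sq,
    smul_smul]
  congr 1
  ring

theorem le_of_hasEigenvalue_rk_self {δ : E} {ν : ℝ}
    (h : End.HasEigenvalue ((1 / 4 : ℝ) • rk δ δ) ν) : ν ≤ ‖δ‖ ^ 2 / 4 := by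
  obtain ⟨w, hw⟩ := h.exists_hasEigenvector
  have h1 := congrArg (fun u => (inner ℝ w u : ℝ)) hw.apply_eq_smul
  simp only [LinearMap.smul_apply, rk_apply, inner_smul_right, real_inner_self_eq_norm_sq] at h1
  rw [real_inner_comm] at h1
  have h2 := real_inner_mul_inner_self_le δ w
  rw [real_inner_self_eq_norm_sq, real_inner_self_eq_norm_sq, real_inner_comm] at h2
  have hw0 : 0 < ‖w‖ ^ 2 := by have := norm_pos_iff.2 hw.2; positivity
  refine le_of_mul_le_mul_right ?_ hw0
  linarith

/-- A nonzero eigenvalue of a rank-one operator forces `v` to be parallel to `δ`, and `‖v‖ = 1`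
leaves only the sign free. -/
theorem sqrt_smul_eq_of_eigenpair {δ v : E} (hδ : δ ≠ 0) {lam : ℝ} (hv : ‖v‖ = 1)
    (hlam : ((1 / 4 : ℝ) • rk δ δ) v = lam • v) (hle : ‖δ‖ ^ 2 / 4 ≤ lam) :
    √lam • v = (1 / 2 : ℝ) • δ ∨ √lam • v = -((1 / 2 : ℝ) • δ) := by
  have hδ0 : 0 < ‖δ‖ := norm_pos_iff.2 hδ
  have hlam0 : 0 < lam := lt_of_lt_of_le (by positivity) hle
  rw [LinearMap.smul_apply, rk_apply, smul_smul] at hlam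
  have hval : lam = ‖δ‖ ^ 2 / 4 := by
    refine le_antisymm (le_of_hasEigenvalue_rk_self (δ := δ)
      (End.hasEigenvalue_of_hasEigenvector (x := v) (End.hasEigenvector_iff.2 ⟨?_, ?_⟩))) hle
    · rw [End.mem_eigenspace_iff, LinearMap.smul_apply, rk_apply, smul_smul, hlam]
    · rw [← norm_pos_iff, hv]; exact one_pos
  have hsqrt : √lam = ‖δ‖ / 2 := by
    rw [hval, show ‖δ‖ ^ 2 / 4 = (‖δ‖ / 2) ^ 2 by ring, Real.sqrt_sq (by positivity)]
  have hin : inner ℝ δ v ^ 2 = ‖δ‖ ^ 2 := by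
    have := congrArg (fun u => (inner ℝ v u : ℝ)) hlam
    simp only [inner_smul_right, real_inner_self_eq_norm_sq, hv, hval] at this
    rw [real_inner_comm δ v] at this
    linarith
  have hvδ : √lam • v = (inner ℝ δ v / (2 * ‖δ‖)) • δ := by
    have : v = lam⁻¹ • ((1 / 4 * inner ℝ δ v) • δ) := by
      rw [hlam, smul_smul, inv_mul_cancel₀ hlam0.ne', one_smul]
    conv_lhs => rw [this]
    rw [smul_smul, smul_smul, hsqrt, hval]
    congr 1
    field_simp
  rcases sq_eq_sq_iff_eq_or_eq_neg.1 hin with h | h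
  · left
    rw [hvδ, h]
    congr 1
    field_simp
  · right
    rw [hvδ, h, ← neg_smul]
    congr 1
    field_simp

end Recovery

/-! ### Translation between matrices and operators, and recovery for fixed data. -/

section Matrices

open Module

variable {p : ℕ}

theorem nuclearNorm_eq_nuc (K : Matrix (Fin p) (Fin p) ℝ) :
    nuclearNorm K = nuc (Matrix.toEuclideanLin K) := by
  rw [nuclearNorm, nuc, Fin.sum_univ_eq_sum_range (fun i => (Matrix.toEuclideanLin K).singularValues i),
    Fin.sum_univ_eq_sum_range (fun i => (Matrix.toEuclideanLin K).singularValues i),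
    finrank_euclideanSpace_fin]

theorem toEuclideanLin_vecMulVec (u v : EuclideanSpace ℝ (Fin p)) :
    Matrix.toEuclideanLin (Matrix.vecMulVec u.ofLp v.ofLp) = rk u v := by
  refine LinearMap.ext fun z => ?_
  ext i
  rw [rk_apply, Matrix.toLpLin_apply, Matrix.vecMulVec_mulVec, PiLp.inner_apply]
  simp [dotProduct, mul_comm]

theorem toEuclideanLin_symPart (K : Matrix (Fin p) (Fin p) ℝ) :
    Matrix.toEuclideanLin (symPart K) =
      (1 / 2 : ℝ) • (Matrix.toEuclideanLin K + (Matrix.toEuclideanLin K).adjoint) := by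
  rw [symPart, map_smul, map_add, ← Matrix.toEuclideanLin_conjTranspose_eq_adjoint,
    Matrix.conjTranspose_eq_transpose_of_trivial]

theorem matInner_outer (x : EuclideanSpace ℝ (Fin p)) (K : Matrix (Fin p) (Fin p) ℝ) :
    matInner (outer x) K = inner ℝ x (Matrix.toEuclideanLin K x) := by
  rw [matInner, outer, Matrix.transpose_vecMulVec, Matrix.vecMulVec_mul, Matrix.trace_vecMulVec,
    PiLp.inner_apply, Matrix.toLpLin_apply, dotProduct_comm,
    ← Matrix.dotProduct_mulVec]
  simp [dotProduct, mul_comm]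

theorem adjoint_symm_part {E : Type*} [NormedAddCommGroup E] [InnerProductSpace ℝ E]
    [FiniteDimensional ℝ E] (T : E →ₗ[ℝ] E) :
    ((1 / 2 : ℝ) • (T + T.adjoint)).adjoint = (1 / 2 : ℝ) • (T + T.adjoint) := by
  simp [add_comm]

theorem inner_symm_part_apply {E : Type*} [NormedAddCommGroup E] [InnerProductSpace ℝ E]
    [FiniteDimensional ℝ E] (T : E →ₗ[ℝ] E) (x : E) :
    inner ℝ x (((1 / 2 : ℝ) • (T + T.adjoint)) x) = inner ℝ x (T x) := by
  rw [LinearMap.smul_apply, LinearMap.add_apply, inner_smul_right, inner_add_right,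
    LinearMap.adjoint_inner_right, real_inner_comm x (T x)]
  ring

theorem isFeasible_zero_iff {n : ℕ} {x : Fin n → EuclideanSpace ℝ (Fin p)} {y : Fin n → ℝ}
    {K : Matrix (Fin p) (Fin p) ℝ} {g : EuclideanSpace ℝ (Fin p)} :
    IsFeasible x y 0 K g ↔ ∀ i, -inner ℝ (x i) (Matrix.toEuclideanLin K (x i)) +
      2 * y i * inner ℝ (x i) g - y i ^ 2 = 0 := by
  have h0 : ∀ i ∈ Finset.univ, 0 ≤ |-matInner (outer (x i)) K + 2 * y i * inner ℝ (x i) g - y i ^ 2| :=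
    fun i _ => abs_nonneg _
  rw [IsFeasible, (Finset.sum_nonneg h0).ge_iff_eq', Finset.sum_eq_zero_iff_of_nonneg h0]
  simp only [Finset.mem_univ, true_implies, abs_eq_zero, matInner_outer]

/-- The matrix handed to the eigenvalue step is `δ δᵀ / 4`. Both signs of the unit eigenvector are
allowed, so both orders of the output occur. -/
theorem isAlgorithmOutput_iff {β₁ β₂ : EuclideanSpace ℝ (Fin p)} (hne : β₁ - β₂ ≠ 0)
    {K : Matrix (Fin p) (Fin p) ℝ} (hK : Matrix.toEuclideanLin K = symRk β₁ β₂)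
    {b₁ b₂ : EuclideanSpace ℝ (Fin p)} :
    IsAlgorithmOutput K ((1 / 2 : ℝ) • (β₁ + β₂)) b₁ b₂ ↔
      (b₁ = β₁ ∧ b₂ = β₂) ∨ (b₁ = β₂ ∧ b₂ = β₁) := by
  set δ := β₁ - β₂ with hδ
  have hJ : Matrix.toEuclideanLin (outer ((1 / 2 : ℝ) • (β₁ + β₂)) - K) =
      (1 / 4 : ℝ) • rk δ δ := by
    rw [map_sub, hK, outer, toEuclideanLin_vecMulVec, rk_self_sub_symRk]
  have hp : (1 / 2 : ℝ) • (β₁ + β₂) + (1 / 2 : ℝ) • δ = β₁ := by rw [hδ]; module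
  have hm : (1 / 2 : ℝ) • (β₁ + β₂) - (1 / 2 : ℝ) • δ = β₂ := by rw [hδ]; module
  have hδ0 : 0 < ‖δ‖ := norm_pos_iff.2 hne
  simp only [IsAlgorithmOutput, IsFirstEigenpair, hJ]
  constructor
  · rintro ⟨lam, v, ⟨hv, hlam, hmax⟩, rfl, rfl⟩
    rcases sqrt_smul_eq_of_eigenpair hne hv hlam (hmax _ (hasEigenvalue_rk_self hne)) with h | h
    · left; rw [h]; exact ⟨hp, hm⟩
    · right; rw [h, sub_neg_eq_add, ← sub_eq_add_neg]; exact ⟨hm, hp⟩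
  · have hsqrt : √(‖δ‖ ^ 2 / 4) = ‖δ‖ / 2 := by
      rw [show ‖δ‖ ^ 2 / 4 = (‖δ‖ / 2) ^ 2 by ring, Real.sqrt_sq (by positivity)]
    have hpair : ∀ c : ℝ, |c| = 1 → ‖(c / ‖δ‖) • δ‖ = 1 ∧
        ((1 / 4 : ℝ) • rk δ δ) ((c / ‖δ‖) • δ) = (‖δ‖ ^ 2 / 4) • ((c / ‖δ‖) • δ) := by
      intro c hc
      refine ⟨?_, ?_⟩
      · rw [norm_smul, norm_div, norm_norm, Real.norm_eq_abs, hc]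
        field_simp
      · rw [LinearMap.smul_apply, rk_apply, inner_smul_right, real_inner_self_eq_norm_sq,
          smul_smul, smul_smul]
        congr 1
        ring
    have hhalf : √(‖δ‖ ^ 2 / 4) • ((1 / ‖δ‖) • δ) = (1 / 2 : ℝ) • δ := by
      rw [hsqrt, smul_smul]
      congr 1
      field_simp
    have hhalf' : √(‖δ‖ ^ 2 / 4) • ((-1 / ‖δ‖) • δ) = -((1 / 2 : ℝ) • δ) := by
      rw [← hhalf, neg_div, neg_smul, smul_neg]
    rintro (⟨rfl, rfl⟩ | ⟨rfl, rfl⟩)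
    · obtain ⟨h1, h2⟩ := hpair 1 abs_one
      exact ⟨_, _, ⟨h1, h2, fun ν hν => le_of_hasEigenvalue_rk_self hν⟩,
        by rw [hhalf, hp], by rw [hhalf, hm]⟩
    · obtain ⟨h1, h2⟩ := hpair (-1) (by simp)
      exact ⟨_, _, ⟨h1, h2, fun ν hν => le_of_hasEigenvalue_rk_self hν⟩,
        by rw [hhalf', ← sub_eq_add_neg, hm], by rw [hhalf', sub_neg_eq_add, hp]⟩

/-- Exact recovery for a fixed data set. -/
theorem isEstimate_iff {n : ℕ} {x : Fin n → EuclideanSpace ℝ (Fin p)} {y : Fin n → ℝ}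
    {β₁ β₂ : EuclideanSpace ℝ (Fin p)} {I₁ I₂ : Finset (Fin n)} (hI : IsCompl I₁ I₂)
    (hy : IsObservation β₁ β₂ I₁ I₂ 0 x y) (hne : β₁ - β₂ ≠ 0)
    (h₁ : ∀ D : EuclideanSpace ℝ (Fin p) →ₗ[ℝ] EuclideanSpace ℝ (Fin p), D.adjoint = D →
      hsNorm D = 1 → nuc D ≤ 31 / √(alpha β₁ β₂) → ∃ k ∈ I₁, inner ℝ (x k) (D (x k)) ≠ 0)
    (h₂ : ∀ D : EuclideanSpace ℝ (Fin p) →ₗ[ℝ] EuclideanSpace ℝ (Fin p), D.adjoint = D →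
      hsNorm D = 1 → nuc D ≤ 31 / √(alpha β₁ β₂) → ∃ k ∈ I₂, inner ℝ (x k) (D (x k)) ≠ 0)
    {b₁ b₂ : EuclideanSpace ℝ (Fin p)} :
    IsEstimate x y 0 b₁ b₂ ↔ (b₁ = β₁ ∧ b₂ = β₂) ∨ (b₁ = β₂ ∧ b₂ = β₁) := by
  have hy₁ : ∀ i ∈ I₁, y i = inner ℝ (x i) β₁ := fun i hi => by simpa using hy.1 i hi
  have hy₂ : ∀ i ∈ I₂, y i = inner ℝ (x i) β₂ := fun i hi => by simpa using hy.2 i hi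
  have huniv : ∀ i, i ∈ I₁ ∨ i ∈ I₂ := fun i => by
    have : i ∈ I₁ ⊔ I₂ := by rw [hI.sup_eq_top]; exact Finset.mem_univ i
    exact Finset.mem_union.1 this
  set Ks : Matrix (Fin p) (Fin p) ℝ := (1 / 2 : ℝ) •
    (Matrix.vecMulVec β₁.ofLp β₂.ofLp + Matrix.vecMulVec β₂.ofLp β₁.ofLp) with hKs
  have hKlin : Matrix.toEuclideanLin Ks = symRk β₁ β₂ := by
    rw [hKs, map_smul, map_add, toEuclideanLin_vecMulVec, toEuclideanLin_vecMulVec, symRk]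
  have hKsym : Matrix.toEuclideanLin (symPart Ks) = symRk β₁ β₂ := by
    rw [toEuclideanLin_symPart, hKlin, adjoint_symRk]
    module
  have hfeas : IsFeasible x y 0 Ks ((1 / 2 : ℝ) • (β₁ + β₂)) := by
    refine isFeasible_zero_iff.2 fun i => ?_
    rw [hKlin, inner_symRk_apply, inner_smul_right, inner_add_right]
    rcases huniv i with hi | hi
    · rw [hy₁ i hi]; ring
    · rw [hy₂ i hi]; ring
  have huniq : ∀ K g, IsFeasible x y 0 K g → nuclearNorm K ≤ nuclearNorm Ks →
      Matrix.toEuclideanLin (symPart K) = symRk β₁ β₂ ∧ g = (1 / 2 : ℝ) • (β₁ + β₂) := by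
    intro K g hf hle
    rw [isFeasible_zero_iff] at hf
    rw [nuclearNorm_eq_nuc, nuclearNorm_eq_nuc, hKlin] at hle
    rw [toEuclideanLin_symPart]
    refine eq_of_measurements (I₁ := I₁) (I₂ := I₂) (x := x) hne
      (fun D a b c => ?_) (fun D a b c => ?_) (adjoint_symm_part _) ((nuc_symm_le _).trans hle)
      (fun i hi => ?_) (fun i hi => ?_)
    · obtain ⟨k, hk, hk'⟩ := h₁ D a b c
      exact ⟨⟨k, hk⟩, hk'⟩
    · obtain ⟨k, hk, hk'⟩ := h₂ D a b c
      exact ⟨⟨k, hk⟩, hk'⟩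
    · rw [inner_symm_part_apply, ← hy₁ i hi]; exact hf i
    · rw [inner_symm_part_apply, ← hy₂ i hi]; exact hf i
  constructor
  · rintro ⟨K, g, ⟨hf, hopt⟩, hout⟩
    obtain ⟨hK, rfl⟩ := huniq K g hf (hopt _ _ hfeas)
    exact (isAlgorithmOutput_iff hne hK).1 hout
  · intro hb
    -- Existence of an optimum needs no compactness: any feasible `K` no worse than `Ks` has the
    -- operator of `Ks` as its symmetric part, and symmetrizing does not increase the nuclear norm.
    refine ⟨Ks, _, ⟨hfeas, fun K g hf => ?_⟩, (isAlgorithmOutput_iff hne hKsym).2 hb⟩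
    rcases le_total (nuclearNorm Ks) (nuclearNorm K) with h | h
    · exact h
    · have hK := (huniq K g hf h).1
      rw [toEuclideanLin_symPart] at hK
      rw [nuclearNorm_eq_nuc, nuclearNorm_eq_nuc, hKlin, ← hK]
      exact nuc_symm_le _

theorem alpha_le_two (β₁ β₂ : EuclideanSpace ℝ (Fin p)) : alpha β₁ β₂ ≤ 2 := by
  refine div_le_of_le_mul₀ (by positivity) zero_le_two ?_
  have h := parallelogram_law_with_norm ℝ β₁ β₂
  nlinarith [norm_nonneg (β₁ + β₂)]

end Matrices

/-! ### Restriction of the design to one of the two samples. -/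

section Subsample

theorem IsDesign.exists_subsample_inner_ne_zero {Ω : Type*} [MeasurableSpace Ω] {P : Measure Ω}
    [IsProbabilityMeasure P] {n p : ℕ} {x : Fin n → Ω → EuclideanSpace ℝ (Fin p)} {μ : ℝ} {κ : ℝ≥0}
    (h : IsDesign P x μ κ) (I : Finset (Fin n)) {L b : ℝ}
    (hgood : ∀ x : Fin I.card → Ω → EuclideanSpace ℝ (Fin p), (∀ k, Measurable (x k)) →
      ProbabilityTheory.iIndepFun x P → (∀ k, IsRow P (fun l ω => x k ω l) μ κ) →
      ∃ B : Set Ω, MeasurableSet B ∧ P.real B ≤ b ∧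
        ∀ ω ∉ B, ∀ D : EuclideanSpace ℝ (Fin p) →ₗ[ℝ] EuclideanSpace ℝ (Fin p),
          D.adjoint = D → hsNorm D = 1 → nuc D ≤ L → ∃ k, inner ℝ (x k ω) (D (x k ω)) ≠ 0) :
    ∃ B : Set Ω, MeasurableSet B ∧ P.real B ≤ b ∧
      ∀ ω ∉ B, ∀ D : EuclideanSpace ℝ (Fin p) →ₗ[ℝ] EuclideanSpace ℝ (Fin p),
        D.adjoint = D → hsNorm D = 1 → nuc D ≤ L → ∃ k ∈ I, inner ℝ (x k ω) (D (x k ω)) ≠ 0 := by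
  set e := I.orderEmbOfFin rfl with he
  obtain ⟨B, hB, hBb, hBD⟩ := hgood (fun k => x (e k)) (fun k => h.measurable _)
    (h.iIndepFun.precomp e.injective) fun k => h.isRow _
  refine ⟨B, hB, hBb, fun ω hω D h1 h2 h3 => ?_⟩
  obtain ⟨k, hk⟩ := hBD ω hω D h1 h2 h3
  exact ⟨e k, I.orderEmbOfFin_mem rfl k, hk⟩

end Subsample

end MixedRegression

/-! ### Union over the two samples and choice of constants. -/

theorem corollary1 (μ : ℝ) (hμ : 1 < μ) (κ : NNReal) (R : ℝ) :
    ∃ c₁ c₂ c₃ : ℝ, 0 < c₁ ∧ 0 < c₂ ∧ 0 < c₃ ∧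
      ∀ (Ω : Type*) [MeasurableSpace Ω] (P : Measure Ω) [IsProbabilityMeasure P]
        (n p : ℕ) (x : Fin n → Ω → EuclideanSpace ℝ (Fin p)) (y : Fin n → Ω → ℝ)
        (β₁ β₂ : EuclideanSpace ℝ (Fin p)) (I₁ I₂ : Finset (Fin n)),
        MixedRegression.IsDesign P x μ κ →
        IsCompl I₁ I₂ →
        (∀ ω, MixedRegression.IsObservation β₁ β₂ I₁ I₂ 0 (fun i => x i ω) (fun i => y i ω)) →
        (I₁.card : ℝ) ≤ R * I₂.card →
        (I₂.card : ℝ) ≤ R * I₁.card →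
        0 < MixedRegression.alpha β₁ β₂ →
        c₃ * (1 / MixedRegression.alpha β₁ β₂) * p ≤ (min I₁.card I₂.card : ℕ) →
        ∃ E : Set Ω, MeasurableSet E ∧ 1 - c₁ * Real.exp (-c₂ * n) ≤ P.real E ∧
          ∀ ω ∈ E,
            (∃ b₁ b₂, MixedRegression.IsEstimate (fun i => x i ω) (fun i => y i ω) 0 b₁ b₂) ∧
            ∀ b₁ b₂, MixedRegression.IsEstimate (fun i => x i ω) (fun i => y i ω) 0 b₁ b₂ →
              ({b₁, b₂} : Set (EuclideanSpace ℝ (Fin p))) = {β₁, β₂} := by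
  obtain ⟨c₂, c₃, hc₂, hc₃, hgood⟩ := MixedRegression.exists_forall_exists_inner_ne_zero μ hμ κ
  -- 2 counts the bad events, one per sample; `n ≤ (1 + |R|) n_b` converts the exponent from `n_b`
  -- to `n`; and `31 ^ 2` comes from `L ^ 2 = 31 ^ 2 / α`.
  refine ⟨2, c₂ / (1 + |R|), c₃ * 31 ^ 2, two_pos, by positivity, by positivity, ?_⟩
  intro Ω _ P _ n p x y β₁ β₂ I₁ I₂ hdes hI hobs hR₁ hR₂ hα hn
  have hne : β₁ - β₂ ≠ 0 := by
    intro h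
    simp [MixedRegression.alpha, h] at hα
  have hp : 0 < p := by
    rcases Nat.eq_zero_or_pos p with rfl | hp
    · exact absurd (Subsingleton.elim _ _) hne
    · exact hp
  have hsqrt : 0 < √(MixedRegression.alpha β₁ β₂) := Real.sqrt_pos.2 hα
  have hL : 1 ≤ 31 / √(MixedRegression.alpha β₁ β₂) := by
    rw [one_le_div hsqrt]
    refine (Real.sqrt_le_left (by norm_num)).2 ?_
    linarith [MixedRegression.alpha_le_two β₁ β₂]
  have hcard : (I₁.card : ℝ) + I₂.card = n := by
    have := Finset.card_add_card_compl I₁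
    rw [hI.compl_eq, Fintype.card_fin] at this
    exact_mod_cast this
  have hsub : ∀ I : Finset (Fin n), min I₁.card I₂.card ≤ I.card → (n : ℝ) ≤ (1 + |R|) * I.card →
      ∃ B : Set Ω, MeasurableSet B ∧ P.real B ≤ Real.exp (-(c₂ / (1 + |R|)) * n) ∧
        ∀ ω ∉ B, ∀ D : EuclideanSpace ℝ (Fin p) →ₗ[ℝ] EuclideanSpace ℝ (Fin p),
          D.adjoint = D → MixedRegression.hsNorm D = 1 →
          MixedRegression.nuc D ≤ 31 / √(MixedRegression.alpha β₁ β₂) →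
          ∃ k ∈ I, inner ℝ (x k ω) (D (x k ω)) ≠ 0 := by
    intro I hmin hIn
    refine hdes.exists_subsample_inner_ne_zero I fun x' h1 h2 h3 => ?_
    obtain ⟨B, hB, hBb, hBD⟩ := hgood P x' h1 h2 h3 hL hp (by
      rw [div_pow, Real.sq_sqrt hα.le]
      calc c₃ * (31 ^ 2 / MixedRegression.alpha β₁ β₂) * (p : ℝ)
          = c₃ * 31 ^ 2 * (1 / MixedRegression.alpha β₁ β₂) * p := by ring
        _ ≤ ((min I₁.card I₂.card : ℕ) : ℝ) := hn
        _ ≤ (I.card : ℝ) := by exact_mod_cast hmin)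
    refine ⟨B, hB, hBb.trans (Real.exp_le_exp.2 ?_), hBD⟩
    rw [neg_mul, neg_mul, neg_le_neg_iff, div_mul_eq_mul_div, div_le_iff₀ (by positivity)]
    calc c₂ * n ≤ c₂ * ((1 + |R|) * I.card) := by gcongr
      _ = _ := by ring
  have hRabs : R ≤ |R| := le_abs_self R
  obtain ⟨B₁, hB₁, hb₁, hD₁⟩ := hsub I₁ (min_le_left _ _) (by
    have := mul_le_mul_of_nonneg_right hRabs (Nat.cast_nonneg (α := ℝ) I₁.card)
    linarith)
  obtain ⟨B₂, hB₂, hb₂, hD₂⟩ := hsub I₂ (min_le_right _ _) (by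
    have := mul_le_mul_of_nonneg_right hRabs (Nat.cast_nonneg (α := ℝ) I₂.card)
    linarith)
  refine ⟨(B₁ ∪ B₂)ᶜ, (hB₁.union hB₂).compl, ?_, fun ω hω => ?_⟩
  · rw [probReal_compl_eq_one_sub (hB₁.union hB₂)]
    linarith [measureReal_union_le (μ := P) B₁ B₂]
  · rw [Set.mem_compl_iff, Set.mem_union, not_or] at hω
    have hiff := fun b₁ b₂ => MixedRegression.isEstimate_iff hI (hobs ω) hne (hD₁ ω hω.1)
      (hD₂ ω hω.2) (b₁ := b₁) (b₂ := b₂)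
    refine ⟨⟨β₁, β₂, (hiff _ _).2 (Or.inl ⟨rfl, rfl⟩)⟩, fun b₁ b₂ hb => ?_⟩
    rcases (hiff _ _).1 hb with ⟨rfl, rfl⟩ | ⟨rfl, rfl⟩
    · rfl
    · exact Set.pair_comm _ _
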